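/- **Theorem (orbifold Moser).** Let $N$ be a closed (i.e. compact Hausdorff, without boundary) real orbifold of dimension $n\ge 2$, and let $\omega_t$, $t\in[0,1]$, be a smooth family of orbifold symplectic forms on $N$ all lying in the same de Rham cohomology class, i.e. for all $s,t\in[0,1]$ there is an orbifold $1$-form $\eta$ with $\omega_t-\omega_s=d\eta$. Then there exists a smooth family of orbifold diffeomorphisms $\Psi_t:N\to N$, $t\in[0,1]$, such that $\Psi_t^*\omega_0=\omega_t$ for all $t\in[0,1]$. Conventions. An orbifold chart on $N$ consists of a connected open set $U_\alpha\subset N$, a connected open neighbourhood $\tilde U_\alpha$ of $0$ in $\mathbb R^n$, a finite group $\Gamma_\alpha$ acting effectively and linearly on $\mathbb R^n$, preserving $\tilde U_\alpha$ and such that the set of points with non-trivial stabilizer has codimension at least $2$, and a homeomorphism $U_\alpha\to\tilde U_\alpha/\Gamma_\alpha$. An orbifold atlas is a collection of such charts covering $N$, such that every finite intersection of chart domains $U_\alpha$ is a union of chart domains, and such that whenever $U_\alpha\subset U_\beta$ there is a smooth embedding $\tilde U_\alpha\to\tilde U_\beta$ that covers the inclusion and is equivariant with respect to an injective homomorphism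 $\Gamma_\alpha\to\Gamma_\beta$. An orbifold structure is a maximal orbifold atlas. An orbifold $k$-form is a collection of smooth $\Gamma_\alpha$-invariant $k$-forms on the $\tilde U_\alpha$ that correspond to each other under these embeddings; its differential, closedness and non-degeneracy are understood in charts, and an orbifold symplectic form is a closed non-degenerate orbifold $2$-form. A family $\omega_t$ is smooth if in each chart it is smooth in $(t,x)\in[0,1]\times\tilde U_\alpha$. A map $f:N\to N$ is orbifold smooth if, near every point of every $\tilde U_\alpha$ and for every chart $\beta$ around the image of that point, it has a smooth lift to $\tilde U_\beta$ defined on a neighbourhood invariant under the stabilizer of the point and equivariant with respect to a homomorphism from this stabilizer to $\Gamma_\beta$; an orbifold diffeomorphism is a bijection that is orbifold smooth together with its inverse; a family $\Psi_t$ of orbifold diffeomorphisms is smooth if it has such local lifts depending smoothly on $(t,x)$, equivariant with respect to a homomorphism independent of $t$. The pullback $\Psi_t^*\omega_0$ is computed by means of the local lifts. -/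

import Mathlib

open Set Function
open scoped ContDiff Topology

/-- The model Euclidean space `ℝⁿ`. -/
abbrev OrbModel (n : ℕ) : Type := EuclideanSpace ℝ (Fin n)

/-- An `n`-dimensional real orbifold chart on the topological space `N`.

The effective linear action of a finite group is given by a finite subgroup `Γ` of `GL(ℝⁿ)`.
The homeomorphism from the chart domain `U ⊆ N` to `dom / Γ` is recorded through the composite
`proj : dom → dom / Γ ≃ U ⊆ N`: a continuous open map whose fibres are exactly the `Γ`-orbits
(see `OrbifoldChart.quotientHomeo`). Values of `proj` outside `dom` are irrelevant. -/
structure OrbifoldChart (n : ℕ) (N : Type*) [TopologicalSpace N] where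
  /-- the open connected neighbourhood of the origin in `ℝⁿ` -/
  dom : Set (OrbModel n)
  isOpen_dom : IsOpen dom
  isConnected_dom : IsConnected dom
  zero_mem_dom : (0 : OrbModel n) ∈ dom
  /-- the finite linear group -/
  Γ : Subgroup (OrbModel n ≃L[ℝ] OrbModel n)
  finite_Γ : Finite Γ
  smul_mem_dom : ∀ γ ∈ Γ, ∀ x ∈ dom, γ x ∈ dom
  /-- the set of points with non-trivial stabilizer has codimension at least two: each
  `γ ≠ 1` fixes a linear subspace of codimension at least two -/
  codim_fixed : ∀ γ ∈ Γ, γ ≠ 1 →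
    Module.finrank ℝ
      (LinearMap.ker ((γ : OrbModel n →L[ℝ] OrbModel n).toLinearMap - LinearMap.id)) + 2 ≤ n
  /-- the quotient map onto the chart domain in `N` -/
  proj : OrbModel n → N
  continuousOn_proj : ContinuousOn proj dom
  isOpen_image_proj : ∀ V : Set (OrbModel n), IsOpen V → V ⊆ dom → IsOpen (proj '' V)
  proj_eq_iff : ∀ x ∈ dom, ∀ y ∈ dom, proj x = proj y ↔ ∃ γ ∈ Γ, γ x = y

namespace OrbifoldChart

variable {n : ℕ} {N : Type*} [TopologicalSpace N]

/-- The open subset `U` of `N` covered by the chart. -/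
def U (α : OrbifoldChart n N) : Set N := α.proj '' α.dom

theorem isOpen_U (α : OrbifoldChart n N) : IsOpen α.U :=
  α.isOpen_image_proj _ α.isOpen_dom Subset.rfl

theorem isConnected_U (α : OrbifoldChart n N) : IsConnected α.U :=
  α.isConnected_dom.image _ α.continuousOn_proj

/-- The orbit equivalence relation of `Γ` on `dom`. -/
def orbitSetoid (α : OrbifoldChart n N) : Setoid α.dom where
  r x y := ∃ γ ∈ α.Γ, γ (x : OrbModel n) = y
  iseqv :=
    { refl := fun x => ⟨1, α.Γ.one_mem, rfl⟩
      symm := fun {x y} h => by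
        have h' := (α.proj_eq_iff x x.2 y y.2).2 h
        exact (α.proj_eq_iff y y.2 x x.2).1 h'.symm
      trans := fun {x y z} h k => by
        have h' := (α.proj_eq_iff x x.2 y y.2).2 h
        have k' := (α.proj_eq_iff y y.2 z z.2).2 k
        exact (α.proj_eq_iff x x.2 z z.2).1 (h'.trans k') }

/-- The homeomorphism `φ : U → dom / Γ` of an orbifold chart. -/
noncomputable def quotientHomeo (α : OrbifoldChart n N) : α.U ≃ₜ Quotient α.orbitSetoid :=
  let p : α.dom → α.U := fun x => ⟨α.proj x, mem_image_of_mem _ x.2⟩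
  have hp : Continuous p := α.continuousOn_proj.domRestrict.subtype_mk _
  let q : Quotient α.orbitSetoid → α.U :=
    Quotient.lift p fun x y h => Subtype.ext ((α.proj_eq_iff x x.2 y y.2).2 h)
  have hq : Continuous q := hp.quotient_lift _
  have hbij : Bijective q := by
    constructor
    · rintro ⟨x⟩ ⟨y⟩ h
      exact Quotient.sound ((α.proj_eq_iff x x.2 y y.2).1 (congrArg Subtype.val h))
    · rintro ⟨_, x, hx, rfl⟩
      exact ⟨Quotient.mk _ ⟨x, hx⟩, rfl⟩
  have hopen : IsOpenMap q := by
    intro V hV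
    have h1 : IsOpen ((fun x : α.dom => (Quotient.mk α.orbitSetoid x)) ⁻¹' V) :=
      hV.preimage continuous_quotient_mk'
    have h2 := α.isOpen_image_proj _ (α.isOpen_dom.isOpenMap_subtype_val _ h1)
      (by rintro _ ⟨x, _, rfl⟩; exact x.2)
    have h3 : q '' V = Subtype.val ⁻¹' (α.proj '' (Subtype.val ''
        ((fun x : α.dom => (Quotient.mk α.orbitSetoid x)) ⁻¹' V))) := by
      ext u
      constructor
      · rintro ⟨⟨x⟩, hx, rfl⟩
        exact ⟨x, ⟨x, hx, rfl⟩, rfl⟩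
      · rintro ⟨_, ⟨x, hx, rfl⟩, hu⟩
        exact ⟨Quotient.mk _ x, hx, Subtype.ext hu⟩
    rw [h3]
    exact h2.preimage continuous_subtype_val
  ((Equiv.ofBijective q hbij).toHomeomorphOfContinuousOpen hq hopen).symm

/-- `φ : dom_α → dom_β` is a smooth embedding of charts: it is a smooth injective immersion
(in equal dimensions this is automatically a diffeomorphism onto an open subset), it is
equivariant with respect to an injective homomorphism `Γ_α → Γ_β`, and it covers the inclusion
of `U_α` in `U_β`. -/
structure IsEmbedding (α β : OrbifoldChart n N) (φ : OrbModel n → OrbModel n) : Prop where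
  mapsTo : MapsTo φ α.dom β.dom
  contDiffOn : ContDiffOn ℝ ∞ φ α.dom
  injOn : InjOn φ α.dom
  immersion : ∀ x ∈ α.dom, Injective (fderiv ℝ φ x)
  equivariant : ∃ f : α.Γ →* β.Γ, Injective f ∧
    ∀ γ : α.Γ, ∀ x ∈ α.dom, φ (γ.1 x) = (f γ).1 (φ x)
  covers : ∀ x ∈ α.dom, β.proj (φ x) = α.proj x

end OrbifoldChart

/-- A real orbifold atlas of dimension `n` on `N`. The condition `inter` says, pointwise, that
`U_α ∩ U_β` is a union of chart domains; with `cover` this is the same as all finite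
intersections of chart domains being unions of chart domains. -/
structure IsOrbifoldAtlas {n : ℕ} {N : Type*} [TopologicalSpace N]
    (A : Set (OrbifoldChart n N)) : Prop where
  cover : ∀ p : N, ∃ α ∈ A, p ∈ α.U
  inter : ∀ α ∈ A, ∀ β ∈ A, ∀ p ∈ α.U ∩ β.U, ∃ γ ∈ A, p ∈ γ.U ∧ γ.U ⊆ α.U ∩ β.U
  embed : ∀ α ∈ A, ∀ β ∈ A, α.U ⊆ β.U → ∃ φ, α.IsEmbedding β φ

/-- An orbifold structure of dimension `n` on the space `N`: a maximal orbifold atlas. -/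
structure OrbifoldStructure (n : ℕ) (N : Type*) [TopologicalSpace N] where
  charts : Set (OrbifoldChart n N)
  isAtlas : IsOrbifoldAtlas charts
  maximal : ∀ A : Set (OrbifoldChart n N), IsOrbifoldAtlas A → charts ⊆ A → A = charts

/-- An orbifold smooth differential `k`-form: a smooth `Γ_α`-invariant form on every `dom_α`,
such that the embeddings of charts glue these forms. Values outside `dom_α` are irrelevant. -/
structure OrbifoldForm {n : ℕ} {N : Type*} [TopologicalSpace N]
    (X : OrbifoldStructure n N) (k : ℕ) where
  form : X.charts → OrbModel n → (OrbModel n) [⋀^Fin k]→L[ℝ] ℝ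
  smooth : ∀ α : X.charts, ContDiffOn ℝ ∞ (form α) α.1.dom
  invariant : ∀ α : X.charts, ∀ γ ∈ α.1.Γ, ∀ x ∈ α.1.dom,
    (form α (γ x)).compContinuousLinearMap (γ : OrbModel n →L[ℝ] OrbModel n) = form α x
  glue : ∀ α β : X.charts, ∀ φ, α.1.IsEmbedding β.1 φ → ∀ x ∈ α.1.dom,
    (form β (φ x)).compContinuousLinearMap (fderiv ℝ φ x) = form α x

namespace OrbifoldForm

variable {n : ℕ} {N : Type*} [TopologicalSpace N] {X : OrbifoldStructure n N}

/-- An orbifold symplectic form: a closed non-degenerate orbifold `2`-form. -/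
structure IsSymplectic (Ω : OrbifoldForm X 2) : Prop where
  closed : ∀ α : X.charts, ∀ x ∈ α.1.dom, extDeriv (Ω.form α) x = 0
  nondegenerate : ∀ α : X.charts, ∀ x ∈ α.1.dom, ∀ v : OrbModel n,
    (∀ w : OrbModel n, Ω.form α x ![v, w] = 0) → v = 0

/-- Two (closed) orbifold `(k+1)`-forms lie in the same de Rham cohomology class: their
difference is the differential of an orbifold `k`-form. -/
def Cohomologous {k : ℕ} (Ω Ω' : OrbifoldForm X (k + 1)) : Prop :=
  ∃ η : OrbifoldForm X k, ∀ α : X.charts, ∀ x ∈ α.1.dom,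
    Ω'.form α x - Ω.form α x = extDeriv (η.form α) x

/-- The family of orbifold forms `Ω t`, `t ∈ [0,1]`, is smooth: in every chart it depends smoothly
on `(t, x) ∈ [0,1] × dom`. -/
def IsSmoothFamily {k : ℕ} (Ω : ℝ → OrbifoldForm X k) : Prop :=
  ∀ α : X.charts, ContDiffOn ℝ ∞
    (fun p : ℝ × OrbModel n => (Ω p.1).form α p.2) (Icc 0 1 ×ˢ α.1.dom)

end OrbifoldForm

section Maps

variable {n m : ℕ} {N M : Type*} [TopologicalSpace N] [TopologicalSpace M]

/-- The stabilizer in `Γ_α` of the point `x` of `ℝⁿ`. -/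
def OrbifoldChart.stab (α : OrbifoldChart n N) (x : OrbModel n) : Subgroup α.Γ where
  carrier := {γ | γ.1 x = x}
  one_mem' := rfl
  mul_mem' := fun {a b} (ha : a.1 x = x) (hb : b.1 x = x) =>
    show a.1 (b.1 x) = x by rw [hb, ha]
  inv_mem' := fun {a} (ha : a.1 x = x) =>
    show a.1.symm x = x by rw [ContinuousLinearEquiv.symm_apply_eq, ha]

/-- `F` is a smooth lift to `W ⊆ dom_α` and `dom_β` of the map `f : N → M`. -/
structure IsSmoothLift (f : N → M) (α : OrbifoldChart n N) (β : OrbifoldChart m M)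
    (W : Set (OrbModel n)) (F : OrbModel n → OrbModel m) : Prop where
  mapsTo : MapsTo F W β.dom
  contDiffOn : ContDiffOn ℝ ∞ F W
  covers : ∀ x ∈ W, β.proj (F x) = f (α.proj x)

/-- `f : N → M` is an orbifold smooth map: near every point `x` of every chart `α` on `N`, and for
every chart `β` on `M` around the image point, it has a smooth lift on a neighbourhood `W` of `x`
invariant under the stabilizer of `x`, equivariant with respect to a homomorphism from this
stabilizer to `Γ_β`. -/
def IsOrbifoldSmooth (X : OrbifoldStructure n N) (Y : OrbifoldStructure m M) (f : N → M) : Prop :=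
  ∀ (α : X.charts) (β : Y.charts), ∀ x ∈ α.1.dom, f (α.1.proj x) ∈ β.1.U →
    ∃ (W : Set (OrbModel n)) (F : OrbModel n → OrbModel m) (θ : α.1.stab x →* β.1.Γ),
      IsOpen W ∧ x ∈ W ∧ W ⊆ α.1.dom ∧ IsSmoothLift f α.1 β.1 W F ∧
      ∀ γ : α.1.stab x, ∀ y ∈ W, γ.1.1 y ∈ W ∧ F (γ.1.1 y) = (θ γ).1 (F y)

/-- An orbifold diffeomorphism: a bijection that is orbifold smooth in both directions. -/
structure OrbifoldDiffeo (X : OrbifoldStructure n N) (Y : OrbifoldStructure m M)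
    extends N ≃ M where
  smooth_toFun : IsOrbifoldSmooth X Y toFun
  smooth_invFun : IsOrbifoldSmooth Y X invFun

/-- The family `Ψ t`, `t ∈ [0,1]`, of orbifold diffeomorphisms is smooth: locally it has
equivariant lifts `F t x` as above which depend smoothly on `(t, x)`. -/
def OrbifoldDiffeo.IsSmoothFamily {X : OrbifoldStructure n N} {Y : OrbifoldStructure m M}
    (Ψ : ℝ → OrbifoldDiffeo X Y) : Prop :=
  ∀ (α : X.charts) (β : Y.charts), ∀ t ∈ Icc (0 : ℝ) 1, ∀ x ∈ α.1.dom,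
    (Ψ t).toEquiv (α.1.proj x) ∈ β.1.U →
    ∃ (J : Set ℝ) (W : Set (OrbModel n)) (F : ℝ → OrbModel n → OrbModel m)
      (θ : α.1.stab x →* β.1.Γ),
      IsOpen J ∧ t ∈ J ∧ IsOpen W ∧ x ∈ W ∧ W ⊆ α.1.dom ∧
      ContDiffOn ℝ ∞ (uncurry F) ((J ∩ Icc 0 1) ×ˢ W) ∧
      ∀ s ∈ J ∩ Icc 0 1, IsSmoothLift (Ψ s).toEquiv α.1 β.1 W (F s) ∧
        ∀ γ : α.1.stab x, ∀ y ∈ W, γ.1.1 y ∈ W ∧ F s (γ.1.1 y) = (θ γ).1 (F s y)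

/-- `f^* Ω = Ω'` for an orbifold smooth map `f`: in charts, `Ω'` is the pullback of `Ω` by every
smooth local lift of `f`. Pullbacks of a `Γ`-invariant form by different lifts of the same map
agree, and an orbifold smooth map has lifts near every point. -/
def PullbackEq {X : OrbifoldStructure n N} {Y : OrbifoldStructure m M} {k : ℕ} (f : N → M)
    (Ω : OrbifoldForm Y k) (Ω' : OrbifoldForm X k) : Prop :=
  ∀ (α : X.charts) (β : Y.charts) (W : Set (OrbModel n)) (F : OrbModel n → OrbModel m),
    IsOpen W → W ⊆ α.1.dom → IsSmoothLift f α.1 β.1 W F →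
    ∀ x ∈ W, (Ω.form β (F x)).compContinuousLinearMap (fderiv ℝ F x) = Ω'.form α x

end Maps

/-!
The proof is Moser's argument, carried out in the charts of the orbifold.

The forms `ω t - ω 0` are exact for each `t`, but the primitives provided by the hypothesis need
not depend smoothly on `t`. A smooth family of primitives `η t` is found as follows
(`BallCover.exists_smooth_coherent_primitive`). On the finitely many balls of a cover by charts, the
Poincaré lemma gives local primitives depending smoothly on `t`. For each `t`, they differ from a
global primitive by differentials of functions `g k`. The differences of these functions on overlaps
of the balls are determined, up to constants on connected pieces, by the local primitives, and
finding the `g k` amounts to solving a system of linear equations, with one unknown for each ball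
and each point, whose coefficients do not depend on `t` and whose right hand sides depend smoothly
on `t`. Since the system is solvable for each `t`, a generalized inverse of its matrix, which
expresses every unknown by finitely many of the right hand sides, solves it in such a way that the
differences of the `g k` on overlaps are smooth in `(t, x)` (`exists_solution_linear_in_rhs`,
`BallCover.exists_smooth_differences`). An average with respect to a partition of unity, taken over
the fibres of the charts, then replaces the `g k` by smooth functions with the same differences
(`BallCover.exists_smooth_of_smooth_differences`), and these correct the local primitives to a
global family. No Hodge theory is needed.

The vector field `V t` defined by `ω t (V t, ·) = - ∂ₜ η t` is compatible with all changes of charts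
(`BallCover.exists_isMoserField`), and along its flow the derivative of `ω t` vanishes
(`derivWithin_add_lieDerivative_eq_zero`, `apply_eq_of_lieDerivative`). Over short times the flow
exists in the balls (`exists_smooth_local_flow`), by the smooth dependence of solutions of
differential equations on parameters (`contDiffOn_ode_solution`), and the flows in different balls
induce the same map of the orbifold (`BallCover.IsCurve.proj_eq`). The flow from time `t` to time
`0` is the composite of the flows over the intervals from `t * (j + 1) / m` to `t * j / m` for large
`m`; it is the required diffeomorphism.

What is asserted about lifts rests on one fact: two smooth lifts of the same map differ, to first
order at every point, by an element of the finite group of the target chart, and over a connected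
set by a constant one if one of them is an immersion (`IsSmoothLift.exists_eq_group_action`,
`exists_eq_group_action_of_isPreconnected`). This makes the lifts of the flow equivariant, and makes
the pullback of a form independent of the lift.
-/

/-! ### Linear differential equations and Grönwall estimates on the unit interval -/

section ODE

universe u

variable {Y : Type u} [NormedAddCommGroup Y] [NormedSpace ℝ Y]

theorem HasDerivWithinAt.ici_of_Icc {f : ℝ → Y} {f' : Y} {a b σ : ℝ}
    (h : HasDerivWithinAt f f' (Icc a b) σ) (hσ : σ ∈ Ico a b) :
    HasDerivWithinAt f f' (Ici σ) σ :=
  h.mono_of_mem_nhdsWithin (Filter.mem_of_superset (Icc_mem_nhdsGE hσ.2)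
    (Icc_subset_Icc_left hσ.1))

/-- Solutions of one differential equation on consecutive intervals can be glued. -/
theorem exists_hasDerivWithinAt_Icc_glue {V : ℝ → Y → Y} {w v : ℝ → Y} {T T' : ℝ}
    (hT : 0 ≤ T) (hT' : T ≤ T') (hwv : v T = w T)
    (hw : ∀ σ ∈ Icc 0 T, HasDerivWithinAt w (V σ (w σ)) (Icc 0 T) σ)
    (hv : ∀ σ ∈ Icc T T', HasDerivWithinAt v (V σ (v σ)) (Icc T T') σ) :
    ∃ z : ℝ → Y, z 0 = w 0 ∧
      ∀ σ ∈ Icc 0 T', HasDerivWithinAt z (V σ (z σ)) (Icc 0 T') σ := by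
  set z : ℝ → Y := fun σ => if σ ≤ T then w σ else v σ with hz
  have zw : ∀ σ ∈ Icc 0 T, z σ = w σ := fun σ hσ => if_pos hσ.2
  have zv : ∀ σ ∈ Icc T T', z σ = v σ := by
    intro σ hσ
    rcases hσ.1.eq_or_lt with h | h
    · subst h; simp [hz, hwv]
    · simp [hz, not_le.2 h]
  refine ⟨z, zw 0 ⟨le_rfl, hT⟩, fun σ hσ => ?_⟩
  rw [← Icc_union_Icc_eq_Icc hT hT']
  apply HasDerivWithinAt.union
  · by_cases h : σ ∈ Icc 0 T
    · rw [zw σ h]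
      exact (hw σ h).congr zw (zw σ h)
    · exact hasDerivWithinAt_iff_hasFDerivWithinAt.2
        (.of_notMem_closure (by rwa [isClosed_Icc.closure_eq]))
  · by_cases h : σ ∈ Icc T T'
    · rw [zv σ h]
      exact (hv σ h).congr zv (zv σ h)
    · exact hasDerivWithinAt_iff_hasFDerivWithinAt.2
        (.of_notMem_closure (by rwa [isClosed_Icc.closure_eq]))

/-- A linear differential equation with continuous coefficients has a solution on all of
`[0,1]`. The Picard-Lindelöf time of existence depends only on a bound for the coefficients, so
finitely many steps suffice. -/
theorem exists_linear_ode [CompleteSpace Y] {A : ℝ → Y →L[ℝ] Y}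
    (hA : ContinuousOn A (Icc 0 1)) (w₀ : Y) :
    ∃ w : ℝ → Y, w 0 = w₀ ∧
      ∀ σ ∈ Icc (0 : ℝ) 1, HasDerivWithinAt w (A σ (w σ)) (Icc 0 1) σ := by
  obtain ⟨C, hC⟩ := isCompact_Icc.exists_bound_of_continuousOn hA
  have hC0 : 0 ≤ C := (norm_nonneg _).trans (hC 0 (by simp))
  obtain ⟨m, hm⟩ := exists_nat_gt (2 * C)
  have hm0 : (0 : ℝ) < m := by linarith
  have key : ∀ j : ℕ, j ≤ m → ∃ w : ℝ → Y, w 0 = w₀ ∧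
      ∀ σ ∈ Icc (0 : ℝ) (j / m), HasDerivWithinAt w (A σ (w σ)) (Icc 0 (j / m)) σ := by
    intro j
    induction j with
    | zero =>
      refine fun _ => ⟨fun _ => w₀, rfl, fun σ hσ => ?_⟩
      simp only [Nat.cast_zero, zero_div, Icc_self] at hσ ⊢
      exact hasDerivWithinAt_iff_hasFDerivWithinAt.2 (.of_subsingleton subsingleton_singleton)
    | succ j ih =>
      intro hj
      obtain ⟨w, hw0, hw⟩ := ih (by omega)
      have hT : (j : ℝ) / m ≤ (j + 1 : ℕ) / m := by gcongr; simp
      have hT0 : (0 : ℝ) ≤ j / m := by positivity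
      have hT1 : ((j + 1 : ℕ) : ℝ) / m ≤ 1 := by
        rw [div_le_one hm0]; exact_mod_cast hj
      have hsub : Icc ((j : ℝ) / m) ((j + 1 : ℕ) / m) ⊆ Icc 0 1 := Icc_subset_Icc hT0 hT1
      set x := w (j / m)
      have hPL : IsPicardLindelof (fun σ y => A σ y) (tmin := (j : ℝ) / m)
          (tmax := ((j + 1 : ℕ) : ℝ) / m) ⟨(j : ℝ) / m, le_rfl, hT⟩ x
          (‖x‖₊ + 1) 0 (C.toNNReal * (2 * ‖x‖₊ + 1)) C.toNNReal := by
        refine ⟨fun t ht => ?_, fun y _ => ?_, fun t ht y hy => ?_, ?_⟩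
        · refine ((A t).lipschitz.lipschitzOnWith).weaken ?_
          rw [← NNReal.coe_le_coe, Real.coe_toNNReal _ hC0]
          exact hC t (hsub ht)
        · exact (hA.mono hsub).clm_apply continuousOn_const
        · simp only [NNReal.coe_mul, Real.coe_toNNReal _ hC0, NNReal.coe_add, coe_nnnorm,
            NNReal.coe_one, NNReal.coe_ofNat]
          have h1 : ‖y‖ ≤ 2 * ‖x‖ + 1 := by
            have := norm_le_norm_add_norm_sub' y x
            have h2 := mem_closedBall_iff_norm.1 hy
            simp only [NNReal.coe_add, coe_nnnorm, NNReal.coe_one] at h2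
            linarith
          exact (A t).le_of_opNorm_le_of_le (hC t (hsub ht)) h1
        · simp only [NNReal.coe_mul, Real.coe_toNNReal _ hC0, NNReal.coe_add, coe_nnnorm,
            NNReal.coe_one, NNReal.coe_ofNat, sub_self, NNReal.coe_zero, sub_zero]
          rw [max_eq_left (by linarith), ← sub_div]
          push_cast
          rw [add_sub_cancel_left, mul_one_div, div_le_iff₀ hm0]
          nlinarith [norm_nonneg x]
      obtain ⟨v, hv0, hv⟩ := hPL.exists_eq_forall_mem_Icc_hasDerivWithinAt₀
      obtain ⟨z, hz0, hz⟩ := exists_hasDerivWithinAt_Icc_glue (V := fun σ y => A σ y)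
        hT0 hT hv0 hw hv
      exact ⟨z, hz0.trans hw0, hz⟩
  obtain ⟨w, hw0, hw⟩ := key m le_rfl
  rw [div_self hm0.ne'] at hw
  exact ⟨w, hw0, hw⟩

theorem norm_le_mul_exp_of_norm_deriv_le {f f' : ℝ → Y} {δ K ε : ℝ} (hK : 1 ≤ K) (hε : 0 ≤ ε)
    (hf : ∀ σ ∈ Icc (0 : ℝ) 1, HasDerivWithinAt f (f' σ) (Icc 0 1) σ) (h0 : ‖f 0‖ ≤ δ)
    (bound : ∀ σ ∈ Icc (0 : ℝ) 1, ‖f' σ‖ ≤ K * ‖f σ‖ + ε) :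
    ∀ σ ∈ Icc (0 : ℝ) 1, ‖f σ‖ ≤ (δ + ε) * Real.exp K := by
  intro σ hσ
  have h := norm_le_gronwallBound_of_norm_deriv_right_le
    (fun σ hσ => (hf σ hσ).continuousWithinAt)
    (fun σ hσ => (hf σ (Ico_subset_Icc_self hσ)).ici_of_Icc hσ) h0
    (fun σ hσ => bound σ (Ico_subset_Icc_self hσ)) σ hσ
  refine h.trans ?_
  have hδ : 0 ≤ δ := (norm_nonneg _).trans h0
  rw [gronwallBound_of_K_ne_0 (by linarith), sub_zero]
  have h1 : Real.exp (K * σ) ≤ Real.exp K := Real.exp_le_exp.2 (by nlinarith [hσ.1, hσ.2])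
  have h2 : ε / K ≤ ε := div_le_self hε hK
  have h3 : 0 ≤ ε / K := by positivity
  have h4 : 1 ≤ Real.exp (K * σ) := Real.one_le_exp (by nlinarith [hσ.1])
  have h5 : ε / K * (Real.exp (K * σ) - 1) ≤ ε * Real.exp K :=
    mul_le_mul h2 (by linarith) (by linarith) hε
  have h6 := mul_le_mul_of_nonneg_left h1 hδ
  show δ * Real.exp (K * σ) + ε / K * (Real.exp (K * σ) - 1) ≤ _
  linarith

end ODE

/-! ### Smooth dependence of solutions on parameters -/

section SmoothDependence

universe u

theorem ContinuousOn.eventually_forall_dist_lt {α β Z : Type*} [PseudoMetricSpace Z]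
    [TopologicalSpace α] [TopologicalSpace β] {S : Set α} {k : Set β} {f : α → β → Z} {p : α}
    (hk : IsCompact k) (hf : ContinuousOn (uncurry f) (S ×ˢ k)) (hp : p ∈ S) {ε : ℝ}
    (hε : 0 < ε) : ∀ᶠ q in 𝓝[S] p, ∀ b ∈ k, dist (f q b) (f p b) < ε := by
  obtain ⟨v, hv, h⟩ := hk.mem_uniformity_of_prod hf hp (Metric.dist_mem_uniformity hε)
  exact Filter.mem_of_superset hv fun q hq b hb => h q hq b hb

variable {Q Y : Type u} [NormedAddCommGroup Q] [NormedSpace ℝ Q] [NormedAddCommGroup Y]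
  [NormedSpace ℝ Y]

/-- Grönwall's inequality gives continuous dependence on parameters for a differential equation
that is Lipschitz along its solutions. -/
theorem continuousOn_uncurry_of_lipschitz_ode {α : Type*} [TopologicalSpace α] {S : Set α}
    {f : ℝ → α → Y → Y} {w : ℝ → α → Y}
    (hf : ∀ p ∈ S, ContinuousOn (fun z : α × ℝ => f z.2 z.1 (w z.2 p)) (S ×ˢ Icc 0 1))
    (hLip : ∀ p ∈ S, ∃ K, ∀ᶠ q in 𝓝[S] p, ∀ σ ∈ Icc (0 : ℝ) 1,
      ‖f σ q (w σ q) - f σ q (w σ p)‖ ≤ K * ‖w σ q - w σ p‖)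
    (hw0 : ContinuousOn (w 0) S)
    (hw : ∀ q ∈ S, ∀ σ ∈ Icc (0 : ℝ) 1,
      HasDerivWithinAt (w · q) (f σ q (w σ q)) (Icc 0 1) σ) :
    ContinuousOn (uncurry w) (Icc 0 1 ×ˢ S) := by
  have key : ∀ p ∈ S, ∀ ε > 0, ∀ᶠ q in 𝓝[S] p, ∀ σ ∈ Icc (0 : ℝ) 1,
      dist (w σ q) (w σ p) < ε := by
    intro p hp ε hε
    obtain ⟨K₀, hK₀⟩ := hLip p hp
    set K := |K₀| + 1
    have hK1 : 1 ≤ K := by have := abs_nonneg K₀; linarith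
    set e := ε / (3 * Real.exp K) with he_def
    have he : 0 < e := by positivity
    filter_upwards [self_mem_nhdsWithin, hK₀,
      (hf p hp).eventually_forall_dist_lt (f := fun q σ => f σ q (w σ p)) isCompact_Icc hp he,
      Metric.continuousWithinAt_iff'.1 (hw0 p hp) e he] with q hq h1 h2 h3 σ hσ
    have hr := norm_le_mul_exp_of_norm_deriv_le (f := fun σ => w σ q - w σ p) (δ := e)
      (ε := e) hK1 he.le
      (fun σ hσ => (hw q hq σ hσ).sub (hw p hp σ hσ)) (by rw [← dist_eq_norm]; exact h3.le)
      (fun σ hσ => by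
        have e1 : f σ q (w σ q) - f σ p (w σ p)
            = (f σ q (w σ q) - f σ q (w σ p)) + (f σ q (w σ p) - f σ p (w σ p)) := by abel
        rw [e1]
        have n2 := (h2 σ hσ).le
        rw [dist_eq_norm] at n2
        refine (norm_add_le _ _).trans (add_le_add ((h1 σ hσ).trans ?_) n2)
        exact mul_le_mul_of_nonneg_right (by linarith [le_abs_self K₀]) (norm_nonneg _))
      σ hσ
    rw [dist_eq_norm]
    refine hr.trans_lt ?_
    have : (e + e) * Real.exp K = ε * (2 / 3) := by
      rw [he_def]; field_simp; norm_num
    rw [this]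
    linarith
  rintro ⟨σ₀, p⟩ ⟨hσ₀, hp⟩
  rw [Metric.continuousWithinAt_iff']
  intro ε hε
  have h1 := key p hp (ε / 2) (by positivity)
  have h2 := Metric.continuousWithinAt_iff'.1 (hw p hp σ₀ hσ₀).continuousWithinAt (ε / 2)
    (by positivity)
  rw [nhdsWithin_prod_eq]
  filter_upwards [Filter.prod_mem_prod (Filter.inter_mem self_mem_nhdsWithin h2) h1]
    with ⟨σ, q⟩ ⟨⟨h3, h4⟩, h5⟩
  have h6 : dist (w σ q) (w σ p) < ε / 2 := h5 σ h3
  have h7 : dist (w σ p) (w σ₀ p) < ε / 2 := h4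
  exact (dist_triangle (w σ q) (w σ p) (w σ₀ p)).trans_lt (by linarith)

/-- Solutions of a linear equation depend continuously on parameters. -/
theorem continuousOn_uncurry_of_linear_ode {α : Type*} [TopologicalSpace α] {S : Set α}
    {B : ℝ → α → Y →L[ℝ] Y} {w : ℝ → α → Y}
    (hB : ContinuousOn (uncurry B) (Icc 0 1 ×ˢ S)) (hw0 : ContinuousOn (w 0) S)
    (hw : ∀ q ∈ S, ∀ σ ∈ Icc (0 : ℝ) 1,
      HasDerivWithinAt (w · q) (B σ q (w σ q)) (Icc 0 1) σ) :
    ContinuousOn (uncurry w) (Icc 0 1 ×ˢ S) := by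
  have hB' : ContinuousOn (uncurry fun q σ => B σ q) (S ×ˢ Icc (0 : ℝ) 1) :=
    hB.comp continuous_swap.continuousOn fun z hz => ⟨hz.2, hz.1⟩
  refine continuousOn_uncurry_of_lipschitz_ode (f := fun σ q y => B σ q y) (fun p hp => ?_)
    (fun p hp => ?_) hw0 hw
  · have hwp : ContinuousOn (fun σ => w σ p) (Icc 0 1) := fun σ hσ =>
      (hw p hp σ hσ).continuousWithinAt
    exact hB'.clm_apply (hwp.comp continuousOn_snd fun z hz => hz.2)
  · have hBp : ContinuousOn (fun σ => B σ p) (Icc 0 1) :=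
      hB.comp (by fun_prop : Continuous fun σ : ℝ => (σ, p)).continuousOn fun σ hσ => ⟨hσ, hp⟩
    obtain ⟨K₀, hK₀⟩ := isCompact_Icc.exists_bound_of_continuousOn hBp
    refine ⟨K₀ + 1, ?_⟩
    filter_upwards [hB'.eventually_forall_dist_lt isCompact_Icc hp one_pos] with q h1 σ hσ
    rw [← map_sub]
    refine (B σ q).le_of_opNorm_le ?_ _
    have := norm_le_norm_add_norm_sub' (B σ q) (B σ p)
    have h4 := h1 σ hσ
    rw [dist_eq_norm] at h4
    have := hK₀ σ hσ
    linarith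

variable {S : Set Q} {D : Set Y} {V : ℝ → Y → Y} {u : ℝ → Q → Y}

/-- Differentiability of solutions with respect to parameters: the derivative solves the
linearized equation. -/
theorem hasFDerivWithinAt_ode_solution {V' : ℝ → Y → Y →L[ℝ] Y}
    (hD : Convex ℝ D)
    (hV : ∀ σ ∈ Icc (0 : ℝ) 1, ∀ y ∈ D, HasFDerivWithinAt (V σ) (V' σ y) D y)
    (hV' : ContinuousOn (uncurry V') (Icc 0 1 ×ˢ D))
    (hmem : ∀ σ ∈ Icc (0 : ℝ) 1, ∀ q ∈ S, u σ q ∈ D)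
    (hu : ∀ q ∈ S, ∀ σ ∈ Icc (0 : ℝ) 1,
      HasDerivWithinAt (u · q) (V σ (u σ q)) (Icc 0 1) σ)
    (hcont : ContinuousOn (uncurry u) (Icc 0 1 ×ˢ S)) {p : Q} (hp : p ∈ S)
    {w : ℝ → Q →L[ℝ] Y} (hw0 : HasFDerivWithinAt (u 0) (w 0) S p)
    (hw : ∀ σ ∈ Icc (0 : ℝ) 1,
      HasDerivWithinAt w ((V' σ (u σ p)).comp (w σ)) (Icc 0 1) σ) :
    ∀ σ ∈ Icc (0 : ℝ) 1, HasFDerivWithinAt (u σ) (w σ) S p := by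
  have hup : ContinuousOn (fun σ => u σ p) (Icc 0 1) := fun σ hσ =>
    (hu p hp σ hσ).continuousWithinAt
  have hA : ContinuousOn (fun σ => V' σ (u σ p)) (Icc 0 1) :=
    hV'.comp (continuousOn_id.prodMk hup) fun σ hσ => ⟨hσ, hmem σ hσ p hp⟩
  have hseg : ∀ q ∈ S, ∀ σ ∈ Icc (0 : ℝ) 1, ∀ θ ∈ Icc (0 : ℝ) 1,
      u σ p + θ • (u σ q - u σ p) ∈ D := fun q hq σ hσ θ hθ =>
    hD.add_smul_sub_mem (hmem σ hσ p hp) (hmem σ hσ q hq) hθ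
  -- uniform first order expansion of `V` along the solutions
  have stepA : ∀ ε > 0, ∀ᶠ q in 𝓝[S] p, ∀ σ ∈ Icc (0 : ℝ) 1,
      ‖V σ (u σ q) - V σ (u σ p) - V' σ (u σ p) (u σ q - u σ p)‖ ≤ ε * ‖u σ q - u σ p‖ := by
    intro ε hε
    have hf : ContinuousOn (uncurry fun (q : Q) (z : ℝ × ℝ) =>
        V' z.1 (u z.1 p + z.2 • (u z.1 q - u z.1 p))) (S ×ˢ (Icc (0 : ℝ) 1 ×ˢ Icc (0 : ℝ) 1)) := by
      have c1 : ContinuousOn (fun z : Q × ℝ × ℝ => u z.2.1 z.1)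
          (S ×ˢ (Icc (0 : ℝ) 1 ×ˢ Icc (0 : ℝ) 1)) :=
        hcont.comp (f := fun z : Q × ℝ × ℝ => (z.2.1, z.1)) (by fun_prop)
          fun z hz => ⟨hz.2.1, hz.1⟩
      have c2 : ContinuousOn (fun z : Q × ℝ × ℝ => u z.2.1 p)
          (S ×ˢ (Icc (0 : ℝ) 1 ×ˢ Icc (0 : ℝ) 1)) :=
        hup.comp (f := fun z : Q × ℝ × ℝ => z.2.1) (by fun_prop) fun z hz => hz.2.1
      have c3 : ContinuousOn (fun z : Q × ℝ × ℝ =>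
          (z.2.1, u z.2.1 p + z.2.2 • (u z.2.1 z.1 - u z.2.1 p)))
          (S ×ˢ (Icc (0 : ℝ) 1 ×ˢ Icc (0 : ℝ) 1)) :=
        ContinuousOn.prodMk (by fun_prop) (c2.add (ContinuousOn.smul (by fun_prop) (c1.sub c2)))
      exact hV'.comp c3 fun z hz => ⟨hz.2.1, hseg _ hz.1 _ hz.2.1 _ hz.2.2⟩
    filter_upwards [self_mem_nhdsWithin,
      hf.eventually_forall_dist_lt (isCompact_Icc.prod isCompact_Icc) hp hε] with q hq h σ hσ
    have hsub : segment ℝ (u σ p) (u σ q) ⊆ D := hD.segment_subset (hmem σ hσ p hp)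
      (hmem σ hσ q hq)
    refine Convex.norm_image_sub_le_of_norm_hasFDerivWithin_le' (f' := V' σ)
      (fun y hy => (hV σ hσ y (hsub hy)).mono hsub) ?_ (convex_segment _ _)
      (left_mem_segment ℝ _ _) (right_mem_segment ℝ _ _)
    intro y hy
    rw [segment_eq_image'] at hy
    obtain ⟨θ, hθ, rfl⟩ := hy
    have := h (σ, θ) ⟨hσ, hθ⟩
    simp only [sub_self, smul_zero, add_zero, dist_eq_norm] at this
    exact this.le
  obtain ⟨K₀, hK₀⟩ := isCompact_Icc.exists_bound_of_continuousOn hA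
  set K := |K₀| + 1
  have hK1 : 1 ≤ K := by have := abs_nonneg K₀; linarith
  have hAK : ∀ σ ∈ Icc (0 : ℝ) 1, ‖V' σ (u σ p)‖ ≤ |K₀| := fun σ hσ =>
    (hK₀ σ hσ).trans (le_abs_self _)
  have stepB : ∀ᶠ q in 𝓝[S] p, ∀ σ ∈ Icc (0 : ℝ) 1,
      ‖u σ q - u σ p‖ ≤ ‖u 0 q - u 0 p‖ * Real.exp K := by
    filter_upwards [self_mem_nhdsWithin, stepA 1 one_pos] with q hq h σ hσ
    have := norm_le_mul_exp_of_norm_deriv_le (f := fun σ => u σ q - u σ p)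
      (δ := ‖u 0 q - u 0 p‖) (ε := 0) hK1 le_rfl
      (fun σ hσ => (hu q hq σ hσ).sub (hu p hp σ hσ)) le_rfl
      (fun σ hσ => by
        have h1 := h σ hσ
        have h2 := (V' σ (u σ p)).le_of_opNorm_le (hAK σ hσ) (u σ q - u σ p)
        have h3 := norm_le_norm_add_norm_sub' (V σ (u σ q) - V σ (u σ p))
          (V' σ (u σ p) (u σ q - u σ p))
        simp only [K]
        linarith) σ hσ
    simpa using this
  obtain ⟨C, hC⟩ := hw0.isBigO_sub.bound
  intro σ hσ
  rw [hasFDerivWithinAt_iff_isLittleO, Asymptotics.isLittleO_iff]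
  intro ε hε
  set e₁ := ε / (2 * Real.exp K)
  set e₂ := ε / (2 * Real.exp K * (Real.exp K * (|C| + 1)))
  have he₁ : 0 < e₁ := by positivity
  have he₂ : 0 < e₂ := by positivity
  filter_upwards [self_mem_nhdsWithin, stepB, hC, stepA e₂ he₂,
    (Asymptotics.isLittleO_iff.1 (hasFDerivWithinAt_iff_isLittleO.1 hw0)) he₁] with q hq h1 h2 h3 h4
  have hr := norm_le_mul_exp_of_norm_deriv_le
    (f := fun σ => u σ q - u σ p - w σ (q - p)) (δ := e₁ * ‖q - p‖)
    (ε := e₂ * (Real.exp K * (|C| + 1)) * ‖q - p‖) hK1 (by positivity)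
    (f' := fun σ => V σ (u σ q) - V σ (u σ p) - (V' σ (u σ p)) (w σ (q - p)))
    (fun σ hσ => ((hu q hq σ hσ).sub (hu p hp σ hσ)).sub
      (by simpa using (hw σ hσ).clm_apply (hasDerivWithinAt_const σ (Icc 0 1) (q - p)))) h4
    (fun σ hσ => by
      have e1 : V σ (u σ q) - V σ (u σ p) - (V' σ (u σ p)) (w σ (q - p))
          = V' σ (u σ p) (u σ q - u σ p - w σ (q - p))
            + (V σ (u σ q) - V σ (u σ p) - V' σ (u σ p) (u σ q - u σ p)) := by
        rw [map_sub (V' σ (u σ p)) (u σ q - u σ p)]; abel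
      rw [e1]
      refine (norm_add_le _ _).trans (add_le_add
        ((V' σ (u σ p)).le_of_opNorm_le ((hAK σ hσ).trans (by simp [K])) _) ((h3 σ hσ).trans ?_))
      rw [mul_assoc e₂]
      refine mul_le_mul_of_nonneg_left ((h1 σ hσ).trans ?_) he₂.le
      have h5 : ‖u 0 q - u 0 p‖ ≤ (|C| + 1) * ‖q - p‖ :=
        h2.trans (mul_le_mul_of_nonneg_right (by linarith [le_abs_self C]) (norm_nonneg _))
      nlinarith [Real.exp_pos K]) σ hσ
  refine hr.trans (le_of_eq ?_)
  simp only [e₁, e₂]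
  field_simp
  ring

theorem ContDiffOn.fderivWithin_uncurry {E F G : Type*} [NormedAddCommGroup E] [NormedSpace ℝ E]
    [NormedAddCommGroup F] [NormedSpace ℝ F] [NormedAddCommGroup G] [NormedSpace ℝ G]
    {s : Set E} {t : Set F} {f : E → F → G} (hf : ContDiffOn ℝ ∞ (uncurry f) (s ×ˢ t))
    (ht : UniqueDiffOn ℝ t) :
    ContDiffOn ℝ ∞ (uncurry fun x y => fderivWithin ℝ (f x) t y) (s ×ˢ t) := by
  intro z hz
  refine ContDiffWithinAt.fderivWithin (f := fun (z : E × F) y => f z.1 y) (g := Prod.snd)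
    (t := t) (n := ∞) ?_ contDiffWithinAt_snd ht le_rfl hz fun z hz => hz.2
  refine ContDiffWithinAt.comp (g := uncurry f) (f := fun z : (E × F) × F => (z.1.1, z.2)) _
    (hf (z.1, z.2) hz) (by fun_prop) fun z hz => ⟨hz.1.1, hz.2⟩

theorem ContDiffOn.uncurry_left {E F G : Type*} [NormedAddCommGroup E] [NormedSpace ℝ E]
    [NormedAddCommGroup F] [NormedSpace ℝ F] [NormedAddCommGroup G] [NormedSpace ℝ G]
    {s : Set E} {t : Set F} {f : E → F → G} {k : WithTop ℕ∞}
    (hf : ContDiffOn ℝ k (uncurry f) (s ×ˢ t)) {x : E} (hx : x ∈ s) : ContDiffOn ℝ k (f x) t :=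
  hf.comp (f := fun y => (x, y)) (by fun_prop) fun _ hy => ⟨hx, hy⟩

/-- The derivative in the parameters of a solution depending continuously on parameters. -/
theorem exists_hasFDerivWithinAt_ode_solution [CompleteSpace Y]
    (hD : Convex ℝ D) (hDu : UniqueDiffOn ℝ D)
    (hV : ContDiffOn ℝ ∞ (uncurry V) (Icc 0 1 ×ˢ D))
    (hS : UniqueDiffOn ℝ S) (hu0 : ContDiffOn ℝ ∞ (u 0) S)
    (hmem : ∀ σ ∈ Icc (0 : ℝ) 1, ∀ q ∈ S, u σ q ∈ D)
    (hu : ∀ q ∈ S, ∀ σ ∈ Icc (0 : ℝ) 1,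
      HasDerivWithinAt (u · q) (V σ (u σ q)) (Icc 0 1) σ)
    (hcont : ContinuousOn (uncurry u) (Icc 0 1 ×ˢ S)) :
    ∃ w : ℝ → Q → Q →L[ℝ] Y, ContinuousOn (uncurry w) (Icc 0 1 ×ˢ S) ∧
      (∀ q, w 0 q = fderivWithin ℝ (u 0) S q) ∧
      (∀ q ∈ S, ∀ σ ∈ Icc (0 : ℝ) 1, HasDerivWithinAt (w · q)
        ((fderivWithin ℝ (V σ) D (u σ q)).comp (w σ q)) (Icc 0 1) σ) ∧
      ∀ q ∈ S, ∀ σ ∈ Icc (0 : ℝ) 1, HasFDerivWithinAt (u σ) (w σ q) S q := by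
  have hV' := (hV.fderivWithin_uncurry hDu).continuousOn
  set B : ℝ → Q → (Q →L[ℝ] Y) →L[ℝ] (Q →L[ℝ] Y) := fun σ q =>
    ContinuousLinearMap.compL ℝ Q Y Y (fderivWithin ℝ (V σ) D (u σ q)) with hBdef
  have hB : ContinuousOn (uncurry B) (Icc 0 1 ×ˢ S) :=
    (ContinuousLinearMap.compL ℝ Q Y Y).continuous.comp_continuousOn
      (hV'.comp (f := fun z : ℝ × Q => (z.1, u z.1 z.2)) (continuousOn_fst.prodMk hcont)
        fun z hz => ⟨hz.1, hmem _ hz.1 _ hz.2⟩)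
  have hex : ∀ q, ∃ w : ℝ → Q →L[ℝ] Y, w 0 = fderivWithin ℝ (u 0) S q ∧
      (q ∈ S → ∀ σ ∈ Icc (0 : ℝ) 1, HasDerivWithinAt w (B σ q (w σ)) (Icc 0 1) σ) := by
    intro q
    by_cases hq : q ∈ S
    · obtain ⟨w, h1, h2⟩ := exists_linear_ode (A := fun σ => B σ q)
        (hB.comp (f := fun σ => (σ, q)) (by fun_prop) fun σ hσ => ⟨hσ, hq⟩)
        (fderivWithin ℝ (u 0) S q)
      exact ⟨w, h1, fun _ => h2⟩
    · exact ⟨fun _ => _, rfl, fun h => absurd h hq⟩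
  choose w hw0 hw using hex
  refine ⟨fun σ q => w q σ, ?_, hw0, fun q hq σ hσ => hw q hq σ hσ, fun q hq => ?_⟩
  · refine continuousOn_uncurry_of_linear_ode hB ?_ (fun q hq σ hσ => hw q hq σ hσ)
    simp only [hw0]
    exact hu0.continuousOn_fderivWithin hS (by simp)
  · refine hasFDerivWithinAt_ode_solution (V' := fun σ => fderivWithin ℝ (V σ) D) hD ?_ hV' hmem
      hu hcont hq ?_ fun σ hσ => hw q hq σ hσ
    · intro σ hσ y hy
      exact ((hV.uncurry_left hσ).differentiableOn (by simp) y hy).hasFDerivWithinAt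
    · show HasFDerivWithinAt (u 0) (w q 0) S q
      rw [hw0]
      exact (hu0.differentiableOn (by simp) q hq).hasFDerivWithinAt

/-- Finite differentiability in the parameters, by induction on the order: the solution together with
its derivative solves a differential equation of the same kind. -/
theorem contDiffOn_nat_ode_solution [CompleteSpace Y]
    (hD : Convex ℝ D) (hDu : UniqueDiffOn ℝ D)
    (hV : ContDiffOn ℝ ∞ (uncurry V) (Icc 0 1 ×ˢ D))
    (hS : UniqueDiffOn ℝ S) (hu0 : ContDiffOn ℝ ∞ (u 0) S)
    (hmem : ∀ σ ∈ Icc (0 : ℝ) 1, ∀ q ∈ S, u σ q ∈ D)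
    (hu : ∀ q ∈ S, ∀ σ ∈ Icc (0 : ℝ) 1,
      HasDerivWithinAt (u · q) (V σ (u σ q)) (Icc 0 1) σ)
    (hcont : ContinuousOn (uncurry u) (Icc 0 1 ×ˢ S)) (k : ℕ) :
    ∀ σ ∈ Icc (0 : ℝ) 1, ContDiffOn ℝ k (u σ) S := by
  induction k generalizing Y with
  | zero =>
    exact fun σ hσ => contDiffOn_zero.2
      (hcont.comp (f := fun q => (σ, q)) (by fun_prop) fun q hq => ⟨hσ, hq⟩)
  | succ k ih =>
    intro σ hσ
    obtain ⟨w, hwc, hw0, hw, hwd⟩ :=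
      exists_hasFDerivWithinAt_ode_solution hD hDu hV hS hu0 hmem hu hcont
    -- the solution together with its derivative solves the first variation system
    have hext : ContDiffOn ℝ k (fun q => (u σ q, w σ q)) S := by
      refine ih (Y := Y × (Q →L[ℝ] Y)) (D := D ×ˢ univ) (u := fun σ q => (u σ q, w σ q))
        (V := fun σ z => (V σ z.1, (fderivWithin ℝ (V σ) D z.1).comp z.2))
        (hD.prod convex_univ) (hDu.prod uniqueDiffOn_univ) ?_ ?_ ?_ ?_ ?_ σ hσ
      · have c1 : ContDiffOn ℝ ∞ (fun z : ℝ × Y × (Q →L[ℝ] Y) => (z.1, z.2.1))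
          (Icc 0 1 ×ˢ (D ×ˢ univ)) := by fun_prop
        have m1 : MapsTo (fun z : ℝ × Y × (Q →L[ℝ] Y) => (z.1, z.2.1))
          (Icc 0 1 ×ˢ (D ×ˢ univ)) (Icc 0 1 ×ˢ D) := fun z hz => ⟨hz.1, hz.2.1⟩
        exact (hV.comp c1 m1).prodMk
          (((hV.fderivWithin_uncurry hDu).comp c1 m1).clm_comp (by fun_prop))
      · simp only [hw0]
        exact hu0.prodMk (hu0.fderivWithin hS le_rfl)
      · exact fun σ hσ q hq => ⟨hmem σ hσ q hq, mem_univ _⟩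
      · exact fun q hq σ hσ => (hu q hq σ hσ).prodMk (hw q hq σ hσ)
      · exact hcont.prodMk hwc
    push_cast
    refine contDiffOn_succ_of_fderivWithin
      (fun q hq => (hwd q hq σ hσ).differentiableWithinAt) (by simp) ?_
    exact (contDiff_snd.comp_contDiffOn hext).congr
      fun q hq => (hwd q hq σ hσ).fderivWithin (hS q hq)

/-- Solutions of a smooth differential equation on a convex set, possibly with boundary, depend
smoothly on parameters as soon as they depend continuously on them. -/
theorem contDiffOn_ode_solution [CompleteSpace Y]
    (hD : Convex ℝ D) (hDu : UniqueDiffOn ℝ D)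
    (hV : ContDiffOn ℝ ∞ (uncurry V) (Icc 0 1 ×ˢ D))
    (hS : UniqueDiffOn ℝ S) (hu0 : ContDiffOn ℝ ∞ (u 0) S)
    (hmem : ∀ σ ∈ Icc (0 : ℝ) 1, ∀ q ∈ S, u σ q ∈ D)
    (hu : ∀ q ∈ S, ∀ σ ∈ Icc (0 : ℝ) 1,
      HasDerivWithinAt (u · q) (V σ (u σ q)) (Icc 0 1) σ)
    (hcont : ContinuousOn (uncurry u) (Icc 0 1 ×ˢ S)) :
    ∀ σ ∈ Icc (0 : ℝ) 1, ContDiffOn ℝ ∞ (u σ) S := fun σ hσ =>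
  contDiffOn_infty.2 fun k =>
    contDiffOn_nat_ode_solution hD hDu hV hS hu0 hmem hu hcont k σ hσ

end SmoothDependence

/-! ### Antiderivatives and local flows depending smoothly on parameters -/

section LocalFlow

universe u

/-- A smooth function of `(σ, q)` has a smooth antiderivative in `σ`, whose derivative in `q` is
the antiderivative of the derivative. -/
theorem exists_smooth_antiderivative {Q Y : Type u} [NormedAddCommGroup Q] [NormedSpace ℝ Q]
    [CompleteSpace Q]
    [NormedAddCommGroup Y] [NormedSpace ℝ Y] [CompleteSpace Y] {S : Set Q}
    (hSc : Convex ℝ S) (hS : UniqueDiffOn ℝ S) {F : ℝ → Q → Y}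
    (hF : ContDiffOn ℝ ∞ (uncurry F) (Icc 0 1 ×ˢ S)) :
    ∃ z : ℝ → Q → Y, (∀ q, z 0 q = 0) ∧
      (∀ q ∈ S, ∀ σ ∈ Icc (0 : ℝ) 1, HasDerivWithinAt (z · q) (F σ q) (Icc 0 1) σ) ∧
      (∀ σ ∈ Icc (0 : ℝ) 1, ContDiffOn ℝ ∞ (z σ) S) ∧
      ∃ m : ℝ → Q → Q →L[ℝ] Y, (∀ q ∈ S, m 0 q = 0) ∧
        (∀ q ∈ S, ∀ σ ∈ Icc (0 : ℝ) 1,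
          HasDerivWithinAt (m · q) (fderivWithin ℝ (F σ) S q) (Icc 0 1) σ) ∧
        ∀ q ∈ S, ∀ σ ∈ Icc (0 : ℝ) 1, HasFDerivWithinAt (z σ) (m σ q) S q := by
  set z : ℝ → Q → Y := fun σ q => ∫ s in (0 : ℝ)..σ, IccExtend zero_le_one
    (domRestrict (Icc (0 : ℝ) 1) fun s => F s q) s with hz
  have hz0 : ∀ q, z 0 q = 0 := fun q => by simp [hz]
  have hz' : ∀ q ∈ S, ∀ σ ∈ Icc (0 : ℝ) 1, HasDerivWithinAt (z · q) (F σ q) (Icc 0 1) σ := by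
    intro q hq σ hσ
    have hc : ContinuousOn (fun s => F s q) (Icc 0 1) :=
      hF.continuousOn.comp (f := fun s => (s, q)) (by fun_prop) fun s hs => ⟨hs, hq⟩
    have hc' : Continuous (IccExtend zero_le_one (domRestrict (Icc (0 : ℝ) 1) fun s => F s q)) :=
      (continuousOn_iff_continuous_domRestrict.1 hc).Icc_extend'
    have := (hc'.integral_hasStrictDerivAt 0 σ).hasDerivAt.hasDerivWithinAt (s := Icc (0 : ℝ) 1)
    rwa [IccExtend_of_mem _ _ hσ] at this
  have hzc : ContinuousOn (uncurry z) (Icc 0 1 ×ˢ S) := by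
    refine continuousOn_uncurry_of_lipschitz_ode (f := fun σ q _ => F σ q)
      (fun p _ => hF.continuousOn.comp continuous_swap.continuousOn fun z hz => ⟨hz.2, hz.1⟩)
      (fun p _ => ⟨0, .of_forall fun q σ _ => by simp⟩) ?_ hz'
    exact (continuousOn_const (c := (0 : Y))).congr fun q _ => hz0 q
  have hFd := fun σ (hσ : σ ∈ Icc (0 : ℝ) 1) => (hF.uncurry_left hσ).differentiableOn (by simp)
  -- the system `q' = 0`, `y' = F σ q` on `S × Y`
  set V : ℝ → Q × Y → Q × Y := fun σ y => (0, F σ y.1)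
  have hV : ContDiffOn ℝ ∞ (uncurry V) (Icc 0 1 ×ˢ (S ×ˢ univ)) := by
    refine contDiffOn_const.prodMk (hF.comp (f := fun z : ℝ × Q × Y => (z.1, z.2.1))
      (by fun_prop) fun z hz => ⟨hz.1, hz.2.1⟩)
  have hsol := contDiffOn_ode_solution (V := V) (u := fun σ q => (q, z σ q))
    (hSc.prod convex_univ) (hS.prod uniqueDiffOn_univ) hV hS
    (by simp only [hz0]; fun_prop) (fun σ _ q hq => ⟨hq, mem_univ _⟩)
    (fun q hq σ hσ => (hasDerivWithinAt_const σ _ q).prodMk (hz' q hq σ hσ))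
    (continuousOn_snd.prodMk hzc)
  obtain ⟨w, -, hw0, hw, hwd⟩ := exists_hasFDerivWithinAt_ode_solution (V := V)
    (u := fun σ q => (q, z σ q))
    (hSc.prod convex_univ) (hS.prod uniqueDiffOn_univ) hV hS
    (by simp only [hz0]; fun_prop) (fun σ _ q hq => ⟨hq, mem_univ _⟩)
    (fun q hq σ hσ => (hasDerivWithinAt_const σ _ q).prodMk (hz' q hq σ hσ))
    (continuousOn_snd.prodMk hzc)
  refine ⟨z, hz0, hz', fun σ hσ => contDiff_snd.comp_contDiffOn (hsol σ hσ),
    fun σ q => (ContinuousLinearMap.snd ℝ Q Y).comp (w σ q), fun q hq => ?_, fun q hq σ hσ => ?_,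
    fun q hq σ hσ => ?_⟩
  · have h1 : HasFDerivWithinAt (fun q => (q, z 0 q))
        ((ContinuousLinearMap.id ℝ Q).prod (0 : Q →L[ℝ] Y)) S q := by
      simp only [hz0]
      exact (hasFDerivWithinAt_id q S).prodMk (hasFDerivWithinAt_const 0 q S)
    simp only [hw0, h1.fderivWithin (hS q hq)]
    rfl
  · have h1 := (ContinuousLinearMap.compL ℝ Q (Q × Y) Y
      (ContinuousLinearMap.snd ℝ Q Y)).hasFDerivAt.comp_hasDerivWithinAt σ (hw q hq σ hσ)
    refine h1.congr_deriv ?_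
    have h2 : HasFDerivWithinAt (V σ) ((0 : Q × Y →L[ℝ] Q).prod
        ((fderivWithin ℝ (F σ) S q).comp (ContinuousLinearMap.fst ℝ Q Y)))
        (S ×ˢ univ) (q, z σ q) :=
      (hasFDerivWithinAt_const 0 _ _).prodMk (HasFDerivWithinAt.comp (q, z σ q) (t := S)
        (g := F σ) (f := Prod.fst) (hFd σ hσ q hq).hasFDerivWithinAt hasFDerivWithinAt_fst
        fun z hz => hz.1)
    rw [h2.fderivWithin ((hS.prod uniqueDiffOn_univ) _ ⟨hq, mem_univ _⟩)]
    have h3 : (ContinuousLinearMap.fst ℝ Q Y).comp (w σ q) = ContinuousLinearMap.id ℝ Q :=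
      (hS q hq).eq (HasFDerivAt.comp_hasFDerivWithinAt (g := Prod.fst) q hasFDerivAt_fst
        (hwd q hq σ hσ)) (hasFDerivWithinAt_id q S)
    ext v
    have h4 : (w σ q v).1 = v := congrArg (fun L : Q →L[ℝ] Q => L v) h3
    simp [h4]
  · exact HasFDerivAt.comp_hasFDerivWithinAt (g := Prod.snd) q hasFDerivAt_snd (hwd q hq σ hσ)

/-- Picard-Lindelöf, recording that the solution stays in the ball. -/
theorem IsPicardLindelof.exists_solution_mem_closedBall {E : Type*} [NormedAddCommGroup E]
    [NormedSpace ℝ E] [CompleteSpace E] {f : ℝ → E → E} {tmin tmax : ℝ} {t₀ : Icc tmin tmax}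
    {x₀ x : E} {a r L K : NNReal} (hf : IsPicardLindelof f t₀ x₀ a r L K)
    (hx : x ∈ Metric.closedBall x₀ r) :
    ∃ α : ℝ → E, α t₀ = x ∧ (∀ t, α t ∈ Metric.closedBall x₀ a) ∧
      ∀ t ∈ Icc tmin tmax, HasDerivWithinAt α (f t (α t)) (Icc tmin tmax) t := by
  obtain ⟨α, hα⟩ := ODE.FunSpace.exists_isFixedPt_next hf hx
  refine ⟨α.compProj, by rw [ODE.FunSpace.compProj_val, ← hα, ODE.FunSpace.next_apply₀],
    fun t => α.compProj_mem_closedBall hf.mul_max_le, fun t ht => ?_⟩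
  apply ODE.hasDerivWithinAt_picard_Icc t₀.2 hf.continuousOn_uncurry
    α.continuous_compProj.continuousOn (fun _ ht' ↦ α.compProj_mem_closedBall hf.mul_max_le)
    x ht |>.congr_of_mem _ ht
  intro t' ht'
  nth_rw 1 [← hα]
  rw [ODE.FunSpace.compProj_of_mem ht', ODE.FunSpace.next_apply]

theorem add_mul_sub_mem_Icc {s t σ : ℝ} (hs : s ∈ Icc (0 : ℝ) 1) (ht : t ∈ Icc (0 : ℝ) 1)
    (hσ : σ ∈ Icc (0 : ℝ) 1) : s + σ * (t - s) ∈ Icc (0 : ℝ) 1 := by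
  simpa using (convex_Icc (0 : ℝ) 1).add_smul_sub_mem hs ht hσ

/-- Pairs of times in `[0,1]` at distance at most `δ`, together with a point of `B`. -/
def shortTimes {E : Type*} (δ : ℝ) (B : Set E) : Set (ℝ × ℝ × E) :=
  {p | p.1 ∈ Icc (0 : ℝ) 1 ∧ p.2.1 ∈ Icc (0 : ℝ) 1 ∧ |p.2.1 - p.1| ≤ δ ∧ p.2.2 ∈ B}

variable {E : Type u} [NormedAddCommGroup E] [NormedSpace ℝ E]

theorem convex_shortTimes (δ : ℝ) {B : Set E} (hB : Convex ℝ B) :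
    Convex ℝ (shortTimes δ B) := by
  have h1 : Convex ℝ {p : ℝ × ℝ × E | p.1 ∈ Icc (0 : ℝ) 1} :=
    (convex_Icc (0 : ℝ) 1).linear_preimage (LinearMap.fst ℝ ℝ (ℝ × E))
  have h2 : Convex ℝ {p : ℝ × ℝ × E | p.2.1 ∈ Icc (0 : ℝ) 1} :=
    (convex_Icc (0 : ℝ) 1).linear_preimage
      ((LinearMap.fst ℝ ℝ E).comp (LinearMap.snd ℝ ℝ (ℝ × E)))
  have h3 : Convex ℝ {p : ℝ × ℝ × E | p.2.1 - p.1 ∈ Icc (-δ) δ} :=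
    (convex_Icc (-δ) δ).linear_preimage
      ((LinearMap.fst ℝ ℝ E).comp (LinearMap.snd ℝ ℝ (ℝ × E)) - LinearMap.fst ℝ ℝ (ℝ × E))
  have h4 : Convex ℝ {p : ℝ × ℝ × E | p.2.2 ∈ B} :=
    hB.linear_preimage ((LinearMap.snd ℝ ℝ E).comp (LinearMap.snd ℝ ℝ (ℝ × E)))
  convert h1.inter (h2.inter (h3.inter h4)) using 1
  ext p
  simp only [shortTimes, mem_ofPred_eq, mem_inter_iff, abs_le, mem_Icc]

theorem uniqueDiffOn_shortTimes {δ : ℝ} (hδ : 0 < δ) {c : E} {r : ℝ} (hr : 0 < r) :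
    UniqueDiffOn ℝ (shortTimes δ (Metric.ball c r)) := by
  refine uniqueDiffOn_convex (convex_shortTimes δ (convex_ball c r)) ⟨(1 / 2, 1 / 2, c), ?_⟩
  have hopen : IsOpen {p : ℝ × ℝ × E | p.1 ∈ Ioo (0 : ℝ) 1 ∧ p.2.1 ∈ Ioo (0 : ℝ) 1 ∧
      |p.2.1 - p.1| < δ ∧ p.2.2 ∈ Metric.ball c r} := by
    refine (isOpen_Ioo.preimage continuous_fst).inter
      ((isOpen_Ioo.preimage (continuous_fst.comp continuous_snd)).inter
      ((isOpen_lt (f := fun p : ℝ × ℝ × E => |p.2.1 - p.1|) (by fun_prop)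
        (continuous_const (y := δ))).inter
      (Metric.isOpen_ball.preimage (continuous_snd.comp continuous_snd))))
  refine interior_maximal ?_ hopen ?_
  · rintro p ⟨h1, h2, h3, h4⟩
    exact ⟨Ioo_subset_Icc_self h1, Ioo_subset_Icc_self h2, h3.le, h4⟩
  · refine ⟨by norm_num, by norm_num, by simpa using hδ, Metric.mem_ball_self hr⟩

/-- The flow of a time dependent vector field on a ball for short times: `e σ (s, t, x)` is the
position at time `s + σ (t - s)` of the integral curve that is at `x` at time `s`. Rescaling the
time to `[0,1]` makes `s` and `t` parameters like `x`. -/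
theorem exists_smooth_local_flow [FiniteDimensional ℝ E] {V : ℝ → E → E} {c : E} {r : ℝ}
    (hr : 0 < r) (hV : ContDiffOn ℝ ∞ (uncurry V) (Icc 0 1 ×ˢ Metric.ball c r)) :
    ∃ δ > 0, ∃ e : ℝ → ℝ × ℝ × E → E,
      (∀ σ ∈ Icc (0 : ℝ) 1, ContDiffOn ℝ ∞ (e σ) (shortTimes δ (Metric.ball c (r / 4)))) ∧
      (∀ p ∈ shortTimes δ (Metric.ball c (r / 4)), e 0 p = p.2.2 ∧
        (∀ σ ∈ Icc (0 : ℝ) 1, e σ p ∈ Metric.ball c r) ∧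
        (∀ σ ∈ Icc (0 : ℝ) 1, HasDerivWithinAt (e · p)
          ((p.2.1 - p.1) • V (p.1 + σ * (p.2.1 - p.1)) (e σ p)) (Icc 0 1) σ) ∧
        ∃ w : ℝ → E →L[ℝ] E, w 0 = ContinuousLinearMap.id ℝ E ∧
          (∀ σ ∈ Icc (0 : ℝ) 1,
            HasFDerivAt (fun x => e σ (p.1, p.2.1, x)) (w σ) p.2.2) ∧
          ∀ σ ∈ Icc (0 : ℝ) 1, HasDerivWithinAt w ((p.2.1 - p.1) •
            (fderiv ℝ (V (p.1 + σ * (p.2.1 - p.1))) (e σ p)).comp (w σ)) (Icc 0 1) σ) := by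
  have := FiniteDimensional.proper ℝ E
  have := FiniteDimensional.complete ℝ E
  have hsub : Metric.closedBall c (r / 2) ⊆ Metric.ball c r :=
    Metric.closedBall_subset_ball (by linarith)
  have hcpt : IsCompact (Icc (0 : ℝ) 1 ×ˢ Metric.closedBall c (r / 2)) :=
    isCompact_Icc.prod (isCompact_closedBall c _)
  have hsub' : Icc (0 : ℝ) 1 ×ˢ Metric.closedBall c (r / 2) ⊆ Icc 0 1 ×ˢ Metric.ball c r :=
    prod_mono_right hsub
  obtain ⟨L₀, hL₀⟩ := hcpt.exists_bound_of_continuousOn (hV.continuousOn.mono hsub')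
  obtain ⟨K₀, hK₀⟩ := hcpt.exists_bound_of_continuousOn
    ((hV.fderivWithin_uncurry Metric.isOpen_ball.uniqueDiffOn).continuousOn.mono hsub')
  set L := |L₀| + 1 with hL_def
  have hL : 0 < L := by positivity
  -- with speed at most `L`, curves that start in the ball of radius `r / 4` stay in that of
  -- radius `r / 2` for the time `δ`
  set δ := r / (4 * L) with hδ_def
  have hδ : 0 < δ := by positivity
  have hVdiff : ∀ τ ∈ Icc (0 : ℝ) 1, DifferentiableOn ℝ (V τ) (Metric.ball c r) := fun τ hτ =>
    (hV.uncurry_left hτ).differentiableOn (by simp)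
  have hVL : ∀ τ ∈ Icc (0 : ℝ) 1, ∀ y ∈ Metric.closedBall c (r / 2), ‖V τ y‖ ≤ L :=
    fun τ hτ y hy => (hL₀ (τ, y) ⟨hτ, hy⟩).trans (by linarith [le_abs_self L₀])
  have hVK : ∀ τ ∈ Icc (0 : ℝ) 1, ∀ y ∈ Metric.closedBall c (r / 2),
      ∀ z ∈ Metric.closedBall c (r / 2), ‖V τ y - V τ z‖ ≤ |K₀| * ‖y - z‖ := by
    intro τ hτ y hy z hz
    refine (convex_closedBall c (r / 2)).norm_image_sub_le_of_norm_hasFDerivWithin_le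
      (f' := fun y => fderivWithin ℝ (V τ) (Metric.ball c r) y)
      (fun y hy => ((hVdiff τ hτ y (hsub hy)).hasFDerivWithinAt).mono hsub)
      (fun y hy => (hK₀ (τ, y) ⟨hτ, hy⟩).trans (le_abs_self _)) hz hy
  set S := shortTimes δ (Metric.ball c (r / 4)) with hS_def
  have htime : ∀ p ∈ S, ∀ σ ∈ Icc (0 : ℝ) 1, p.1 + σ * (p.2.1 - p.1) ∈ Icc (0 : ℝ) 1 :=
    fun p hp σ hσ => add_mul_sub_mem_Icc hp.1 hp.2.1 hσ
  set f : ℝ → ℝ × ℝ × E → E → E := fun σ p y => (p.2.1 - p.1) • V (p.1 + σ * (p.2.1 - p.1)) y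
  have hδ1 : ∀ p ∈ S, |p.2.1 - p.1| ≤ 1 := by
    rintro p ⟨h1, h2, -⟩
    rw [abs_le]; constructor <;> linarith [h1.1, h1.2, h2.1, h2.2]
  have hfK : ∀ p ∈ S, ∀ σ ∈ Icc (0 : ℝ) 1, ∀ y ∈ Metric.closedBall c (r / 2),
      ∀ z ∈ Metric.closedBall c (r / 2), ‖f σ p y - f σ p z‖ ≤ |K₀| * ‖y - z‖ := by
    intro p hp σ hσ y hy z hz
    rw [← smul_sub, norm_smul, Real.norm_eq_abs]
    have h1 := hVK _ (htime p hp σ hσ) y hy z hz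
    have h2 := mul_le_mul (hδ1 p hp) h1 (norm_nonneg _) zero_le_one
    simpa using h2
  have hex : ∀ p, ∃ α : ℝ → E, p ∈ S → α 0 = p.2.2 ∧
      (∀ σ, α σ ∈ Metric.closedBall c (r / 2)) ∧
      ∀ σ ∈ Icc (0 : ℝ) 1, HasDerivWithinAt α (f σ p (α σ)) (Icc 0 1) σ := by
    intro p
    by_cases hp : p ∈ S
    swap
    · exact ⟨fun _ => 0, fun h => absurd h hp⟩
    have hr2 : ((r / 2).toNNReal : ℝ) = r / 2 := Real.coe_toNNReal _ (by positivity)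
    have hr4 : ((r / 4).toNNReal : ℝ) = r / 4 := Real.coe_toNNReal _ (by positivity)
    have hPL : IsPicardLindelof (fun σ y => f σ p y) (tmin := 0) (tmax := 1)
        ⟨(0 : ℝ), by simp⟩ c (r / 2).toNNReal (r / 4).toNNReal
        (δ * L).toNNReal (|K₀|).toNNReal := by
      refine ⟨fun σ hσ => ?_, fun y hy => ?_, fun σ hσ y hy => ?_, ?_⟩
      · refine LipschitzOnWith.of_dist_le_mul fun y hy z hz => ?_
        rw [hr2] at hy hz
        rw [dist_eq_norm, dist_eq_norm, Real.coe_toNNReal _ (abs_nonneg _)]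
        exact hfK p hp σ hσ y hy z hz
      · rw [hr2] at hy
        refine ContinuousOn.const_smul (hV.continuousOn.comp
          (f := fun σ => (p.1 + σ * (p.2.1 - p.1), y)) (by fun_prop)
          fun σ hσ => ⟨htime p hp σ hσ, hsub hy⟩) _
      · rw [hr2] at hy
        rw [norm_smul, Real.coe_toNNReal _ (by positivity)]
        exact mul_le_mul hp.2.2.1 (hVL _ (htime p hp σ hσ) y hy) (norm_nonneg _) hδ.le
      · rw [hr2, hr4, Real.coe_toNNReal _ (by positivity)]
        have : δ * L = r / 4 := by rw [hδ_def]; field_simp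
        rw [this]; norm_num; linarith
    obtain ⟨α, h1, h2, h3⟩ := hPL.exists_solution_mem_closedBall (x := p.2.2)
      (by rw [hr4]; exact Metric.ball_subset_closedBall hp.2.2.2)
    rw [hr2] at h2
    exact ⟨α, fun _ => ⟨h1, h2, h3⟩⟩
  choose α hα using hex
  set e : ℝ → ℝ × ℝ × E → E := fun σ p => α p σ
  have he0 : ∀ p ∈ S, e 0 p = p.2.2 := fun p hp => (hα p hp).1
  have hemem' : ∀ p ∈ S, ∀ σ, e σ p ∈ Metric.closedBall c (r / 2) := fun p hp => (hα p hp).2.1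
  have hemem : ∀ p ∈ S, ∀ σ, e σ p ∈ Metric.ball c r := fun p hp σ => hsub (hemem' p hp σ)
  have hed : ∀ p ∈ S, ∀ σ ∈ Icc (0 : ℝ) 1, HasDerivWithinAt (e · p) (f σ p (e σ p)) (Icc 0 1) σ :=
    fun p hp => (hα p hp).2.2
  have hec : ContinuousOn (uncurry e) (Icc 0 1 ×ˢ S) := by
    refine continuousOn_uncurry_of_lipschitz_ode (f := f) (fun p hp => ?_) (fun p hp => ?_) ?_ hed
    · have c1 : ContinuousOn (fun z : (ℝ × ℝ × E) × ℝ => e z.2 p) (S ×ˢ Icc (0 : ℝ) 1) := by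
        have c0 : ContinuousOn (fun σ => e σ p) (Icc 0 1) := fun σ hσ =>
          (hed p hp σ hσ).continuousWithinAt
        exact c0.comp (f := fun z : (ℝ × ℝ × E) × ℝ => z.2) (by fun_prop) fun z hz => hz.2
      refine ContinuousOn.smul (by fun_prop) (hV.continuousOn.comp
        (f := fun z : (ℝ × ℝ × E) × ℝ => (z.1.1 + z.2 * (z.1.2.1 - z.1.1), e z.2 p))
        (ContinuousOn.prodMk (by fun_prop) c1)
        fun z hz => ⟨htime z.1 hz.1 z.2 hz.2, hemem p hp _⟩)
    · refine ⟨|K₀|, ?_⟩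
      filter_upwards [self_mem_nhdsWithin] with q hq σ hσ
      exact hfK q hq σ hσ _ (hemem' q hq σ) _ (hemem' p hp σ)
    · exact ContinuousOn.congr (by fun_prop) he0
  have hSu : UniqueDiffOn ℝ S := uniqueDiffOn_shortTimes hδ (by positivity)
  refine ⟨δ, hδ, e, fun σ hσ => ?_, fun p hp => ⟨he0 p hp, fun σ _ => hemem p hp σ, hed p hp, ?_⟩⟩
  · -- smoothness in `(s, t, x)`: the system in which `s` and `t` are constant
    have h1 := contDiffOn_ode_solution (Q := ℝ × ℝ × E) (S := S)
      (D := Icc (0 : ℝ) 1 ×ˢ (Icc (0 : ℝ) 1 ×ˢ Metric.ball c r))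
      (V := fun σ y => ((0 : ℝ), (0 : ℝ), f σ y y.2.2))
      (u := fun σ p => (p.1, p.2.1, e σ p))
      ((convex_Icc _ _).prod ((convex_Icc _ _).prod (convex_ball _ _)))
      ((uniqueDiffOn_Icc zero_lt_one).prod ((uniqueDiffOn_Icc zero_lt_one).prod
        Metric.isOpen_ball.uniqueDiffOn)) ?_ hSu ?_ ?_ ?_ ?_ σ hσ
    · exact contDiff_snd.comp_contDiffOn (contDiff_snd.comp_contDiffOn h1)
    · refine contDiffOn_const.prodMk (contDiffOn_const.prodMk (ContDiffOn.smul (by fun_prop)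
        (hV.comp (f := fun z : ℝ × ℝ × ℝ × E =>
          (z.2.1 + z.1 * (z.2.2.1 - z.2.1), z.2.2.2)) (by fun_prop) ?_)))
      rintro ⟨σ, s, t, x⟩ ⟨h1, h2, h3, h4⟩
      exact ⟨add_mul_sub_mem_Icc h2 h3 h1, h4⟩
    · refine ContDiffOn.congr (f := fun p : ℝ × ℝ × E => (p.1, p.2.1, p.2.2)) (by fun_prop) ?_
      intro p hp
      simp only [he0 p hp]
    · exact fun σ _ q hq => ⟨hq.1, hq.2.1, hemem q hq σ⟩
    · exact fun q hq σ hσ => (hasDerivWithinAt_const σ _ q.1).prodMk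
        ((hasDerivWithinAt_const σ _ q.2.1).prodMk (hed q hq σ hσ))
    · exact ContinuousOn.prodMk (by fun_prop) (ContinuousOn.prodMk (by fun_prop) hec)
  · -- the derivative in `x`, for fixed `s` and `t`
    have hps : ∀ x ∈ Metric.ball c (r / 4), ((p.1, p.2.1, x) : ℝ × ℝ × E) ∈ S :=
      fun x hx => ⟨hp.1, hp.2.1, hp.2.2.1, hx⟩
    have hVf : ContDiffOn ℝ ∞ (uncurry fun σ y => f σ p y) (Icc 0 1 ×ˢ Metric.ball c r) :=
      contDiffOn_const.smul (hV.comp (f := fun z : ℝ × E => (p.1 + z.1 * (p.2.1 - p.1), z.2))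
        (by fun_prop) fun z hz => ⟨htime p hp z.1 hz.1, hz.2⟩)
    obtain ⟨w, -, hw0, hw, hwd⟩ := exists_hasFDerivWithinAt_ode_solution
      (S := Metric.ball c (r / 4)) (D := Metric.ball c r) (V := fun σ y => f σ p y)
      (u := fun σ x => e σ (p.1, p.2.1, x))
      (convex_ball _ _) Metric.isOpen_ball.uniqueDiffOn hVf Metric.isOpen_ball.uniqueDiffOn
      (contDiffOn_id.congr fun x hx => he0 _ (hps x hx))
      (fun σ _ x hx => hemem _ (hps x hx) σ) (fun x hx => hed _ (hps x hx))
      (hec.comp (f := fun z : ℝ × E => (z.1, p.1, p.2.1, z.2)) (by fun_prop)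
        fun z hz => ⟨hz.1, hps _ hz.2⟩)
    refine ⟨fun σ => w σ p.2.2, ?_, fun σ hσ => ?_, fun σ hσ => ?_⟩
    · simp only []
      rw [hw0, fderivWithin_congr (f := id) (fun x hx => he0 _ (hps x hx)) (he0 _ hp),
        fderivWithin_id (Metric.isOpen_ball.uniqueDiffWithinAt hp.2.2.2)]
    · exact (hwd _ hp.2.2.2 σ hσ).hasFDerivAt (Metric.isOpen_ball.mem_nhds hp.2.2.2)
    · have h1 := hw _ hp.2.2.2 σ hσ
      have h2 : fderivWithin ℝ (fun y => f σ p y) (Metric.ball c r) (e σ p)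
          = (p.2.1 - p.1) • fderiv ℝ (V (p.1 + σ * (p.2.1 - p.1))) (e σ p) := by
        rw [fderivWithin_of_isOpen Metric.isOpen_ball (hemem p hp σ)]
        exact fderiv_const_smul ((hVdiff _ (htime p hp σ hσ)).differentiableAt
          (Metric.isOpen_ball.mem_nhds (hemem p hp σ))) _
      rw [← ContinuousLinearMap.smul_comp, ← h2]
      exact h1

end LocalFlow

/-! ### Local lifts of maps between orbifolds -/

section Lifts

variable {n m : ℕ} {N M : Type*} [TopologicalSpace N] [TopologicalSpace M]

theorem Filter.Tendsto.eventually_ne_of_ne {ι Z : Type*} [TopologicalSpace Z] [T2Space Z]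
    {l : Filter ι} {f g : ι → Z} {a b : Z} (hf : Filter.Tendsto f l (𝓝 a))
    (hg : Filter.Tendsto g l (𝓝 b)) (hab : a ≠ b) : ∀ᶠ i in l, f i ≠ g i :=
  (hf.prodMk_nhds hg).eventually
    ((isClosed_diagonal.isOpen_compl).mem_nhds (x := (a, b)) (by simpa using hab))

theorem IsSmoothLift.mono {f : N → M} {α : OrbifoldChart n N} {β : OrbifoldChart m M}
    {W W' : Set (OrbModel n)} {F : OrbModel n → OrbModel m} (h : IsSmoothLift f α β W F)
    (hW : W' ⊆ W) : IsSmoothLift f α β W' F :=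
  ⟨h.mapsTo.mono_left hW, h.contDiffOn.mono hW, fun x hx => h.covers x (hW hx)⟩

theorem IsSmoothLift.differentiableAt {f : N → M} {α : OrbifoldChart n N} {β : OrbifoldChart m M}
    {W : Set (OrbModel n)} {F : OrbModel n → OrbModel m} (h : IsSmoothLift f α β W F)
    (hW : IsOpen W) {x : OrbModel n} (hx : x ∈ W) : DifferentiableAt ℝ F x :=
  (h.contDiffOn.differentiableOn (by simp)).differentiableAt (hW.mem_nhds hx)

theorem IsSmoothLift.comp {l : ℕ} {L : Type*} [TopologicalSpace L] {f : N → M} {f' : M → L}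
    {α : OrbifoldChart n N} {β : OrbifoldChart m M} {γ : OrbifoldChart l L}
    {W : Set (OrbModel n)} {W' : Set (OrbModel m)} {F : OrbModel n → OrbModel m}
    {F' : OrbModel m → OrbModel l} (h' : IsSmoothLift f' β γ W' F') (h : IsSmoothLift f α β W F)
    (hm : MapsTo F W W') : IsSmoothLift (f' ∘ f) α γ W (F' ∘ F) :=
  ⟨h'.mapsTo.comp hm, h'.contDiffOn.comp h.contDiffOn hm, fun x hx => by
    rw [comp_apply, h'.covers _ (hm hx), h.covers x hx, comp_apply]⟩

/-- Two smooth lifts of the same map differ, to first order, by an element of the group at every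
point: they differ by a locally constant element on a dense open set, and the group is finite. -/
theorem IsSmoothLift.exists_eq_group_action {f : N → M} {α : OrbifoldChart n N}
    {β : OrbifoldChart m M}
    {W : Set (OrbModel n)} (hW : IsOpen W) {F G : OrbModel n → OrbModel m}
    (hF : IsSmoothLift f α β W F) (hG : IsSmoothLift f α β W G) {x : OrbModel n} (hx : x ∈ W) :
    ∃ g ∈ β.Γ, F x = g (G x) ∧
      fderiv ℝ F x = (g : OrbModel m →L[ℝ] OrbModel m).comp (fderiv ℝ G x) := by
  have := β.finite_Γ
  have cF : ∀ z ∈ W, ContinuousAt F z := fun z hz => (hF.differentiableAt hW hz).continuousAt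
  have cG : ∀ z ∈ W, ContinuousAt G z := fun z hz => (hG.differentiableAt hW hz).continuousAt
  have dF := hF.contDiffOn.continuousOn_fderiv_of_isOpen hW (by simp)
  have dG := hG.contDiffOn.continuousOn_fderiv_of_isOpen hW (by simp)
  by_contra! hne
  have hev : ∀ g : β.Γ, ∀ᶠ z in 𝓝 x, ¬ (F z = g.1 (G z) ∧
      fderiv ℝ F z = (g.1 : OrbModel m →L[ℝ] OrbModel m).comp (fderiv ℝ G z)) := by
    intro g
    by_cases h : F x = g.1 (G x)
    · have c : ContinuousAt (fun z =>
          (g.1 : OrbModel m →L[ℝ] OrbModel m).comp (fderiv ℝ G z)) x :=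
        continuousAt_const.clm_comp (dG.continuousAt (hW.mem_nhds hx))
      filter_upwards [Filter.Tendsto.eventually_ne_of_ne (dF.continuousAt (hW.mem_nhds hx)) c
        (hne g.1 g.2 h)] with z hz h' using hz h'.2
    · have c : ContinuousAt (fun z => g.1 (G z)) x :=
        g.1.continuous.continuousAt.comp (cG x hx)
      filter_upwards [Filter.Tendsto.eventually_ne_of_ne (cF x hx) c h] with z hz h' using hz h'.1
  obtain ⟨O, hO, hOo, hxO⟩ := mem_nhds_iff.1
    (Filter.inter_mem (Filter.eventually_all.2 hev) (hW.mem_nhds hx))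
  -- the closed sets on which `F` and `G` differ by a given element, and the complement of `W`
  let K : Option β.Γ → Set (OrbModel n) := fun i =>
    i.elim Wᶜ fun g => closure {z | z ∈ W ∧ F z = g.1 (G z)}
  have hKc : ∀ i, IsClosed (K i) := by
    rintro (_ | g)
    · exact hW.isClosed_compl
    · exact isClosed_closure
  have hKu : ⋃ i, K i = univ := by
    refine eq_univ_of_forall fun z => mem_iUnion.2 ?_
    by_cases hz : z ∈ W
    · obtain ⟨g, hg, h⟩ := (β.proj_eq_iff _ (hG.mapsTo hz) _ (hF.mapsTo hz)).1
        ((hG.covers z hz).trans (hF.covers z hz).symm)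
      exact ⟨some ⟨g, hg⟩, subset_closure ⟨hz, h.symm⟩⟩
    · exact ⟨none, hz⟩
  obtain ⟨z, hzO, hz⟩ := (dense_iUnion_interior_of_closed hKc hKu).inter_open_nonempty O hOo
    ⟨x, hxO⟩
  obtain ⟨i, hi⟩ := mem_iUnion.1 hz
  have hOW : O ⊆ W := fun z hz => (hO hz).2
  rcases i with _ | g
  · exact interior_subset hi (hOW hzO)
  · have heq : ∀ᶠ y in 𝓝 z, F y = g.1 (G y) := by
      filter_upwards [isOpen_interior.mem_nhds hi, hW.mem_nhds (hOW hzO)] with y hy hyW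
      by_contra hyne
      have hc : y ∈ closure {z | z ∈ W ∧ F z = g.1 (G z)} := interior_subset hy
      have c : ContinuousAt (fun z => g.1 (G z)) y := g.1.continuous.continuousAt.comp (cG y hyW)
      obtain ⟨y', hy'1, hy'2⟩ := mem_closure_iff_nhds.1 hc _
        (Filter.Tendsto.eventually_ne_of_ne (cF y hyW) c hyne)
      exact hy'1 hy'2.2
    refine (hO hzO).1 g ⟨heq.self_of_nhds, ?_⟩
    rw [Filter.EventuallyEq.fderiv_eq heq]
    exact (HasFDerivAt.comp z (g.1 : OrbModel m →L[ℝ] OrbModel m).hasFDerivAt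
      (hG.differentiableAt hW (hOW hzO)).hasFDerivAt).fderiv

/-- Two continuous families of local lifts, one of them by immersions, differ by one element of
the group over a connected set. -/
theorem exists_eq_group_action_of_isPreconnected {α : OrbifoldChart n N}
    {β : OrbifoldChart n M} {f : ℝ → N → M} {J : Set ℝ} {W : Set (OrbModel n)} (hW : IsOpen W)
    {F G : ℝ → OrbModel n → OrbModel n} (hJ : IsPreconnected J) (hWc : IsPreconnected W)
    (hF : ContDiffOn ℝ ∞ (uncurry F) (J ×ˢ W)) (hG : ContDiffOn ℝ ∞ (uncurry G) (J ×ˢ W))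
    (hFl : ∀ s ∈ J, IsSmoothLift (f s) α β W (F s)) (hGl : ∀ s ∈ J, IsSmoothLift (f s) α β W (G s))
    (hGi : ∀ s ∈ J, ∀ y ∈ W, Injective (fderiv ℝ (G s) y)) :
    ∃ g ∈ β.Γ, ∀ s ∈ J, ∀ y ∈ W, F s y = g (G s y) := by
  have := β.finite_Γ
  let P : β.Γ → ℝ × OrbModel n → Prop := fun g z => F z.1 z.2 = g.1 (G z.1 z.2) ∧
    fderiv ℝ (F z.1) z.2 = (g.1 : OrbModel n →L[ℝ] OrbModel n).comp (fderiv ℝ (G z.1) z.2)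
  have hex : ∀ z ∈ J ×ˢ W, ∃ g, P g z := by
    rintro ⟨s, y⟩ ⟨hs, hy⟩
    obtain ⟨g, hg, h⟩ := (hFl s hs).exists_eq_group_action hW (hGl s hs) hy
    exact ⟨⟨g, hg⟩, h⟩
  have hinj : ∀ z ∈ J ×ˢ W, ∀ g h, P g z → P h z → g = h := by
    rintro ⟨s, y⟩ ⟨hs, hy⟩ g h hg hh
    have h1 := hg.2.symm.trans hh.2
    have h2 : Surjective (fderiv ℝ (G s) y) :=
      LinearMap.surjective_of_injective (f := (fderiv ℝ (G s) y).toLinearMap) (hGi s hs y hy)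
    refine Subtype.ext (ContinuousLinearEquiv.ext (funext fun v => ?_))
    obtain ⟨u, rfl⟩ := h2 v
    exact congrArg (fun L : OrbModel n →L[ℝ] OrbModel n => L u) h1
  have dcont : ∀ {H : ℝ → OrbModel n → OrbModel n}, ContDiffOn ℝ ∞ (uncurry H) (J ×ˢ W) →
      ContinuousOn (fun z : ℝ × OrbModel n => fderiv ℝ (H z.1) z.2) (J ×ˢ W) := by
    intro H hH
    refine (hH.fderivWithin_uncurry hW.uniqueDiffOn).continuousOn.congr ?_
    rintro ⟨s, y⟩ ⟨-, hy⟩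
    exact (fderivWithin_of_isOpen hW hy).symm
  have hfalse : ∀ g, ∀ z ∈ J ×ˢ W, ¬ P g z → ∀ᶠ z' in 𝓝[J ×ˢ W] z, ¬ P g z' := by
    intro g z hz hP
    by_cases h : F z.1 z.2 = g.1 (G z.1 z.2)
    · have c := continuousWithinAt_const (b := (g.1 : OrbModel n →L[ℝ] OrbModel n)).clm_comp
        (dcont hG z hz)
      have hne : fderiv ℝ (F z.1) z.2 ≠
          (g.1 : OrbModel n →L[ℝ] OrbModel n).comp (fderiv ℝ (G z.1) z.2) := fun h' => hP ⟨h, h'⟩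
      filter_upwards [Filter.Tendsto.eventually_ne_of_ne (dcont hF z hz) c hne] with z' h1 h2
        using h1 h2.2
    · have c := g.1.continuous.continuousAt.comp_continuousWithinAt (hG.continuousOn z hz)
      filter_upwards [Filter.Tendsto.eventually_ne_of_ne (hF.continuousOn z hz) c h] with z' h1 h2
        using h1 h2.1
  rcases (J ×ˢ W).eq_empty_or_nonempty with he | ⟨z₀, hz₀⟩
  · exact ⟨1, one_mem _, fun s hs y hy => absurd (show (s, y) ∈ J ×ˢ W from ⟨hs, hy⟩) (by simp [he])⟩
  obtain ⟨g, hg⟩ := hex z₀ hz₀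
  classical
  have hcont : ContinuousOn (fun z => decide (P g z)) (J ×ˢ W) := by
    intro z hz
    refine tendsto_nhds_of_eventually_eq ?_
    by_cases hP : P g z
    · have h1 : ∀ᶠ z' in 𝓝[J ×ˢ W] z, ∀ h, h ≠ g → ¬ P h z' := by
        refine Filter.eventually_all.2 fun h => ?_
        by_cases hgh : h = g
        · exact .of_forall fun _ h' => absurd hgh h'
        · filter_upwards [hfalse h z hz fun h' => hgh (hinj z hz _ _ h' hP)] with z' hz' _ using hz'
      filter_upwards [h1, self_mem_nhdsWithin] with z' h2 h3
      obtain ⟨h, hh⟩ := hex z' h3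
      have : h = g := by_contra fun h' => h2 h h' hh
      subst this
      simp [hP, hh]
    · filter_upwards [hfalse g z hz hP] with z' h2
      simp [hP, h2]
  refine ⟨g.1, g.2, fun s hs y hy => ?_⟩
  have := (hJ.prod hWc).constant hcont (show (s, y) ∈ J ×ˢ W from ⟨hs, hy⟩) hz₀
  simp only [hg, decide_true, decide_eq_true_eq] at this
  exact this.1

end Lifts

/-! ### Transitions between charts -/

section Transitions

variable {n : ℕ} {N : Type*} [TopologicalSpace N]

/-- Near `x` in the chart `α` there is a smooth lift of the identity of the orbifold with values
in the chart `β` which sends `x` to `y`, is a local diffeomorphism, and pulls back every orbifold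
form to itself. -/
def HasTransition (X : OrbifoldStructure n N) (α β : X.charts) (x y : OrbModel n) : Prop :=
  ∃ (W : Set (OrbModel n)) (τ : OrbModel n → OrbModel n), IsOpen W ∧ x ∈ W ∧ W ⊆ α.1.dom ∧
    IsSmoothLift id α.1 β.1 W τ ∧ τ x = y ∧ (∀ z ∈ W, Injective (fderiv ℝ τ z)) ∧
    ∀ (k : ℕ) (Ω : OrbifoldForm X k), ∀ z ∈ W,
      (Ω.form β (τ z)).compContinuousLinearMap (fderiv ℝ τ z) = Ω.form α z

namespace HasTransition

variable {X : OrbifoldStructure n N} {α β γ : X.charts} {x y z : OrbModel n}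

theorem of_isEmbedding {φ : OrbModel n → OrbModel n} (h : α.1.IsEmbedding β.1 φ)
    (hx : x ∈ α.1.dom) : HasTransition X α β x (φ x) :=
  ⟨α.1.dom, φ, α.1.isOpen_dom, hx, Subset.rfl, ⟨h.mapsTo, h.contDiffOn, h.covers⟩, rfl,
    h.immersion, fun _ Ω => Ω.glue α β φ h⟩

theorem of_mem_group {g : OrbModel n ≃L[ℝ] OrbModel n} (hg : g ∈ α.1.Γ) (hx : x ∈ α.1.dom) :
    HasTransition X α α x (g x) := by
  refine ⟨α.1.dom, g, α.1.isOpen_dom, hx, Subset.rfl, ⟨fun z hz => α.1.smul_mem_dom g hg z hz,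
    g.contDiff.contDiffOn, fun z hz => ?_⟩, rfl, fun z _ => ?_, fun k Ω z hz => ?_⟩
  · exact ((α.1.proj_eq_iff z hz _ (α.1.smul_mem_dom g hg z hz)).2 ⟨g, hg, rfl⟩).symm
  · rw [g.fderiv]; exact g.injective
  · rw [g.fderiv]; exact Ω.invariant α g hg z hz

theorem trans (h₁ : HasTransition X α β x y) (h₂ : HasTransition X β γ y z) :
    HasTransition X α γ x z := by
  obtain ⟨W, τ, hWo, hxW, hWd, hτ, hτx, hinj, hform⟩ := h₁
  obtain ⟨W', τ', hWo', hxW', hWd', hτ', hτx', hinj', hform'⟩ := h₂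
  have hfd : ∀ z ∈ W ∩ τ ⁻¹' W', fderiv ℝ (τ' ∘ τ) z = (fderiv ℝ τ' (τ z)).comp (fderiv ℝ τ z) :=
    fun z hz => fderiv_comp z (hτ'.differentiableAt hWo' hz.2) (hτ.differentiableAt hWo hz.1)
  refine ⟨W ∩ τ ⁻¹' W', τ' ∘ τ, hτ.contDiffOn.continuousOn.isOpen_inter_preimage hWo hWo',
    ⟨hxW, by rwa [mem_preimage, hτx]⟩, inter_subset_left.trans hWd,
    IsSmoothLift.comp hτ' (hτ.mono inter_subset_left) fun z hz => hz.2,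
    by rw [comp_apply, hτx, hτx'], fun z hz => ?_, fun k Ω z hz => ?_⟩
  · rw [hfd z hz]
    exact (hinj' _ hz.2).comp (hinj _ hz.1)
  · rw [hfd z hz, comp_apply, ← hform k Ω z hz.1, ← hform' k Ω _ hz.2]
    rfl

theorem symm (h : HasTransition X α β x y) : HasTransition X β α y x := by
  obtain ⟨W, τ, hWo, hxW, hWd, hτ, rfl, hinj, hform⟩ := h
  have hcd : ∀ z ∈ W, ContDiffAt ℝ ∞ τ z := fun z hz => hτ.contDiffOn.contDiffAt (hWo.mem_nhds hz)
  have hder : ∀ z ∈ W, ∃ e : OrbModel n ≃L[ℝ] OrbModel n,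
      HasFDerivAt τ (e : OrbModel n →L[ℝ] OrbModel n) z := by
    intro z hz
    refine ⟨(LinearEquiv.ofInjectiveEndo (fderiv ℝ τ z).toLinearMap
      (hinj z hz)).toContinuousLinearEquiv, ?_⟩
    convert (hτ.differentiableAt hWo hz).hasFDerivAt using 1
    ext v : 1
    rfl
  obtain ⟨e, he⟩ := hder x hxW
  set T := ((hcd x hxW).toOpenPartialHomeomorph τ he (by simp)) with hT
  have hTτ : (T : OrbModel n → OrbModel n) = τ := rfl
  have hxT : x ∈ T.source := (hcd x hxW).mem_toOpenPartialHomeomorph_source he (by simp)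
  have hgood : ∀ z ∈ T.target ∩ T.symm ⁻¹' W, T.symm z ∈ W ∧ τ (T.symm z) = z ∧
      ContDiffAt ℝ ∞ T.symm z := by
    rintro z ⟨hz1, hz2⟩
    obtain ⟨e', he'⟩ := hder _ hz2
    exact ⟨hz2, T.right_inv hz1, T.contDiffAt_symm hz1 he' (hcd _ hz2)⟩
  have hopen : IsOpen (T.target ∩ T.symm ⁻¹' W) :=
    T.symm.continuousOn.isOpen_inter_preimage T.open_target hWo
  have hfd : ∀ z ∈ T.target ∩ T.symm ⁻¹' W,
      (fderiv ℝ τ (T.symm z)).comp (fderiv ℝ T.symm z) = ContinuousLinearMap.id ℝ _ := by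
    intro z hz
    obtain ⟨h1, h2, h3⟩ := hgood z hz
    rw [← fderiv_comp z (hτ.differentiableAt hWo h1) (h3.differentiableAt (by simp)),
      ← fderiv_id (𝕜 := ℝ) (x := z)]
    refine Filter.EventuallyEq.fderiv_eq ?_
    filter_upwards [hopen.mem_nhds hz] with z' hz' using (hgood z' hz').2.1
  have hTx : T.symm (τ x) = x := T.left_inv hxT
  refine ⟨T.target ∩ T.symm ⁻¹' W, T.symm, hopen, ⟨T.map_source hxT, ?_⟩, fun z hz => ?_,
    ⟨fun z hz => ?_, fun z hz => (hgood z hz).2.2.contDiffWithinAt, fun z hz => ?_⟩, hTx,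
    fun z hz => ?_, fun k Ω z hz => ?_⟩
  · rw [mem_preimage, hTx]; exact hxW
  · rw [← (hgood z hz).2.1]; exact hτ.mapsTo (hgood z hz).1
  · exact hWd (hgood z hz).1
  · have := hτ.covers _ (hgood z hz).1
    rw [(hgood z hz).2.1] at this
    exact this.symm
  · refine LeftInverse.injective (g := fderiv ℝ τ (T.symm z)) fun v => ?_
    exact congrArg (fun L : OrbModel n →L[ℝ] OrbModel n => L v) (hfd z hz)
  · rw [← hform k Ω _ (hgood z hz).1, (hgood z hz).2.1]
    ext v
    have h1 : ∀ w, fderiv ℝ τ (T.symm z) (fderiv ℝ T.symm z w) = w := fun w =>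
      congrArg (fun L : OrbModel n →L[ℝ] OrbModel n => L w) (hfd z hz)
    simp only [ContinuousAlternatingMap.compContinuousLinearMap_apply]
    congr 1
    funext i
    exact h1 (v i)

end HasTransition

/-- Any two points in charts with the same image in the orbifold are related by a transition. -/
theorem hasTransition (X : OrbifoldStructure n N) (α β : X.charts) {x y : OrbModel n}
    (hx : x ∈ α.1.dom) (hy : y ∈ β.1.dom) (h : α.1.proj x = β.1.proj y) :
    HasTransition X α β x y := by
  obtain ⟨γ, hγ, ⟨z, hz, hzp⟩, hsub⟩ := X.isAtlas.inter α.1 α.2 β.1 β.2 (α.1.proj x)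
    ⟨mem_image_of_mem _ hx, h ▸ mem_image_of_mem _ hy⟩
  obtain ⟨φ, hφ⟩ := X.isAtlas.embed γ hγ α.1 α.2 (hsub.trans inter_subset_left)
  obtain ⟨ψ, hψ⟩ := X.isAtlas.embed γ hγ β.1 β.2 (hsub.trans inter_subset_right)
  obtain ⟨g, hg, hgx⟩ := (α.1.proj_eq_iff x hx _ (hφ.mapsTo hz)).1
    (hzp.symm.trans (hφ.covers z hz).symm)
  obtain ⟨g', hg', hgy⟩ := (β.1.proj_eq_iff _ (hψ.mapsTo hz) y hy).1
    ((hψ.covers z hz).trans (hzp.trans h))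
  have h1 := HasTransition.of_mem_group (X := X) (α := α) hg hx
  rw [hgx] at h1
  have h2 := HasTransition.of_isEmbedding (X := X) (α := ⟨γ, hγ⟩) (β := α) hφ hz
  have h3 := HasTransition.of_isEmbedding (X := X) (α := ⟨γ, hγ⟩) (β := β) hψ hz
  have h4 := HasTransition.of_mem_group (X := X) (α := β) hg' (hψ.mapsTo hz)
  rw [hgy] at h4
  exact h1.trans (h2.symm.trans (h3.trans h4))

/-- Every smooth lift of the identity is a local diffeomorphism and pulls back orbifold forms to
themselves. -/
theorem IsSmoothLift.injective_fderiv_and_pullback {X : OrbifoldStructure n N} {α β : X.charts}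
    {W : Set (OrbModel n)} (hW : IsOpen W) (hWd : W ⊆ α.1.dom) {τ : OrbModel n → OrbModel n}
    (hτ : IsSmoothLift id α.1 β.1 W τ) {x : OrbModel n} (hx : x ∈ W) :
    Injective (fderiv ℝ τ x) ∧ ∀ (k : ℕ) (Ω : OrbifoldForm X k),
      (Ω.form β (τ x)).compContinuousLinearMap (fderiv ℝ τ x) = Ω.form α x := by
  obtain ⟨W', τ', hWo, hxW, hWd', hτ', hτx, hinj, hform⟩ :=
    hasTransition X α β (hWd hx) (hτ.mapsTo hx) (hτ.covers x hx).symm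
  obtain ⟨g, hg, h1, h2⟩ := IsSmoothLift.exists_eq_group_action (hW.inter hWo)
    (hτ.mono inter_subset_left) (hτ'.mono inter_subset_right) ⟨hx, hxW⟩
  rw [h2]
  refine ⟨g.injective.comp (hinj x hxW), fun k Ω => ?_⟩
  rw [h1, ← hform k Ω x hxW, ← Ω.invariant β g hg _ (hτ'.mapsTo hxW)]
  rfl

end Transitions

/-! ### Primitives of families of closed forms on balls -/

section Poincare

theorem eq_of_hasDerivWithinAt_eq {Y : Type*} [NormedAddCommGroup Y] [NormedSpace ℝ Y]
    {f g f' : ℝ → Y} (hf : ∀ σ ∈ Icc (0 : ℝ) 1, HasDerivWithinAt f (f' σ) (Icc 0 1) σ)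
    (hg : ∀ σ ∈ Icc (0 : ℝ) 1, HasDerivWithinAt g (f' σ) (Icc 0 1) σ) (h0 : f 0 = g 0) :
    ∀ σ ∈ Icc (0 : ℝ) 1, f σ = g σ := by
  intro σ hσ
  have := norm_le_mul_exp_of_norm_deriv_le (f := fun σ => f σ - g σ) (δ := 0) (K := 1) (ε := 0)
    le_rfl le_rfl (fun σ hσ => (hf σ hσ).sub (hg σ hσ)) (by simp [h0]) (fun σ _ => by simp) σ hσ
  simpa [sub_eq_zero] using this

variable {E : Type} [NormedAddCommGroup E] [NormedSpace ℝ E]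

theorem hasFDerivAt_slice {Y : Type*} [NormedAddCommGroup Y] [NormedSpace ℝ Y] {s : Set ℝ}
    {B : Set E} (hB : IsOpen B) {f : ℝ × E → Y} {f' : ℝ × E →L[ℝ] Y} {t : ℝ} {x : E} (ht : t ∈ s)
    (hx : x ∈ B) (hf : HasFDerivWithinAt f f' (s ×ˢ B) (t, x)) :
    HasFDerivAt (fun y => f (t, y)) (f'.comp (ContinuousLinearMap.inr ℝ ℝ E)) x := by
  have h := hf.comp (t := s ×ˢ B) (s := B) (f := fun y => (t, y)) x
    (hasFDerivAt_prodMk_right t x).hasFDerivWithinAt fun y hy => ⟨ht, hy⟩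
  exact h.hasFDerivAt (hB.mem_nhds hx)

/-- Integrals of a smooth family of `1`-forms along the radii of a ball depend smoothly on the
parameter and the end point; they compute the potentials of those forms that are exact. -/
theorem exists_smooth_radial_integral [CompleteSpace E] {a : E} {ε : ℝ} {θ : ℝ → E → E →L[ℝ] ℝ}
    (hθ : ContDiffOn ℝ ∞ (uncurry θ) (Icc 0 1 ×ˢ Metric.ball a ε)) :
    ∃ z : ℝ → E → ℝ, ContDiffOn ℝ ∞ (uncurry z) (Icc 0 1 ×ˢ Metric.ball a ε) ∧
      ∀ t ∈ Icc (0 : ℝ) 1, ∀ f : E → ℝ, (∀ x ∈ Metric.ball a ε, HasFDerivAt f (θ t x) x) →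
        ∀ x ∈ Metric.ball a ε, z t x = f x - f a := by
  have hseg : ∀ σ ∈ Icc (0 : ℝ) 1, ∀ x ∈ Metric.ball a ε, a + σ • (x - a) ∈ Metric.ball a ε :=
    fun σ hσ x hx => (convex_ball a ε).add_smul_sub_mem
      (Metric.mem_ball_self (dist_nonneg.trans_lt hx)) hx hσ
  set F : ℝ → ℝ × E → ℝ := fun σ p => θ p.1 (a + σ • (p.2 - a)) (p.2 - a)
  have hF : ContDiffOn ℝ ∞ (uncurry F) (Icc 0 1 ×ˢ (Icc (0 : ℝ) 1 ×ˢ Metric.ball a ε)) := by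
    refine ContDiffOn.clm_apply (hθ.comp
      (f := fun z : ℝ × ℝ × E => (z.2.1, a + z.1 • (z.2.2 - a))) (by fun_prop) ?_) (by fun_prop)
    rintro ⟨σ, t, x⟩ ⟨h1, h2, h3⟩
    exact ⟨h2, hseg σ h1 x h3⟩
  obtain ⟨z, hz0, hz', hzs, -⟩ := exists_smooth_antiderivative
    ((convex_Icc (0 : ℝ) 1).prod (convex_ball a ε))
    ((uniqueDiffOn_Icc zero_lt_one).prod Metric.isOpen_ball.uniqueDiffOn) hF
  refine ⟨fun t x => z 1 (t, x), hzs 1 (by simp), fun t ht f hf x hx => ?_⟩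
  have := eq_of_hasDerivWithinAt_eq (f := fun σ => z σ (t, x))
    (g := fun σ => f (a + σ • (x - a)) - f a) (hz' (t, x) ⟨ht, hx⟩) (fun σ hσ => ?_)
    (by simp [hz0]) 1 (by simp)
  · simpa using this
  · have h1 : HasDerivAt (fun σ : ℝ => a + σ • (x - a)) (x - a) σ := by
      simpa using ((hasDerivAt_id σ).smul_const (x - a)).const_add a
    exact (((hf _ (hseg σ hσ x hx)).comp_hasDerivAt σ h1).sub_const (f a)).hasDerivWithinAt

/-- The Poincaré lemma for smooth families of closed `2`-forms on a ball. -/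
theorem exists_smooth_primitive [FiniteDimensional ℝ E] {c : E} {r : ℝ}
    {b : ℝ → E → E →L[ℝ] E →L[ℝ] ℝ}
    (hb : ContDiffOn ℝ ∞ (uncurry b) (Icc 0 1 ×ˢ Metric.ball c r))
    (halt : ∀ t ∈ Icc (0 : ℝ) 1, ∀ x ∈ Metric.ball c r, ∀ u v, b t x u v = - b t x v u)
    (hclosed : ∀ t ∈ Icc (0 : ℝ) 1, ∀ x ∈ Metric.ball c r, ∀ w u v,
      fderiv ℝ (b t) x w u v - fderiv ℝ (b t) x u w v + fderiv ℝ (b t) x v w u = 0) :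
    ∃ η : ℝ → E → E →L[ℝ] ℝ, ContDiffOn ℝ ∞ (uncurry η) (Icc 0 1 ×ˢ Metric.ball c r) ∧
      ∀ t ∈ Icc (0 : ℝ) 1, ∀ x ∈ Metric.ball c r, ∀ u v,
        fderiv ℝ (η t) x u v - fderiv ℝ (η t) x v u = b t x u v := by
  have := FiniteDimensional.complete ℝ E
  have hseg : ∀ σ ∈ Icc (0 : ℝ) 1, ∀ x ∈ Metric.ball c r, c + σ • (x - c) ∈ Metric.ball c r :=
    fun σ hσ x hx => (convex_ball c r).add_smul_sub_mem
      (Metric.mem_ball_self (dist_nonneg.trans_lt hx)) hx hσ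
  set F : ℝ → ℝ × E → E →L[ℝ] ℝ := fun σ p => σ • b p.1 (c + σ • (p.2 - c)) (p.2 - c) with hFdef
  have hF : ContDiffOn ℝ ∞ (uncurry F) (Icc 0 1 ×ˢ (Icc (0 : ℝ) 1 ×ˢ Metric.ball c r)) := by
    have h1 : ContDiffOn ℝ ∞ (fun z : ℝ × ℝ × E => b z.2.1 (c + z.1 • (z.2.2 - c)))
        (Icc 0 1 ×ˢ (Icc (0 : ℝ) 1 ×ˢ Metric.ball c r)) := by
      refine hb.comp (f := fun z : ℝ × ℝ × E => (z.2.1, c + z.1 • (z.2.2 - c))) (by fun_prop) ?_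
      rintro ⟨σ, t, x⟩ ⟨h1, h2, h3⟩
      exact ⟨h2, hseg σ h1 x h3⟩
    exact contDiffOn_fst.smul (h1.clm_apply (by fun_prop))
  have hS : UniqueDiffOn ℝ (Icc (0 : ℝ) 1 ×ˢ Metric.ball c r) :=
    (uniqueDiffOn_Icc zero_lt_one).prod Metric.isOpen_ball.uniqueDiffOn
  obtain ⟨z, hz0, hz', hzs, m, hm0, hm', hmd⟩ := exists_smooth_antiderivative
    ((convex_Icc (0 : ℝ) 1).prod (convex_ball c r)) hS hF
  refine ⟨fun t x => z 1 (t, x), hzs 1 (by simp), fun t ht x hx u v => ?_⟩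
  have hq : (t, x) ∈ Icc (0 : ℝ) 1 ×ˢ Metric.ball c r := ⟨ht, hx⟩
  have hbd : ∀ y ∈ Metric.ball c r, HasFDerivAt (b t) (fderiv ℝ (b t) y) y := fun y hy =>
    (((hb.uncurry_left ht).differentiableOn (by simp)).differentiableAt
      (Metric.isOpen_ball.mem_nhds hy)).hasFDerivAt
  -- the derivative of the integrand in the direction of `x`
  have hFd : ∀ σ ∈ Icc (0 : ℝ) 1, ∀ u v, fderivWithin ℝ (F σ) (Icc 0 1 ×ˢ Metric.ball c r) (t, x)
      (0, u) v = σ * (σ * fderiv ℝ (b t) (c + σ • (x - c)) u (x - c) v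
        + b t (c + σ • (x - c)) u v) := by
    intro σ hσ u v
    have h1 := hasFDerivAt_slice Metric.isOpen_ball ht hx
      (((hF.uncurry_left hσ).differentiableOn (by simp) _ hq).hasFDerivWithinAt)
    have h2 : HasFDerivAt (fun y => c + σ • (y - c)) (σ • ContinuousLinearMap.id ℝ E) x :=
      (((hasFDerivAt_id x).sub_const c).const_smul σ).const_add c
    have h3 : HasFDerivAt (fun y => y - c) (ContinuousLinearMap.id ℝ E) x :=
      (hasFDerivAt_id x).sub_const c
    have h4 := ((HasFDerivAt.comp (g := b t)
      (f := fun y => c + σ • (y - c)) x (hbd _ (hseg σ hσ x hx)) h2).clm_apply h3).const_smul σ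
    have h5 := congrArg (fun L : E →L[ℝ] E →L[ℝ] ℝ => L u v) (h1.unique h4)
    simp only [ContinuousLinearMap.comp_apply, ContinuousLinearMap.inr_apply] at h5
    rw [h5]
    simp
    ring
  have hfd : fderiv ℝ (fun x => z 1 (t, x)) x
      = (m 1 (t, x)).comp (ContinuousLinearMap.inr ℝ ℝ E) :=
    (hasFDerivAt_slice Metric.isOpen_ball ht hx (hmd _ hq 1 (by simp))).fderiv
  rw [hfd]
  have key := eq_of_hasDerivWithinAt_eq
    (f := fun σ => m σ (t, x) (0, u) v - m σ (t, x) (0, v) u)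
    (g := fun σ => σ ^ 2 * b t (c + σ • (x - c)) u v)
    (f' := fun σ => fderivWithin ℝ (F σ) (Icc 0 1 ×ˢ Metric.ball c r) (t, x) (0, u) v
      - fderivWithin ℝ (F σ) (Icc 0 1 ×ˢ Metric.ball c r) (t, x) (0, v) u)
    (fun σ hσ => ?_) (fun σ hσ => ?_) (by simp [hm0 _ hq]) 1 (by simp)
  · simpa using key
  · have h1 := hm' _ hq σ hσ
    have h2 : ∀ u v, HasDerivWithinAt (fun σ => m σ (t, x) (0, u) v)
        (fderivWithin ℝ (F σ) (Icc 0 1 ×ˢ Metric.ball c r) (t, x) (0, u) v) (Icc 0 1) σ := by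
      intro u v
      simpa using (h1.clm_apply (hasDerivWithinAt_const σ _ ((0 : ℝ), u))).clm_apply
        (hasDerivWithinAt_const σ _ v)
    exact (h2 u v).sub (h2 v u)
  · have h1 : HasDerivAt (fun σ : ℝ => c + σ • (x - c)) (x - c) σ := by
      simpa using ((hasDerivAt_id σ).smul_const (x - c)).const_add c
    have h2 : HasDerivAt (fun σ : ℝ => b t (c + σ • (x - c)))
        (fderiv ℝ (b t) (c + σ • (x - c)) (x - c)) σ := by
      have := (HasFDerivAt.comp (g := b t) (f := fun σ : ℝ => c + σ • (x - c)) σ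
        (hbd _ (hseg σ hσ x hx)) h1.hasFDerivAt).hasDerivAt
      simpa [comp_def] using this
    have h3 := (h2.clm_apply (hasDerivAt_const σ u)).clm_apply (hasDerivAt_const σ v)
    have h4 := ((hasDerivAt_pow 2 σ).mul h3).hasDerivWithinAt (s := Icc (0 : ℝ) 1)
    refine h4.congr_deriv ?_
    rw [hFd σ hσ, hFd σ hσ]
    have h5 := hclosed t ht _ (hseg σ hσ x hx) (x - c) u v
    have h6 := halt t ht _ (hseg σ hσ x hx) v u
    simp only [map_zero, add_zero]
    rw [h6]
    push_cast
    linear_combination σ ^ 2 * h5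

/-- Mixed partial derivatives in a parameter `t ∈ [0,1]` and a point `x` commute. -/
theorem hasDerivWithinAt_fderiv_comm {Y : Type*} [NormedAddCommGroup Y] [NormedSpace ℝ Y]
    {B : Set E} (hB : IsOpen B) {f : ℝ → E → Y}
    (hf : ContDiffOn ℝ ∞ (uncurry f) (Icc 0 1 ×ˢ B)) {t : ℝ} {x : E}
    (ht : t ∈ Icc (0 : ℝ) 1) (hx : x ∈ B) :
    HasDerivWithinAt (fun s => fderiv ℝ (f s) x)
      (fderiv ℝ (fun y => derivWithin (f · y) (Icc 0 1) t) x) (Icc 0 1) t := by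
  set S := Icc (0 : ℝ) 1 ×ˢ B
  have hS : UniqueDiffOn ℝ S := (uniqueDiffOn_Icc zero_lt_one).prod hB.uniqueDiffOn
  set f' := fderivWithin ℝ (uncurry f) S
  have hf' : ContDiffOn ℝ ∞ f' S := hf.fderivWithin hS le_rfl
  have hd : ∀ q ∈ S, HasFDerivWithinAt (uncurry f) (f' q) S q := fun q hq =>
    (hf.differentiableOn (by simp) q hq).hasFDerivWithinAt
  have hx1 : ∀ s ∈ Icc (0 : ℝ) 1,
      fderiv ℝ (f s) x = (f' (s, x)).comp (ContinuousLinearMap.inr ℝ ℝ E) := fun s hs =>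
    (hasFDerivAt_slice hB hs hx (hd (s, x) ⟨hs, hx⟩)).fderiv
  have hinl : ∀ {Z : Type _} [NormedAddCommGroup Z] [NormedSpace ℝ Z] {g : ℝ × E → Z}
      {g' : ℝ × E →L[ℝ] Z} {y : E}, y ∈ B → HasFDerivWithinAt g g' S (t, y) →
      HasDerivWithinAt (fun s => g (s, y)) (g' (1, 0)) (Icc 0 1) t := by
    intro Z _ _ g g' y hy hg
    have h1 : HasDerivWithinAt (fun s : ℝ => (s, y)) ((1 : ℝ), (0 : E)) (Icc 0 1) t :=
      (hasDerivWithinAt_id t _).prodMk (hasDerivWithinAt_const t _ y)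
    exact hg.comp_hasDerivWithinAt (f := fun s : ℝ => (s, y)) t h1 fun s hs => ⟨hs, hy⟩
  have hx2 : ∀ y ∈ B, derivWithin (f · y) (Icc 0 1) t = f' (t, y) (1, 0) := fun y hy =>
    (hinl hy (hd (t, y) ⟨ht, hy⟩)).derivWithin (uniqueDiffOn_Icc zero_lt_one t ht)
  have hdd : HasFDerivWithinAt f' (fderivWithin ℝ f' S (t, x)) S (t, x) :=
    (hf'.differentiableOn (by simp) _ ⟨ht, hx⟩).hasFDerivWithinAt
  have hsymm : IsSymmSndFDerivWithinAt ℝ (uncurry f) S (t, x) := by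
    refine (hf (t, x) ⟨ht, hx⟩).isSymmSndFDerivWithinAt
      (by simpa using ENat.LEInfty.out) hS ?_ ⟨ht, hx⟩
    rw [interior_prod_eq, closure_prod_eq, interior_Icc, hB.interior_eq,
      closure_Ioo zero_ne_one]
    exact ⟨ht, subset_closure hx⟩
  have hR : fderiv ℝ (fun y => derivWithin (f · y) (Icc 0 1) t) x
      = ((fderivWithin ℝ f' S (t, x)) (1, 0)).comp (ContinuousLinearMap.inr ℝ ℝ E) := by
    have h1 : (fun y => derivWithin (f · y) (Icc 0 1) t) =ᶠ[𝓝 x] fun y => f' (t, y) (1, 0) := by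
      filter_upwards [hB.mem_nhds hx] with y hy using hx2 y hy
    rw [h1.fderiv_eq]
    have h2 := (hasFDerivAt_slice hB ht hx hdd).clm_apply
      (hasFDerivAt_const (((1 : ℝ), (0 : E)) : ℝ × E) x)
    rw [h2.fderiv]
    ext v
    have := hsymm (0, v) (1, 0)
    simpa using this
  rw [hR]
  have h3 := (((ContinuousLinearMap.compL ℝ E (ℝ × E) Y).flip
    (ContinuousLinearMap.inr ℝ ℝ E)).hasFDerivAt.comp_hasDerivWithinAt t (hinl hx hdd))
  exact h3.congr hx1 (hx1 t ht)

end Poincare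

/-! ### Linear equations depending on a parameter -/

section LinearEquations

/-- If a system of linear equations, with right hand sides depending on a parameter, is solvable
for each parameter, then it can be solved by expressions in the right hand sides whose
coefficients do not depend on the parameter. -/
theorem exists_solution_linear_in_rhs {ι R T : Type*} (l : R → ι →₀ ℝ) (c : T → R → ℝ) (P : Set T)
    (h : ∀ t ∈ P, ∃ g : ι → ℝ, ∀ r, Finsupp.linearCombination ℝ g (l r) = c t r) :
    ∃ S : ι → R →₀ ℝ, ∀ t ∈ P, ∀ r,
      Finsupp.linearCombination ℝ (fun i => Finsupp.linearCombination ℝ (c t) (S i)) (l r)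
        = c t r := by
  set L : (R →₀ ℝ) →ₗ[ℝ] (ι →₀ ℝ) := Finsupp.linearCombination ℝ l
  have : Module.Free ℝ L.range := Module.Free.of_divisionRing ℝ L.range
  obtain ⟨ρ, hρ⟩ := L.rangeRestrict.exists_rightInverse_of_surjective L.range_rangeRestrict
  obtain ⟨S, hS⟩ := ρ.exists_extend
  -- `S` is a generalized inverse of `L`
  have hLSL : ∀ z, L (S (L z)) = L z := by
    intro z
    have h1 : S (L z) = ρ (L.rangeRestrict z) := by
      rw [← hS]; rfl
    rw [h1]
    exact congrArg Subtype.val (LinearMap.congr_fun hρ (L.rangeRestrict z))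
  refine ⟨fun i => S (Finsupp.single i 1), fun t ht r => ?_⟩
  obtain ⟨g, hg⟩ := h t ht
  set C := Finsupp.linearCombination ℝ (c t)
  set G := Finsupp.linearCombination ℝ g
  have hGL : G ∘ₗ L = C := by
    ext r
    simp [G, L, C, hg]
  have h2 : Finsupp.linearCombination ℝ (fun i => C (S (Finsupp.single i 1))) = C ∘ₗ S := by
    ext i
    simp
  rw [h2]
  have h3 : l r = L (Finsupp.single r 1) := by simp [L]
  calc C (S (l r)) = G (L (S (L (Finsupp.single r 1)))) := by rw [h3, ← hGL]; rfl
    _ = C (Finsupp.single r 1) := by rw [hLSL, ← hGL]; rfl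
    _ = c t r := by simp [C]

end LinearEquations

/-! ### Covers of a compact orbifold by finitely many balls in charts -/

section BallCover

universe u

variable {n : ℕ} {N : Type u} [TopologicalSpace N]

/-- Finitely many balls contained in the domains of charts, such that the images of the concentric
balls of a quarter of the radius cover the orbifold. -/
structure BallCover (X : OrbifoldStructure n N) where
  /-- the index set -/
  K : Type u
  [fintype : Fintype K]
  /-- the charts -/
  chart : K → X.charts
  /-- the centers of the balls -/
  center : K → OrbModel n
  /-- the radii of the balls -/
  radius : K → ℝ
  radius_pos : ∀ k, 0 < radius k
  ball_subset : ∀ k, Metric.ball (center k) (radius k) ⊆ (chart k).1.dom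
  cover : ∀ p : N, ∃ k, ∃ x ∈ Metric.ball (center k) (radius k / 4), (chart k).1.proj x = p

attribute [instance] BallCover.fintype

theorem nonempty_ballCover [CompactSpace N] (X : OrbifoldStructure n N) :
    Nonempty (BallCover X) := by
  have hex : ∀ p : N, ∃ (α : X.charts) (x : OrbModel n) (r : ℝ), 0 < r ∧
      Metric.ball x r ⊆ α.1.dom ∧ α.1.proj x = p := by
    intro p
    obtain ⟨α, hα, x, hx, hxp⟩ := X.isAtlas.cover p
    obtain ⟨r, hr, hsub⟩ := Metric.isOpen_iff.1 α.isOpen_dom x hx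
    exact ⟨⟨α, hα⟩, x, r, hr, hsub, hxp⟩
  choose α x r hr hsub hxp using hex
  obtain ⟨s, hs⟩ := isCompact_univ.elim_finite_subcover
    (fun p => (α p).1.proj '' Metric.ball (x p) (r p / 4))
    (fun p => (α p).1.isOpen_image_proj _ Metric.isOpen_ball
      ((Metric.ball_subset_ball (by linarith [hr p])).trans (hsub p)))
    (fun p _ => mem_iUnion.2 ⟨p, x p, Metric.mem_ball_self (by linarith [hr p]), hxp p⟩)
  refine ⟨⟨s, fun p => α p, fun p => x p, fun p => r p, fun p => hr p, fun p => hsub p,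
    fun p => ?_⟩⟩
  obtain ⟨q, hq, y, hy, hyp⟩ := mem_iUnion₂.1 (hs (mem_univ p))
  exact ⟨⟨q, hq⟩, y, hy, hyp⟩

namespace BallCover

variable {X : OrbifoldStructure n N} (C : BallCover X)

/-- The ball with index `k`. -/
def ball (k : C.K) : Set (OrbModel n) := Metric.ball (C.center k) (C.radius k)

theorem isOpen_ball (k : C.K) : IsOpen (C.ball k) := Metric.isOpen_ball

/-- The quotient map of the chart with index `k`. -/
def proj (k : C.K) : OrbModel n → N := (C.chart k).1.proj

/-- `φ` is a smooth lift of the identity of the orbifold to `W ⊆ C.ball i` and `C.ball k`. -/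
structure IsTransition (i k : C.K) (W : Set (OrbModel n)) (φ : OrbModel n → OrbModel n) :
    Prop where
  isOpen : IsOpen W
  subset : W ⊆ C.ball i
  mapsTo : MapsTo φ W (C.ball k)
  isSmoothLift : IsSmoothLift id (C.chart i).1 (C.chart k).1 W φ

variable {C}

theorem IsTransition.mono {i k : C.K} {W W' : Set (OrbModel n)} {φ : OrbModel n → OrbModel n}
    (h : C.IsTransition i k W φ) (hW' : IsOpen W') (hsub : W' ⊆ W) : C.IsTransition i k W' φ :=
  ⟨hW', hsub.trans h.subset, h.mapsTo.mono_left hsub, h.isSmoothLift.mono hsub⟩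

theorem IsTransition.subset_dom {i k : C.K} {W : Set (OrbModel n)} {φ : OrbModel n → OrbModel n}
    (h : C.IsTransition i k W φ) : W ⊆ (C.chart i).1.dom := h.subset.trans (C.ball_subset i)

theorem IsTransition.proj_eq {i k : C.K} {W : Set (OrbModel n)} {φ : OrbModel n → OrbModel n}
    (h : C.IsTransition i k W φ) {x : OrbModel n} (hx : x ∈ W) : C.proj k (φ x) = C.proj i x :=
  h.isSmoothLift.covers x hx

/-- Points with the same image in the orbifold are related by transitions defined on balls. -/
theorem exists_isTransition {i k : C.K} {x y : OrbModel n} (hx : x ∈ C.ball i) (hy : y ∈ C.ball k)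
    (h : C.proj i x = C.proj k y) :
    ∃ ε > 0, ∃ φ, C.IsTransition i k (Metric.ball x ε) φ ∧ φ x = y := by
  obtain ⟨W, τ, hWo, hxW, hWd, hτ, rfl, -⟩ := hasTransition X (C.chart i) (C.chart k)
    (C.ball_subset i hx) (C.ball_subset k hy) h
  obtain ⟨ε, hε, hsub⟩ := Metric.isOpen_iff.1
    ((hτ.contDiffOn.continuousOn.isOpen_inter_preimage hWo (C.isOpen_ball k)).inter
      (C.isOpen_ball i)) x ⟨⟨hxW, hy⟩, hx⟩
  exact ⟨ε, hε, τ, ⟨Metric.isOpen_ball, fun z hz => (hsub hz).2, fun z hz => (hsub hz).1.2,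
    hτ.mono fun z hz => (hsub hz).1.1⟩, rfl⟩

theorem IsTransition.contDiffOn_pullback {i k : C.K} {W : Set (OrbModel n)}
    {φ : OrbModel n → OrbModel n} (h : C.IsTransition i k W φ)
    {η : ℝ → OrbModel n → OrbModel n →L[ℝ] ℝ}
    (hη : ContDiffOn ℝ ∞ (uncurry η) (Icc 0 1 ×ˢ C.ball k)) :
    ContDiffOn ℝ ∞ (uncurry fun t x => (η t (φ x)).comp (fderiv ℝ φ x)) (Icc 0 1 ×ˢ W) := by
  have hφ : ContDiffOn ℝ ∞ (fun z : ℝ × OrbModel n => φ z.2) (Icc 0 1 ×ˢ W) :=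
    h.isSmoothLift.contDiffOn.comp contDiffOn_snd fun z hz => hz.2
  have hdφ : ContDiffOn ℝ ∞ (fun z : ℝ × OrbModel n => fderiv ℝ φ z.2) (Icc 0 1 ×ˢ W) :=
    (h.isSmoothLift.contDiffOn.fderiv_of_isOpen h.isOpen le_rfl).comp contDiffOn_snd
      fun z hz => hz.2
  exact (hη.comp (contDiffOn_fst.prodMk hφ) fun z hz => ⟨hz.1, h.mapsTo hz.2⟩).clm_comp hdφ

/-- Suppose that the differences of the `1`-forms `η i t` on overlaps are, for each `t`, the
differentials of differences of functions. Then these functions can be chosen so that the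
differences on overlaps are smooth in `(t, x)`. They are found by solving a system of linear
equations for the values of the functions at all points, see `exists_solution_linear_in_rhs`. -/
theorem exists_smooth_differences (C : BallCover X)
    (η : C.K → ℝ → OrbModel n → OrbModel n →L[ℝ] ℝ)
    (hη : ∀ k, ContDiffOn ℝ ∞ (uncurry (η k)) (Icc 0 1 ×ˢ C.ball k))
    (hpot : ∀ t ∈ Icc (0 : ℝ) 1, ∃ g : C.K → OrbModel n → ℝ, ∀ i k W φ, C.IsTransition i k W φ →
      ∀ x ∈ W, HasFDerivAt (fun x => g i x - g k (φ x))
        (η i t x - (η k t (φ x)).comp (fderiv ℝ φ x)) x) :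
    ∃ g : C.K → ℝ → OrbModel n → ℝ, ∀ i k a ε φ, C.IsTransition i k (Metric.ball a ε) φ →
      ContDiffOn ℝ ∞ (uncurry fun t x => g i t x - g k t (φ x)) (Icc 0 1 ×ˢ Metric.ball a ε) ∧
      ∀ t ∈ Icc (0 : ℝ) 1, ∀ x ∈ Metric.ball a ε, HasFDerivAt (fun x => g i t x - g k t (φ x))
        (η i t x - (η k t (φ x)).comp (fderiv ℝ φ x)) x := by
  -- transitions on balls
  let R₀ := {r : (C.K × C.K) × (OrbModel n × ℝ) × (OrbModel n → OrbModel n) //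
    C.IsTransition r.1.1 r.1.2 (Metric.ball r.2.1.1 r.2.1.2) r.2.2}
  let θ : R₀ → ℝ → OrbModel n → OrbModel n →L[ℝ] ℝ := fun r t x =>
    η r.1.1.1 t x - (η r.1.1.2 t (r.1.2.2 x)).comp (fderiv ℝ r.1.2.2 x)
  have hθ : ∀ r : R₀, ContDiffOn ℝ ∞ (uncurry (θ r))
      (Icc 0 1 ×ˢ Metric.ball r.1.2.1.1 r.1.2.1.2) := fun r =>
    ((hη r.1.1.1).mono (prod_mono_right r.2.subset)).sub (r.2.contDiffOn_pullback (hη r.1.1.2))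
  choose z hzs hz using fun r => exists_smooth_radial_integral (hθ r)
  let R := {r : R₀ × OrbModel n // r.2 ∈ Metric.ball r.1.1.2.1.1 r.1.1.2.1.2}
  let l : R → (C.K × OrbModel n) →₀ ℝ := fun r =>
    (Finsupp.single (r.1.1.1.1.1, r.1.2) 1
      - Finsupp.single (r.1.1.1.1.2, r.1.1.1.2.2 r.1.2) 1)
    - (Finsupp.single (r.1.1.1.1.1, r.1.1.1.2.1.1) 1
      - Finsupp.single (r.1.1.1.1.2, r.1.1.1.2.2 r.1.1.1.2.1.1) 1)
  have hl : ∀ (g : C.K × OrbModel n → ℝ) (r : R), Finsupp.linearCombination ℝ g (l r)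
      = (g (r.1.1.1.1.1, r.1.2) - g (r.1.1.1.1.2, r.1.1.1.2.2 r.1.2))
        - (g (r.1.1.1.1.1, r.1.1.1.2.1.1) - g (r.1.1.1.1.2, r.1.1.1.2.2 r.1.1.1.2.1.1)) := by
    intro g r
    simp [l]
  obtain ⟨S, hS⟩ := exists_solution_linear_in_rhs l (fun (t : ℝ) (r : R) => z r.1.1 t r.1.2)
    (Icc 0 1) (fun t ht => by
      obtain ⟨g, hg⟩ := hpot t ht
      refine ⟨fun p => g p.1 p.2, fun r => ?_⟩
      rw [hl]
      exact (hz r.1.1 t ht _ (hg _ _ _ _ r.1.1.2) _ r.2).symm)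
  refine ⟨fun k t x => Finsupp.linearCombination ℝ (fun r : R => z r.1.1 t r.1.2) (S (k, x)),
    fun i k a ε φ hφ => ?_⟩
  let r₀ : R₀ := ⟨((i, k), (a, ε), φ), hφ⟩
  set g : C.K → ℝ → OrbModel n → ℝ := fun k t x =>
    Finsupp.linearCombination ℝ (fun r : R => z r.1.1 t r.1.2) (S (k, x)) with hg
  have hgs : ∀ k x, ContDiffOn ℝ ∞ (g k · x) (Icc 0 1) := by
    intro k x
    simp only [hg, Finsupp.linearCombination_apply, Finsupp.sum]
    refine ContDiffOn.sum fun r _ => ContDiffOn.const_smul _ ?_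
    exact (hzs r.1.1).comp (f := fun t => (t, r.1.2)) (by fun_prop) fun t ht => ⟨ht, r.2⟩
  have hrel : ∀ t ∈ Icc (0 : ℝ) 1, ∀ x ∈ Metric.ball a ε,
      g i t x - g k t (φ x) = z r₀ t x + (g i t a - g k t (φ a)) := by
    intro t ht x hx
    have h1 := hS t ht ⟨(r₀, x), hx⟩
    rw [hl] at h1
    exact sub_eq_iff_eq_add.1 h1
  constructor
  · refine ContDiffOn.congr (f := fun p : ℝ × OrbModel n => z r₀ p.1 p.2 +
      (g i p.1 a - g k p.1 (φ a))) ((hzs r₀).add ?_) fun p hp => hrel p.1 hp.1 p.2 hp.2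
    exact ((hgs i a).sub (hgs k (φ a))).comp contDiffOn_fst fun p hp => hp.1
  · intro t ht x hx
    obtain ⟨g', hg'⟩ := hpot t ht
    have h1 := hg' i k _ φ hφ
    refine ((h1 x hx).add_const
      ((g i t a - g k t (φ a)) - (g' i a - g' k (φ a)))).congr_of_eventuallyEq ?_
    filter_upwards [Metric.isOpen_ball.mem_nhds hx] with y hy
    rw [hrel t ht y hy, hz r₀ t ht _ h1 y hy]
    ring

/-! ### Averaging over fibres -/

noncomputable instance (α : OrbifoldChart n N) : Fintype α.Γ :=
  @Fintype.ofFinite _ α.finite_Γ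

open Classical in
/-- The sum of the values of `Θ` over the orbit in the chart `k` lying over a point of the
orbifold, counted with multiplicity; it is `0` over points outside the chart. -/
noncomputable def fiberSum (C : BallCover X) (k : C.K) (Θ : OrbModel n → ℝ) (p : N) : ℝ :=
  if h : p ∈ (C.chart k).1.U then ∑ γ : (C.chart k).1.Γ, Θ (γ.1 h.choose) else 0

theorem fiberSum_eq (k : C.K) (Θ : OrbModel n → ℝ) {z : OrbModel n}
    (hz : z ∈ (C.chart k).1.dom) :
    C.fiberSum k Θ (C.proj k z) = ∑ γ : (C.chart k).1.Γ, Θ (γ.1 z) := by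
  have h : C.proj k z ∈ (C.chart k).1.U := mem_image_of_mem _ hz
  rw [fiberSum, dif_pos h]
  obtain ⟨h1, h2⟩ := h.choose_spec
  obtain ⟨g, hg, hgz⟩ := ((C.chart k).1.proj_eq_iff z hz _ h1).1 h2.symm
  rw [← Equiv.sum_comp (Equiv.mulRight (⟨g, hg⟩ : (C.chart k).1.Γ)) fun γ => Θ (γ.1 z)]
  refine Finset.sum_congr rfl fun γ _ => ?_
  rw [← hgz]
  rfl

theorem fiberSum_of_notMem (k : C.K) (Θ : OrbModel n → ℝ) {p : N}
    (hp : p ∉ (C.chart k).1.U) : C.fiberSum k Θ p = 0 := dif_neg hp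

/-- Fibre sums of functions that are smooth along transitions, and vanish away from the ball of
half the radius, are smooth. -/
theorem contDiffWithinAt_fiberSum [T2Space N] {i k : C.K} {Θ : ℝ → OrbModel n → OrbModel n → ℝ}
    (hzero : ∀ t x z, z ∉ Metric.closedBall (C.center k) (C.radius k / 2) → Θ t x z = 0)
    (hsmooth : ∀ a ε φ, C.IsTransition i k (Metric.ball a ε) φ →
      ContDiffOn ℝ ∞ (uncurry fun t x => Θ t x (φ x)) (Icc 0 1 ×ˢ Metric.ball a ε))
    {t₀ : ℝ} (ht₀ : t₀ ∈ Icc (0 : ℝ) 1) {x₀ : OrbModel n} (hx₀ : x₀ ∈ C.ball i) :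
    ContDiffWithinAt ℝ ∞ (uncurry fun t x => C.fiberSum k (Θ t x) (C.proj i x))
      (Icc 0 1 ×ˢ C.ball i) (t₀, x₀) := by
  have hmem : (t₀, x₀) ∈ Icc (0 : ℝ) 1 ×ˢ C.ball i := ⟨ht₀, hx₀⟩
  have hsubball : Metric.closedBall (C.center k) (C.radius k / 2) ⊆ C.ball k :=
    Metric.closedBall_subset_ball (by linarith [C.radius_pos k])
  by_cases hU : C.proj i x₀ ∈ (C.chart k).1.U
  · obtain ⟨z₀, hz₀, hz₀p⟩ := hU
    obtain ⟨W, τ, hWo, hxW, hWd, hτ, hτx, -⟩ := hasTransition X (C.chart i) (C.chart k)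
      (C.ball_subset i hx₀) hz₀ hz₀p.symm
    have hsum : ContDiffWithinAt ℝ ∞ (fun p : ℝ × OrbModel n =>
        ∑ γ : (C.chart k).1.Γ, Θ p.1 p.2 (γ.1 (τ p.2))) (Icc 0 1 ×ˢ C.ball i) (t₀, x₀) := by
      refine ContDiffWithinAt.sum fun γ _ => ?_
      have hγ : IsSmoothLift id (C.chart i).1 (C.chart k).1 W (γ.1 ∘ τ) := by
        refine ⟨fun z hz => (C.chart k).1.smul_mem_dom _ γ.2 _ (hτ.mapsTo hz),
          γ.1.contDiff.comp_contDiffOn hτ.contDiffOn, fun z hz => ?_⟩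
        rw [← hτ.covers z hz]
        exact (((C.chart k).1.proj_eq_iff _ (hτ.mapsTo hz) _
          ((C.chart k).1.smul_mem_dom _ γ.2 _ (hτ.mapsTo hz))).2 ⟨γ.1, γ.2, rfl⟩).symm
      by_cases hb : γ.1 (τ x₀) ∈ C.ball k
      · obtain ⟨ε, hε, hsub⟩ := Metric.isOpen_iff.1
          ((hγ.contDiffOn.continuousOn.isOpen_inter_preimage hWo (C.isOpen_ball k)).inter
            (C.isOpen_ball i)) x₀ ⟨⟨hxW, hb⟩, hx₀⟩
        have h1 := hsmooth x₀ ε (γ.1 ∘ τ) ⟨Metric.isOpen_ball, fun z hz => (hsub hz).2,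
          fun z hz => (hsub hz).1.2, hγ.mono fun z hz => (hsub hz).1.1⟩
        refine (h1 (t₀, x₀) ⟨ht₀, Metric.mem_ball_self hε⟩).mono_of_mem_nhdsWithin ?_
        rw [nhdsWithin_prod_eq]
        exact Filter.prod_mem_prod self_mem_nhdsWithin
          (mem_nhdsWithin_of_mem_nhds (Metric.ball_mem_nhds _ hε))
      · have h1 : ∀ᶠ x in 𝓝 x₀, γ.1 (τ x) ∉ Metric.closedBall (C.center k) (C.radius k / 2) := by
          have hc : ContinuousAt (γ.1 ∘ τ) x₀ := (hγ.differentiableAt hWo hxW).continuousAt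
          exact hc.eventually (Metric.isClosed_closedBall.isOpen_compl.mem_nhds
            fun h => hb (hsubball h))
        have h2 : ∀ᶠ p in 𝓝[Icc (0 : ℝ) 1 ×ˢ C.ball i] (t₀, x₀),
            Θ p.1 p.2 (γ.1 (τ p.2)) = 0 := by
          refine Filter.Eventually.filter_mono nhdsWithin_le_nhds ?_
          filter_upwards [continuous_snd.continuousAt.eventually h1] with p hp
          exact hzero _ _ _ hp
        exact (contDiffWithinAt_const (c := (0 : ℝ))).congr_of_eventuallyEq h2
          (h2.self_of_nhdsWithin hmem)
    have heq : ∀ᶠ p in 𝓝[Icc (0 : ℝ) 1 ×ˢ C.ball i] (t₀, x₀),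
        C.fiberSum k (Θ p.1 p.2) (C.proj i p.2)
          = ∑ γ : (C.chart k).1.Γ, Θ p.1 p.2 (γ.1 (τ p.2)) := by
      refine Filter.Eventually.filter_mono nhdsWithin_le_nhds ?_
      filter_upwards [continuous_snd.continuousAt.eventually (hWo.mem_nhds hxW)] with p hp
      rw [← fiberSum_eq k _ (hτ.mapsTo hp)]
      exact congrArg _ (hτ.covers _ hp).symm
    exact hsum.congr_of_eventuallyEq heq (heq.self_of_nhdsWithin hmem)
  · -- the support of the function is compact, hence closed in the orbifold
    have hcl : IsClosed (C.proj k '' Metric.closedBall (C.center k) (C.radius k / 2)) :=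
      ((isCompact_closedBall _ _).image_of_continuousOn
        ((C.chart k).1.continuousOn_proj.mono (hsubball.trans (C.ball_subset k)))).isClosed
    have hc : ContinuousAt (C.proj i) x₀ := (C.chart i).1.continuousOn_proj.continuousAt
      ((C.chart i).1.isOpen_dom.mem_nhds (C.ball_subset i hx₀))
    have h1 : ∀ᶠ x in 𝓝 x₀, C.proj i x ∉
        C.proj k '' Metric.closedBall (C.center k) (C.radius k / 2) := by
      refine hc.eventually (hcl.isOpen_compl.mem_nhds ?_)
      rintro ⟨z, hz, h⟩
      exact hU ⟨z, C.ball_subset k (hsubball hz), h⟩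
    have h2 : ∀ᶠ p in 𝓝[Icc (0 : ℝ) 1 ×ˢ C.ball i] (t₀, x₀),
        C.fiberSum k (Θ p.1 p.2) (C.proj i p.2) = 0 := by
      refine Filter.Eventually.filter_mono nhdsWithin_le_nhds ?_
      filter_upwards [continuous_snd.continuousAt.eventually h1] with p hp
      by_cases hpU : C.proj i p.2 ∈ (C.chart k).1.U
      · obtain ⟨z, hz, hzp⟩ := hpU
        rw [← hzp]
        show C.fiberSum k (Θ p.1 p.2) (C.proj k z) = 0
        rw [fiberSum_eq k _ hz]
        refine Finset.sum_eq_zero fun γ _ => hzero _ _ _ fun hγ => hp ⟨_, hγ, ?_⟩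
        rw [← hzp]
        exact (((C.chart k).1.proj_eq_iff _ hz _
          ((C.chart k).1.smul_mem_dom _ γ.2 _ hz)).2 ⟨γ.1, γ.2, rfl⟩).symm
      · exact fiberSum_of_notMem k _ hpU
    exact (contDiffWithinAt_const (c := (0 : ℝ))).congr_of_eventuallyEq h2
      (h2.self_of_nhdsWithin hmem)

/-- Functions with smooth differences on overlaps have the same differences as smooth functions:
subtract an average of the functions with respect to a smooth partition of unity. -/
theorem exists_smooth_of_smooth_differences [T2Space N] (C : BallCover X)
    {g : C.K → ℝ → OrbModel n → ℝ}
    (hg : ∀ i k a ε φ, C.IsTransition i k (Metric.ball a ε) φ →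
      ContDiffOn ℝ ∞ (uncurry fun t x => g i t x - g k t (φ x)) (Icc 0 1 ×ˢ Metric.ball a ε)) :
    ∃ h : C.K → ℝ → OrbModel n → ℝ,
      (∀ k, ContDiffOn ℝ ∞ (uncurry (h k)) (Icc 0 1 ×ˢ C.ball k)) ∧
      ∀ i k, ∀ x ∈ C.ball i, ∀ y ∈ C.ball k, C.proj i x = C.proj k y → ∀ t,
        h i t x - h k t y = g i t x - g k t y := by
  let b : ∀ k : C.K, ContDiffBump (C.center k) := fun k =>
    ⟨C.radius k / 4, C.radius k / 2, by linarith [C.radius_pos k], by linarith [C.radius_pos k]⟩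
  have hbzero : ∀ k z, z ∉ Metric.closedBall (C.center k) (C.radius k / 2) → b k z = 0 :=
    fun k z hz => (b k).zero_of_le_dist (by
      rw [Metric.mem_closedBall, not_le] at hz; exact hz.le)
  let A : N → ℝ := fun p => ∑ k, C.fiberSum k (b k) p
  have hApos : ∀ i, ∀ x ∈ C.ball i, 0 < A (C.proj i x) := by
    intro i x _
    have hnn : ∀ k, 0 ≤ C.fiberSum k (b k) (C.proj i x) := by
      intro k
      unfold fiberSum
      split_ifs
      · exact Finset.sum_nonneg fun γ _ => (b k).nonneg
      · exact le_rfl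
    obtain ⟨k, z, hz, hzp⟩ := C.cover (C.proj i x)
    refine lt_of_lt_of_le ?_ (Finset.single_le_sum (fun k _ => hnn k) (Finset.mem_univ k))
    have hzd : z ∈ (C.chart k).1.dom :=
      C.ball_subset k (Metric.ball_subset_ball (by linarith [C.radius_pos k]) hz)
    rw [← hzp]
    show 0 < C.fiberSum k (b k) (C.proj k z)
    rw [fiberSum_eq k _ hzd]
    refine lt_of_lt_of_le zero_lt_one ?_
    have h1 : b k ((1 : (C.chart k).1.Γ).1 z) = 1 :=
      (b k).one_of_mem_closedBall (Metric.ball_subset_closedBall hz)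
    rw [← h1]
    exact Finset.single_le_sum (f := fun γ : (C.chart k).1.Γ => b k (γ.1 z))
      (fun γ _ => (b k).nonneg) (Finset.mem_univ 1)
  -- `G / A` is the average of the functions `g k`; it need not be smooth, but its difference from
  -- each `g i` is an average of the smooth differences `g i - g k`
  let G : ℝ → N → ℝ := fun t p => ∑ k, C.fiberSum k (fun z => b k z * g k t z) p
  refine ⟨fun i t x => g i t x - G t (C.proj i x) / A (C.proj i x), fun i => ?_, ?_⟩
  · have hform : ∀ t, ∀ x ∈ C.ball i, g i t x - G t (C.proj i x) / A (C.proj i x)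
        = (∑ k, C.fiberSum k (fun z => b k z * (g i t x - g k t z)) (C.proj i x))
          / A (C.proj i x) := by
      intro t x hx
      have h0 := (hApos i x hx).ne'
      rw [eq_div_iff h0, sub_mul, div_mul_cancel₀ _ h0]
      simp only [A, G, Finset.mul_sum, ← Finset.sum_sub_distrib]
      refine Finset.sum_congr rfl fun k _ => ?_
      unfold fiberSum
      split_ifs
      · simp only [Finset.mul_sum, ← Finset.sum_sub_distrib]
        exact Finset.sum_congr rfl fun γ _ => by ring
      · simp
    refine ContDiffOn.congr (f := fun p : ℝ × OrbModel n =>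
      (∑ k, C.fiberSum k (fun z => b k z * (g i p.1 p.2 - g k p.1 z)) (C.proj i p.2))
          / A (C.proj i p.2)) ?_ fun p hp => hform p.1 p.2 hp.2
    rintro ⟨t, x⟩ ⟨ht, hx⟩
    have hb : ∀ k a ε φ, C.IsTransition i k (Metric.ball a ε) φ →
        ContDiffOn ℝ ∞ (fun p : ℝ × OrbModel n => b k (φ p.2)) (Icc 0 1 ×ˢ Metric.ball a ε) :=
      fun k a ε φ hφ => (b k).contDiff.comp_contDiffOn
        (hφ.isSmoothLift.contDiffOn.comp contDiffOn_snd fun z hz => hz.2)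
    refine ContDiffWithinAt.div ?_ ?_ (hApos i x hx).ne'
    · refine ContDiffWithinAt.sum fun k _ => ?_
      refine contDiffWithinAt_fiberSum (Θ := fun t x z => b k z * (g i t x - g k t z))
        (fun t x z hz => by rw [hbzero k z hz, zero_mul])
        (fun a ε φ hφ => (hb k a ε φ hφ).mul (hg i k a ε φ hφ)) ht hx
    · refine ContDiffWithinAt.sum fun k _ => ?_
      exact contDiffWithinAt_fiberSum (Θ := fun _ _ z => b k z)
        (fun t x z hz => hbzero k z hz) (fun a ε φ hφ => hb k a ε φ hφ) ht hx
  · intro i k x hx y hy hxy t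
    simp only [hxy]
    ring

end BallCover

end BallCover

/-! ### Forms of degree one and two as linear and bilinear forms -/

section Bilinear

variable {E : Type} [NormedAddCommGroup E] [NormedSpace ℝ E]

/-- The linear form underlying an alternating form in one variable. -/
noncomputable def linearOfAlternating : (E [⋀^Fin 1]→L[ℝ] ℝ) →L[ℝ] E →L[ℝ] ℝ :=
  ((ContinuousAlternatingMap.ofSubsingletonLIE (𝕜 := ℝ) (E := E) (F := ℝ)
      (0 : Fin 1)).symm.toContinuousLinearEquiv :
    (E [⋀^Fin 1]→L[ℝ] ℝ) →L[ℝ] E →L[ℝ] ℝ)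

theorem linearOfAlternating_apply (ζ : E [⋀^Fin 1]→L[ℝ] ℝ) (u : E) :
    linearOfAlternating ζ u = ζ ![u] := by
  rw [show (![u] : Fin 1 → E) = fun _ => u from funext fun i => by fin_cases i; rfl]
  rfl

/-- The bilinear form underlying an alternating form in two variables. -/
noncomputable def bilinearOfAlternating : (E [⋀^Fin 2]→L[ℝ] ℝ) →L[ℝ] E →L[ℝ] E →L[ℝ] ℝ :=
  (ContinuousLinearMap.compL ℝ E (E [⋀^Fin 1]→L[ℝ] ℝ) (E →L[ℝ] ℝ) linearOfAlternating).comp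
    (ContinuousAlternatingMap.curryLeftLI (𝕜 := ℝ) (E := E) (F := ℝ)
      (n := 1)).toContinuousLinearMap

theorem bilinearOfAlternating_apply (ζ : E [⋀^Fin 2]→L[ℝ] ℝ) (u v : E) :
    bilinearOfAlternating ζ u v = ζ ![u, v] :=
  linearOfAlternating_apply (ζ.curryLeft u) v

theorem contDiff_bilinearOfAlternating :
    ContDiff ℝ ∞ (bilinearOfAlternating : (E [⋀^Fin 2]→L[ℝ] ℝ) → E →L[ℝ] E →L[ℝ] ℝ) := by
  apply ContinuousLinearMap.contDiff

theorem bilinearOfAlternating_swap (ζ : E [⋀^Fin 2]→L[ℝ] ℝ) (u v : E) :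
    bilinearOfAlternating ζ u v = - bilinearOfAlternating ζ v u := by
  rw [bilinearOfAlternating_apply, bilinearOfAlternating_apply]
  refine Eq.trans ?_ (ζ.toAlternatingMap.map_swap ![v, u] (i := 0) (j := 1) (by decide))
  refine congrArg ζ (funext fun i => ?_)
  fin_cases i <;> rfl

theorem ext_of_bilinearOfAlternating {ζ ζ' : E [⋀^Fin 2]→L[ℝ] ℝ}
    (h : ∀ u v, bilinearOfAlternating ζ u v = bilinearOfAlternating ζ' u v) : ζ = ζ' := by
  ext v
  have := h (v 0) (v 1)
  rw [bilinearOfAlternating_apply, bilinearOfAlternating_apply] at this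
  convert this using 2 <;> (funext i; fin_cases i <;> rfl)

theorem fderiv_apply_apply {b : E → E →L[ℝ] E →L[ℝ] ℝ} {x : E} (h : DifferentiableAt ℝ b x)
    (u v w : E) : fderiv ℝ b x u v w = fderiv ℝ (fun y => b y v w) x u := by
  have h1 := (h.hasFDerivAt.clm_apply (hasFDerivAt_const v x)).clm_apply (hasFDerivAt_const w x)
  rw [h1.fderiv]
  simp

theorem fderiv_sub_apply_apply {b b' : E → E →L[ℝ] E →L[ℝ] ℝ} {x : E} (h : ContDiffAt ℝ ∞ b x)
    (h' : ContDiffAt ℝ ∞ b' x) (u v w : E) :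
    fderiv ℝ (fun y => b y - b' y) x u v w = fderiv ℝ b x u v w - fderiv ℝ b' x u v w := by
  have h1 : ∀ {b : E → E →L[ℝ] E →L[ℝ] ℝ}, ContDiffAt ℝ ∞ b x →
      DifferentiableAt ℝ (fun y => b y v w) x := fun h =>
    ((h.clm_apply contDiffAt_const).clm_apply contDiffAt_const).differentiableAt (by simp)
  rw [fderiv_apply_apply ((h.sub h').differentiableAt (by simp)),
    fderiv_apply_apply (h.differentiableAt (by simp)),
    fderiv_apply_apply (h'.differentiableAt (by simp))]
  have h2 : fderiv ℝ (fun y => b y v w - b' y v w) x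
      = fderiv ℝ (fun y => b y v w) x - fderiv ℝ (fun y => b' y v w) x := fderiv_sub (h1 h) (h1 h')
  exact congrArg (fun L : E →L[ℝ] ℝ => L u) h2

theorem extDeriv_one_form_apply {η : E → E [⋀^Fin 1]→L[ℝ] ℝ} {x : E}
    (h : DifferentiableAt ℝ η x) (u v : E) :
    extDeriv η x ![u, v] = fderiv ℝ (fun y => linearOfAlternating (η y)) x u v
      - fderiv ℝ (fun y => linearOfAlternating (η y)) x v u := by
  have h1 : fderiv ℝ (fun y => linearOfAlternating (η y)) x
      = linearOfAlternating.comp (fderiv ℝ η x) :=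
    (linearOfAlternating.hasFDerivAt.comp x h.hasFDerivAt).fderiv
  rw [h1, extDeriv, ContinuousAlternatingMap.alternatizeUncurryFin_apply, Fin.sum_univ_two]
  simp only [ContinuousLinearMap.comp_apply, linearOfAlternating_apply]
  have h2 : (0 : Fin 2).removeNth ![u, v] = ![v] := by ext i; fin_cases i; rfl
  have h3 : (1 : Fin 2).removeNth ![u, v] = ![u] := by ext i; fin_cases i; rfl
  rw [h2, h3]
  simp [sub_eq_add_neg]

theorem extDeriv_two_form_apply {ζ : E → E [⋀^Fin 2]→L[ℝ] ℝ} {x : E}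
    (h : DifferentiableAt ℝ ζ x) (u v w : E) :
    extDeriv ζ x ![u, v, w] = fderiv ℝ (fun y => bilinearOfAlternating (ζ y)) x u v w
      - fderiv ℝ (fun y => bilinearOfAlternating (ζ y)) x v u w
      + fderiv ℝ (fun y => bilinearOfAlternating (ζ y)) x w u v := by
  have h1 : ∀ u v w, fderiv ℝ (fun y => bilinearOfAlternating (ζ y)) x u v w
      = fderiv ℝ ζ x u ![v, w] := by
    intro u v w
    have h2 : DifferentiableAt ℝ (fun y => bilinearOfAlternating (ζ y)) x :=
      (contDiff_bilinearOfAlternating.differentiable (by simp) _).comp x h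
    have h4 := (ContinuousAlternatingMap.apply ℝ E ℝ ![v, w]).hasFDerivAt.comp x h.hasFDerivAt
    rw [fderiv_apply_apply h2, (h4.congr_of_eventuallyEq
      (.of_forall fun y => bilinearOfAlternating_apply (ζ y) v w)).fderiv]
    rfl
  simp only [h1]
  rw [extDeriv, ContinuousAlternatingMap.alternatizeUncurryFin_apply, Fin.sum_univ_three]
  have h2 : (0 : Fin 3).removeNth ![u, v, w] = ![v, w] := by ext i; fin_cases i <;> rfl
  have h3 : (1 : Fin 3).removeNth ![u, v, w] = ![u, w] := by ext i; fin_cases i <;> rfl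
  have h4 : (2 : Fin 3).removeNth ![u, v, w] = ![u, v] := by ext i; fin_cases i <;> rfl
  rw [h2, h3, h4]
  simp [sub_eq_add_neg]

end Bilinear

/-! ### Vector fields dual to a family of one-forms -/

section MoserLocal

variable {E : Type} [NormedAddCommGroup E] [NormedSpace ℝ E]

/-- By equality of dimensions, a non-degenerate bilinear form identifies the space with its dual. -/
theorem isInvertible_of_nondegenerate [FiniteDimensional ℝ E] {b : E →L[ℝ] E →L[ℝ] ℝ}
    (hb : ∀ v, (∀ w, b v w = 0) → v = 0) : b.IsInvertible := by
  have hinj : Injective b := (injective_iff_map_eq_zero b).2 fun v hv => hb v fun w => by simp [hv]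
  have hdim : Module.finrank ℝ E = Module.finrank ℝ (E →L[ℝ] ℝ) := by
    rw [← (LinearMap.toContinuousLinearMap (𝕜 := ℝ) (E := E) (F' := ℝ)).finrank_eq]
    exact Subspace.dual_finrank_eq.symm
  refine ⟨(LinearEquiv.ofInjectiveOfFinrankEq b.toLinearMap hinj hdim).toContinuousLinearEquiv, ?_⟩
  ext v : 1
  rfl

/-- The derivative in the parameter is smooth. -/
theorem ContDiffOn.derivWithin_uncurry {Y : Type*} [NormedAddCommGroup Y] [NormedSpace ℝ Y]
    {B : Set E} {f : ℝ → E → Y} (hf : ContDiffOn ℝ ∞ (uncurry f) (Icc 0 1 ×ˢ B)) :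
    ContDiffOn ℝ ∞ (uncurry fun t x => derivWithin (f · x) (Icc 0 1) t) (Icc 0 1 ×ˢ B) := by
  have h1 : ContDiffOn ℝ ∞ (uncurry fun x t => f t x) (B ×ˢ Icc 0 1) :=
    hf.comp (f := fun z : E × ℝ => (z.2, z.1)) (by fun_prop) fun z hz => ⟨hz.2, hz.1⟩
  have h2 := h1.fderivWithin_uncurry (uniqueDiffOn_Icc zero_lt_one)
  have h3 := h2.comp (s := Icc (0 : ℝ) 1 ×ˢ B) (f := fun z : ℝ × E => (z.2, z.1)) (by fun_prop)
    fun z hz => ⟨hz.2, hz.1⟩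
  exact h3.clm_apply (contDiffOn_const (c := (1 : ℝ)))

theorem hasDerivWithinAt_derivWithin_slice {Y : Type*} [NormedAddCommGroup Y] [NormedSpace ℝ Y]
    {B : Set E} {f : ℝ → E → Y} (hf : ContDiffOn ℝ ∞ (uncurry f) (Icc 0 1 ×ˢ B))
    {t : ℝ} (ht : t ∈ Icc (0 : ℝ) 1) {x : E} (hx : x ∈ B) :
    HasDerivWithinAt (f · x) (derivWithin (f · x) (Icc 0 1) t) (Icc 0 1) t := by
  have h1 : ContDiffOn ℝ ∞ (f · x) (Icc 0 1) :=
    hf.comp (f := fun t => (t, x)) (by fun_prop) fun t ht => ⟨ht, hx⟩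
  exact (h1.differentiableOn (by simp) t ht).hasDerivWithinAt

/-- A smooth field of non-degenerate bilinear forms, applied inversely to a smooth field of linear
forms, gives a smooth vector field. -/
theorem contDiffOn_inverse_apply [FiniteDimensional ℝ E] {B : Set E}
    {b : ℝ → E → E →L[ℝ] E →L[ℝ] ℝ} {β : ℝ → E → E →L[ℝ] ℝ}
    (hb : ContDiffOn ℝ ∞ (uncurry b) (Icc 0 1 ×ˢ B)) (hβ : ContDiffOn ℝ ∞ (uncurry β) (Icc 0 1 ×ˢ B))
    (hnd : ∀ t ∈ Icc (0 : ℝ) 1, ∀ x ∈ B, (b t x).IsInvertible) :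
    ContDiffOn ℝ ∞ (uncurry fun t x => (b t x).inverse (β t x)) (Icc 0 1 ×ˢ B) := by
  have := FiniteDimensional.complete ℝ E
  refine ContDiffOn.clm_apply (f := fun p : ℝ × E => (b p.1 p.2).inverse) ?_ hβ
  intro p hp
  exact ((hnd p.1 hp.1 p.2 hp.2).contDiffAt_map_inverse (n := ∞)).comp_contDiffWithinAt p (hb p hp)

/-- Moser's identity: if `ω t` is a family of closed `2`-forms with `ω t - ω 0 = d (η t)` and the
vector field `V t` satisfies `ω t (V t, ·) = - ∂ₜ η t`, then the derivative of `ω t` in `t`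
and its Lie derivative along `V t` cancel. -/
theorem derivWithin_add_lieDerivative_eq_zero [FiniteDimensional ℝ E] {B : Set E} (hB : IsOpen B)
    {b : ℝ → E → E →L[ℝ] E →L[ℝ] ℝ} {η : ℝ → E → E →L[ℝ] ℝ} {V : ℝ → E → E}
    (hb : ContDiffOn ℝ ∞ (uncurry b) (Icc 0 1 ×ˢ B)) (hη : ContDiffOn ℝ ∞ (uncurry η) (Icc 0 1 ×ˢ B))
    (hV : ContDiffOn ℝ ∞ (uncurry V) (Icc 0 1 ×ˢ B))
    (halt : ∀ t ∈ Icc (0 : ℝ) 1, ∀ x ∈ B, ∀ u v, b t x u v = - b t x v u)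
    (hclosed : ∀ t ∈ Icc (0 : ℝ) 1, ∀ x ∈ B, ∀ w u v,
      fderiv ℝ (b t) x w u v - fderiv ℝ (b t) x u w v + fderiv ℝ (b t) x v w u = 0)
    (hprim : ∀ t ∈ Icc (0 : ℝ) 1, ∀ x ∈ B, ∀ u v,
      fderiv ℝ (η t) x u v - fderiv ℝ (η t) x v u = b t x u v - b 0 x u v)
    (hVb : ∀ t ∈ Icc (0 : ℝ) 1, ∀ x ∈ B, b t x (V t x) = - derivWithin (η · x) (Icc 0 1) t)
    {t : ℝ} (ht : t ∈ Icc (0 : ℝ) 1) {x : E} (hx : x ∈ B) (u v : E) :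
    derivWithin (b · x) (Icc 0 1) t u v + fderiv ℝ (b t) x (V t x) u v
      + b t x (fderiv ℝ (V t) x u) v + b t x u (fderiv ℝ (V t) x v) = 0 := by
  set β : E → E →L[ℝ] ℝ := fun y => derivWithin (η · y) (Icc 0 1) t with hβ
  have dβ : ∀ u v, derivWithin (b · x) (Icc 0 1) t u v = fderiv ℝ β x u v - fderiv ℝ β x v u := by
    intro u v
    have h1 := hasDerivWithinAt_fderiv_comm hB hη ht hx
    have h2 : ∀ u v, HasDerivWithinAt (fun s => fderiv ℝ (η s) x u v) (fderiv ℝ β x u v)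
        (Icc 0 1) t := by
      intro u v
      have := (h1.clm_apply (hasDerivWithinAt_const t _ u)).clm_apply (hasDerivWithinAt_const t _ v)
      simpa using this
    have h3 := hasDerivWithinAt_derivWithin_slice hb ht hx
    have h4 : HasDerivWithinAt (fun s => b s x u v) (derivWithin (b · x) (Icc 0 1) t u v)
        (Icc 0 1) t := by
      have := (h3.clm_apply (hasDerivWithinAt_const t _ u)).clm_apply (hasDerivWithinAt_const t _ v)
      simpa using this
    have h5 : HasDerivWithinAt (fun s => b s x u v) (fderiv ℝ β x u v - fderiv ℝ β x v u)
        (Icc 0 1) t := by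
      refine (((h2 u v).sub (h2 v u)).add_const (b 0 x u v)).congr (fun s hs => ?_) ?_
      · show _ = fderiv ℝ (η s) x u v - fderiv ℝ (η s) x v u + _
        rw [hprim s hs x hx]; ring
      · show _ = fderiv ℝ (η t) x u v - fderiv ℝ (η t) x v u + _
        rw [hprim t ht x hx]; ring
    exact (uniqueDiffOn_Icc zero_lt_one t ht).eq_deriv _ h4 h5
  have hdiff : ∀ {Y : Type} [NormedAddCommGroup Y] [NormedSpace ℝ Y] {f : ℝ → E → Y},
      ContDiffOn ℝ ∞ (uncurry f) (Icc 0 1 ×ˢ B) → HasFDerivAt (f t) (fderiv ℝ (f t) x) x := by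
    intro Y _ _ f hf
    exact (((hf.uncurry_left ht).differentiableOn (by simp)).differentiableAt
      (hB.mem_nhds hx)).hasFDerivAt
  have h1 := (hdiff hb).clm_apply (hdiff hV)
  have h2 : HasFDerivAt (fun y => -(b t y (V t y))) (fderiv ℝ β x) x := by
    have h3 := hdiff hη.derivWithin_uncurry
    refine h3.congr_of_eventuallyEq ?_
    filter_upwards [hB.mem_nhds hx] with y hy
    rw [hVb t ht y hy, neg_neg]
  have h3 := h2.unique h1.neg
  have h4 : ∀ u v, fderiv ℝ β x u v = - (fderiv ℝ (b t) x u (V t x) v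
      + b t x (fderiv ℝ (V t) x u) v) := by
    intro u v
    rw [h3]
    simp [add_comm]
  rw [dβ, h4, h4]
  have h5 := hclosed t ht x hx (V t x) u v
  have h6 := halt t ht x hx u (fderiv ℝ (V t) x v)
  linear_combination h5 + h6

theorem hasDerivWithinAt_comp_of_uncurry {Y : Type*} [NormedAddCommGroup Y] [NormedSpace ℝ Y]
    {B : Set E} (hB : IsOpen B) {f : ℝ → E → Y}
    (hf : ContDiffOn ℝ ∞ (uncurry f) (Icc 0 1 ×ˢ B)) {z : ℝ → E} {τ : ℝ → ℝ} {τ' : ℝ} {z' : E}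
    (hmem : ∀ σ ∈ Icc (0 : ℝ) 1, τ σ ∈ Icc (0 : ℝ) 1 ∧ z σ ∈ B) {σ : ℝ} (hσ : σ ∈ Icc (0 : ℝ) 1)
    (hτ : HasDerivWithinAt τ τ' (Icc 0 1) σ) (hz : HasDerivWithinAt z z' (Icc 0 1) σ) :
    HasDerivWithinAt (fun σ => f (τ σ) (z σ))
      (τ' • derivWithin (f · (z σ)) (Icc 0 1) (τ σ) + fderiv ℝ (f (τ σ)) (z σ) z') (Icc 0 1) σ := by
  obtain ⟨h1, h2⟩ := hmem σ hσ
  set S := Icc (0 : ℝ) 1 ×ˢ B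
  have hd : HasFDerivWithinAt (uncurry f) (fderivWithin ℝ (uncurry f) S (τ σ, z σ)) S
      (τ σ, z σ) := (hf.differentiableOn (by simp) _ ⟨h1, h2⟩).hasFDerivWithinAt
  set f' := fderivWithin ℝ (uncurry f) S (τ σ, z σ)
  have h3 := hd.comp_hasDerivWithinAt (f := fun σ => (τ σ, z σ)) σ (hτ.prodMk hz) hmem
  refine h3.congr_deriv ?_
  have h5 : f' (1, 0) = derivWithin (f · (z σ)) (Icc 0 1) (τ σ) := by
    refine (HasDerivWithinAt.derivWithin ?_ (uniqueDiffOn_Icc zero_lt_one _ h1)).symm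
    exact hd.comp_hasDerivWithinAt (f := fun t => (t, z σ)) (τ σ)
      ((hasDerivWithinAt_id _ _).prodMk (hasDerivWithinAt_const _ _ (z σ))) fun t ht => ⟨ht, h2⟩
  have h6 : f' (0, z') = fderiv ℝ (f (τ σ)) (z σ) z' := by
    have h7 : HasFDerivAt (f (τ σ)) _ (z σ) := hasFDerivAt_slice hB h1 h2 hd
    rw [h7.fderiv]
    simp
  rw [← h5, ← h6, ← map_smul, ← map_add]
  simp

/-- A family of bilinear forms whose derivative in the parameter is cancelled by the Lie derivative
along a vector field is constant along the flow of the vector field. The solution `w` of the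
variational equation is the derivative of the flow. -/
theorem apply_eq_of_lieDerivative {B : Set E} (hB : IsOpen B)
    {b : ℝ → E → E →L[ℝ] E →L[ℝ] ℝ} {V : ℝ → E → E}
    (hb : ContDiffOn ℝ ∞ (uncurry b) (Icc 0 1 ×ˢ B))
    (hlie : ∀ t ∈ Icc (0 : ℝ) 1, ∀ x ∈ B, ∀ u v,
      derivWithin (b · x) (Icc 0 1) t u v + fderiv ℝ (b t) x (V t x) u v
        + b t x (fderiv ℝ (V t) x u) v + b t x u (fderiv ℝ (V t) x v) = 0)
    {s t : ℝ} (hs : s ∈ Icc (0 : ℝ) 1) (ht : t ∈ Icc (0 : ℝ) 1) {y : ℝ → E}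
    (hy : ∀ σ ∈ Icc (0 : ℝ) 1, y σ ∈ B ∧
      HasDerivWithinAt y ((t - s) • V (s + σ * (t - s)) (y σ)) (Icc 0 1) σ)
    {w : ℝ → E →L[ℝ] E} (hw0 : w 0 = ContinuousLinearMap.id ℝ E)
    (hw : ∀ σ ∈ Icc (0 : ℝ) 1, HasDerivWithinAt w
      ((t - s) • (fderiv ℝ (V (s + σ * (t - s))) (y σ)).comp (w σ)) (Icc 0 1) σ) (u v : E) :
    b t (y 1) (w 1 u) (w 1 v) = b s (y 0) u v := by
  have key : ∀ σ ∈ Icc (0 : ℝ) 1, HasDerivWithinAt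
      (fun σ => b (s + σ * (t - s)) (y σ) (w σ u) (w σ v)) 0 (Icc 0 1) σ := by
    intro σ hσ
    have h1 : HasDerivWithinAt (fun σ => s + σ * (t - s)) (t - s) (Icc 0 1) σ := by
      simpa using (((hasDerivAt_id σ).mul_const (t - s)).const_add s).hasDerivWithinAt
    have h2 := hasDerivWithinAt_comp_of_uncurry hB hb
      (fun σ hσ => ⟨add_mul_sub_mem_Icc hs ht hσ, (hy σ hσ).1⟩) hσ h1 (hy σ hσ).2
    have h3 : ∀ u, HasDerivWithinAt (fun σ => w σ u)
        ((t - s) • fderiv ℝ (V (s + σ * (t - s))) (y σ) (w σ u)) (Icc 0 1) σ := by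
      intro u
      simpa using (hw σ hσ).clm_apply (hasDerivWithinAt_const σ _ u)
    refine ((h2.clm_apply (h3 u)).clm_apply (h3 v)).congr_deriv ?_
    have h4 := hlie _ (add_mul_sub_mem_Icc hs ht hσ) _ (hy σ hσ).1 (w σ u) (w σ v)
    simp only [add_apply, smul_apply, smul_eq_mul, map_smul]
    linear_combination (t - s) * h4
  have h := eq_of_hasDerivWithinAt_eq key (fun σ _ => hasDerivWithinAt_const σ _ (b s (y 0) u v))
    (by simp [hw0]) 1 (by simp)
  simpa using h

end MoserLocal

/-! ### The Moser vector field -/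

section MoserField

universe u

variable {n : ℕ} {N : Type u} [TopologicalSpace N] {X : OrbifoldStructure n N}

namespace BallCover

/-- The bilinear form of an orbifold `2`-form on the ball with index `k`. -/
noncomputable def bilin (C : BallCover X) (Ω : OrbifoldForm X 2) (k : C.K) (x : OrbModel n) :
    OrbModel n →L[ℝ] OrbModel n →L[ℝ] ℝ :=
  bilinearOfAlternating (Ω.form (C.chart k) x)

/-- The linear form of an orbifold `1`-form on the ball with index `k`. -/
noncomputable def linear (C : BallCover X) (η : OrbifoldForm X 1) (k : C.K) (x : OrbModel n) :
    OrbModel n →L[ℝ] ℝ :=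
  linearOfAlternating (η.form (C.chart k) x)

variable {C : BallCover X}

theorem differentiableAt_form {j : ℕ} (Ω : OrbifoldForm X j) {k : C.K} {x : OrbModel n}
    (hx : x ∈ C.ball k) : DifferentiableAt ℝ (Ω.form (C.chart k)) x :=
  ((Ω.smooth (C.chart k)).differentiableOn (by simp)).differentiableAt
    ((C.chart k).1.isOpen_dom.mem_nhds (C.ball_subset k hx))

theorem contDiffOn_bilin {Ω : ℝ → OrbifoldForm X 2} (hΩ : OrbifoldForm.IsSmoothFamily Ω) (k : C.K) :
    ContDiffOn ℝ ∞ (uncurry fun t => C.bilin (Ω t) k) (Icc 0 1 ×ˢ C.ball k) :=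
  contDiff_bilinearOfAlternating.comp_contDiffOn
    ((hΩ (C.chart k)).mono (prod_mono_right (C.ball_subset k)))

theorem bilin_swap (Ω : OrbifoldForm X 2) (k : C.K) (x u v : OrbModel n) :
    C.bilin Ω k x u v = - C.bilin Ω k x v u := bilinearOfAlternating_swap _ u v

theorem bilin_closed {Ω : OrbifoldForm X 2} (hΩ : Ω.IsSymplectic) {k : C.K} {x : OrbModel n}
    (hx : x ∈ C.ball k) (w u v : OrbModel n) :
    fderiv ℝ (C.bilin Ω k) x w u v - fderiv ℝ (C.bilin Ω k) x u w v
      + fderiv ℝ (C.bilin Ω k) x v w u = 0 := by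
  have h := extDeriv_two_form_apply (differentiableAt_form Ω hx) w u v
  rw [hΩ.closed _ x (C.ball_subset k hx)] at h
  exact h.symm

theorem isInvertible_bilin {Ω : OrbifoldForm X 2} (hΩ : Ω.IsSymplectic) {k : C.K} {x : OrbModel n}
    (hx : x ∈ C.ball k) : (C.bilin Ω k x).IsInvertible := by
  refine isInvertible_of_nondegenerate fun v hv => hΩ.nondegenerate _ x (C.ball_subset k hx) v
    fun w => ?_
  rw [← bilinearOfAlternating_apply]
  exact hv w

theorem IsTransition.bilin_apply {i k : C.K} {W : Set (OrbModel n)} {φ : OrbModel n → OrbModel n}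
    (h : C.IsTransition i k W φ) {x : OrbModel n} (hx : x ∈ W) (Ω : OrbifoldForm X 2)
    (u v : OrbModel n) :
    C.bilin Ω k (φ x) (fderiv ℝ φ x u) (fderiv ℝ φ x v) = C.bilin Ω i x u v := by
  have h1 := (h.isSmoothLift.injective_fderiv_and_pullback h.isOpen h.subset_dom hx).2 2 Ω
  rw [bilin, bilin, bilinearOfAlternating_apply, bilinearOfAlternating_apply, ← h1,
    ContinuousAlternatingMap.compContinuousLinearMap_apply]
  congr 1
  funext j
  fin_cases j <;> rfl

theorem IsTransition.linear_apply {i k : C.K} {W : Set (OrbModel n)} {φ : OrbModel n → OrbModel n}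
    (h : C.IsTransition i k W φ) {x : OrbModel n} (hx : x ∈ W) (η : OrbifoldForm X 1) :
    (C.linear η k (φ x)).comp (fderiv ℝ φ x) = C.linear η i x := by
  have h1 := (h.isSmoothLift.injective_fderiv_and_pullback h.isOpen h.subset_dom hx).2 1 η
  ext u
  rw [ContinuousLinearMap.comp_apply, linear, linear, linearOfAlternating_apply,
    linearOfAlternating_apply, ← h1, ContinuousAlternatingMap.compContinuousLinearMap_apply]
  congr 1
  funext j
  fin_cases j
  rfl

theorem IsTransition.differentiableAt {i k : C.K} {W : Set (OrbModel n)}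
    {φ : OrbModel n → OrbModel n} (h : C.IsTransition i k W φ) {x : OrbModel n} (hx : x ∈ W) :
    DifferentiableAt ℝ φ x := h.isSmoothLift.differentiableAt h.isOpen hx

/-- A smooth family of closed orbifold `2`-forms in one cohomology class has a smooth family of
primitives: local primitives given by the Poincaré lemma differ from global ones, for each `t`,
by differentials of functions, and these functions can be corrected to depend smoothly
on `t`. -/
theorem exists_smooth_coherent_primitive [T2Space N] (C : BallCover X) {Ω : ℝ → OrbifoldForm X 2}
    (hΩ : OrbifoldForm.IsSmoothFamily Ω) (hs : ∀ t ∈ Icc (0 : ℝ) 1, (Ω t).IsSymplectic)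
    (hc : ∀ t ∈ Icc (0 : ℝ) 1, (Ω 0).Cohomologous (Ω t)) :
    ∃ η : C.K → ℝ → OrbModel n → OrbModel n →L[ℝ] ℝ,
      (∀ k, ContDiffOn ℝ ∞ (uncurry (η k)) (Icc 0 1 ×ˢ C.ball k)) ∧
      (∀ k, ∀ t ∈ Icc (0 : ℝ) 1, ∀ x ∈ C.ball k, ∀ u v,
        fderiv ℝ (η k t) x u v - fderiv ℝ (η k t) x v u
          = C.bilin (Ω t) k x u v - C.bilin (Ω 0) k x u v) ∧
      ∀ i k W φ, C.IsTransition i k W φ → ∀ t ∈ Icc (0 : ℝ) 1, ∀ x ∈ W,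
        η i t x = (η k t (φ x)).comp (fderiv ℝ φ x) := by
  have h0 : (0 : ℝ) ∈ Icc (0 : ℝ) 1 := by simp
  have hdb : ∀ t, ∀ k, ∀ x ∈ C.ball k, ContDiffAt ℝ ∞ (C.bilin (Ω t) k) x := fun t k x hx =>
    contDiff_bilinearOfAlternating.contDiffAt.comp x (((Ω t).smooth (C.chart k)).contDiffAt
      ((C.chart k).1.isOpen_dom.mem_nhds (C.ball_subset k hx)))
  have hprim : ∀ k : C.K, ∃ η : ℝ → OrbModel n → OrbModel n →L[ℝ] ℝ,
      ContDiffOn ℝ ∞ (uncurry η) (Icc 0 1 ×ˢ C.ball k) ∧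
      ∀ t ∈ Icc (0 : ℝ) 1, ∀ x ∈ C.ball k, ∀ u v,
        fderiv ℝ (η t) x u v - fderiv ℝ (η t) x v u
          = (C.bilin (Ω t) k x - C.bilin (Ω 0) k x) u v := by
    intro k
    refine exists_smooth_primitive (b := fun t x => C.bilin (Ω t) k x - C.bilin (Ω 0) k x)
      ?_ (fun t _ x _ u v => ?_) (fun t ht x hx w u v => ?_)
    · refine (contDiffOn_bilin hΩ k).sub ?_
      exact (contDiffOn_bilin hΩ k).comp (f := fun p : ℝ × OrbModel n => ((0 : ℝ), p.2))
        (by fun_prop) fun p hp => ⟨h0, hp.2⟩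
    · have h1 := bilin_swap (C := C) (Ω t) k x u v
      have h2 := bilin_swap (C := C) (Ω 0) k x u v
      simp only [sub_apply]
      linear_combination h1 - h2
    · simp only [fderiv_sub_apply_apply (hdb t k x hx) (hdb 0 k x hx)]
      linear_combination bilin_closed (hs t ht) hx w u v - bilin_closed (hs 0 h0) hx w u v
  choose η hη hdη using hprim
  -- for each `t`, the local primitives differ from a global one by the differentials of functions
  have hpot : ∀ t ∈ Icc (0 : ℝ) 1, ∃ g : C.K → OrbModel n → ℝ, ∀ i k W φ,
      C.IsTransition i k W φ → ∀ x ∈ W, HasFDerivAt (fun x => g i x - g k (φ x))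
        (η i t x - (η k t (φ x)).comp (fderiv ℝ φ x)) x := by
    intro t ht
    obtain ⟨θ, hθ⟩ := hc t ht
    have hθd : ∀ k, ∀ x ∈ C.ball k, DifferentiableAt ℝ (C.linear θ k) x := fun k x hx =>
      linearOfAlternating.differentiableAt.comp x (differentiableAt_form θ hx)
    have hηd : ∀ k, ∀ x ∈ C.ball k, DifferentiableAt ℝ (η k t) x := fun k x hx =>
      (((hη k).uncurry_left ht).differentiableOn (by simp)).differentiableAt
        ((C.isOpen_ball k).mem_nhds hx)
    have hg : ∀ k, ∃ g : OrbModel n → ℝ, ∀ x ∈ C.ball k,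
        HasFDerivAt g (η k t x - C.linear θ k x) x := by
      intro k
      refine Convex.exists_forall_hasFDerivAt_of_fderiv_symmetric (convex_ball _ _)
        (C.isOpen_ball k) (fun x hx => ((hηd k x hx).sub (hθd k x hx)).differentiableWithinAt)
        fun x hx u v => ?_
      have h1 : fderiv ℝ (fun x => η k t x - C.linear θ k x) x
          = fderiv ℝ (η k t) x - fderiv ℝ (C.linear θ k) x := fderiv_sub (hηd k x hx) (hθd k x hx)
      have h2 := hdη k t ht x hx u v
      have h3 := extDeriv_one_form_apply (differentiableAt_form θ hx) u v
      rw [← hθ _ x (C.ball_subset k hx)] at h3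
      have h4 : (C.bilin (Ω t) k x - C.bilin (Ω 0) k x) u v
          = fderiv ℝ (C.linear θ k) x u v - fderiv ℝ (C.linear θ k) x v u := by
        rw [sub_apply, sub_apply, bilin, bilin,
          bilinearOfAlternating_apply, bilinearOfAlternating_apply]
        exact h3
      rw [h1]
      simp only [sub_apply]
      linear_combination h2 + h4
    choose g hg using hg
    refine ⟨g, fun i k W φ h x hx => ?_⟩
    have h1 := (hg i x (h.subset hx)).sub
      ((hg k _ (h.mapsTo hx)).comp x (h.differentiableAt hx).hasFDerivAt)
    refine h1.congr_fderiv ?_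
    rw [ContinuousLinearMap.sub_comp, h.linear_apply hx]
    abel
  obtain ⟨g, hg⟩ := exists_smooth_differences C η hη hpot
  obtain ⟨f, hf, hfg⟩ := exists_smooth_of_smooth_differences C fun i k a ε φ h =>
    (hg i k a ε φ h).1
  have hfd : ∀ k, ∀ t ∈ Icc (0 : ℝ) 1, ∀ x ∈ C.ball k, ContDiffAt ℝ ∞ (f k t) x :=
    fun k t ht x hx => ((hf k).uncurry_left ht).contDiffAt ((C.isOpen_ball k).mem_nhds hx)
  refine ⟨fun k t x => η k t x - fderiv ℝ (f k t) x, fun k => ?_, fun k t ht x hx u v => ?_,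
    fun i k W φ h t ht x hx => ?_⟩
  · refine (hη k).sub (ContDiffOn.congr
      ((hf k).fderivWithin_uncurry (C.isOpen_ball k).uniqueDiffOn) ?_)
    rintro ⟨t, x⟩ ⟨-, hx⟩
    exact (fderivWithin_of_isOpen (C.isOpen_ball k) hx).symm
  · have hηd : DifferentiableAt ℝ (η k t) x :=
      (((hη k).uncurry_left ht).differentiableOn (by simp)).differentiableAt
        ((C.isOpen_ball k).mem_nhds hx)
    have hdd : DifferentiableAt ℝ (fun x => fderiv ℝ (f k t) x) x :=
      ((hfd k t ht x hx).fderiv_right (m := ∞) (by simp)).differentiableAt (by simp)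
    have h1 : fderiv ℝ (fun x => η k t x - fderiv ℝ (f k t) x) x
        = fderiv ℝ (η k t) x - fderiv ℝ (fun x => fderiv ℝ (f k t) x) x := fderiv_sub hηd hdd
    have h2 : IsSymmSndFDerivAt ℝ (f k t) x := (hfd k t ht x hx).isSymmSndFDerivAt
      (by simpa using ENat.LEInfty.out)
    have h3 : fderiv ℝ (fun x => fderiv ℝ (f k t) x) x u v
        = fderiv ℝ (fun x => fderiv ℝ (f k t) x) x v u := h2 u v
    have h4 := hdη k t ht x hx u v
    rw [h1]
    simp only [sub_apply] at h4 ⊢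
    linear_combination h4 - h3
  · obtain ⟨ε, hε, hsub⟩ := Metric.isOpen_iff.1 h.isOpen x hx
    have hb := h.mono Metric.isOpen_ball hsub
    have h1 := (hg i k x ε φ hb).2 t ht x (Metric.mem_ball_self hε)
    have h2 : HasFDerivAt (fun x => f i t x - f k t (φ x))
        (fderiv ℝ (f i t) x - (fderiv ℝ (f k t) (φ x)).comp (fderiv ℝ φ x)) x :=
      ((hfd i t ht x (h.subset hx)).differentiableAt (by simp)).hasFDerivAt.sub
        (((hfd k t ht _ (h.mapsTo hx)).differentiableAt (by simp)).hasFDerivAt.comp x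
          (h.differentiableAt hx).hasFDerivAt)
    have h3 : (fun x => f i t x - f k t (φ x)) =ᶠ[𝓝 x] fun x => g i t x - g k t (φ x) := by
      filter_upwards [h.isOpen.mem_nhds hx] with y hy
      exact hfg i k y (h.subset hy) _ (h.mapsTo hy) (h.proj_eq hy).symm t
    have h4 := h2.unique (h1.congr_of_eventuallyEq h3)
    rw [ContinuousLinearMap.sub_comp, sub_eq_sub_iff_sub_eq_sub, ← h4]

/-- A smooth family of vector fields on the balls of a cover, compatible with the transitions,
such that the Lie derivatives of the forms `Ω t` cancel their derivatives in `t`. -/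
structure IsMoserField (C : BallCover X) (Ω : ℝ → OrbifoldForm X 2)
    (V : C.K → ℝ → OrbModel n → OrbModel n) : Prop where
  contDiffOn : ∀ k, ContDiffOn ℝ ∞ (uncurry (V k)) (Icc 0 1 ×ˢ C.ball k)
  map : ∀ i k W φ, C.IsTransition i k W φ → ∀ t ∈ Icc (0 : ℝ) 1, ∀ x ∈ W,
    V k t (φ x) = fderiv ℝ φ x (V i t x)
  lie : ∀ k, ∀ t ∈ Icc (0 : ℝ) 1, ∀ x ∈ C.ball k, ∀ u v,
    derivWithin (fun s => C.bilin (Ω s) k x) (Icc 0 1) t u v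
      + fderiv ℝ (C.bilin (Ω t) k) x (V k t x) u v
      + C.bilin (Ω t) k x (fderiv ℝ (V k t) x u) v
      + C.bilin (Ω t) k x u (fderiv ℝ (V k t) x v) = 0

theorem exists_isMoserField [T2Space N] (C : BallCover X) {Ω : ℝ → OrbifoldForm X 2}
    (hΩ : OrbifoldForm.IsSmoothFamily Ω) (hs : ∀ t ∈ Icc (0 : ℝ) 1, (Ω t).IsSymplectic)
    (hc : ∀ t ∈ Icc (0 : ℝ) 1, (Ω 0).Cohomologous (Ω t)) :
    ∃ V, C.IsMoserField Ω V := by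
  obtain ⟨η, hη, hdη, hηm⟩ := exists_smooth_coherent_primitive C hΩ hs hc
  set β : C.K → ℝ → OrbModel n → OrbModel n →L[ℝ] ℝ := fun k t x =>
    derivWithin (η k · x) (Icc 0 1) t with hβ
  have hβs : ∀ k, ContDiffOn ℝ ∞ (uncurry (β k)) (Icc 0 1 ×ˢ C.ball k) := fun k =>
    (hη k).derivWithin_uncurry
  have hβm : ∀ i k W φ, C.IsTransition i k W φ → ∀ t ∈ Icc (0 : ℝ) 1, ∀ x ∈ W,
      β i t x = (β k t (φ x)).comp (fderiv ℝ φ x) := by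
    intro i k W φ h t ht x hx
    have h1 := hasDerivWithinAt_derivWithin_slice (hη i) ht (h.subset hx)
    have h2 := (hasDerivWithinAt_derivWithin_slice (hη k) ht (h.mapsTo hx)).clm_comp
      (hasDerivWithinAt_const t _ (fderiv ℝ φ x))
    have h3 := h2.congr (fun s hs => hηm i k W φ h s hs x hx) (hηm i k W φ h t ht x hx)
    simpa using (uniqueDiffOn_Icc zero_lt_one t ht).eq_deriv _ h1 h3
  have hsolve : ∀ k, ∀ t ∈ Icc (0 : ℝ) 1, ∀ x ∈ C.ball k,
      C.bilin (Ω t) k x ((C.bilin (Ω t) k x).inverse (-β k t x)) = -β k t x := by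
    intro k t ht x hx
    obtain ⟨e, he⟩ := isInvertible_bilin (hs t ht) hx
    rw [← he, ContinuousLinearMap.inverse_equiv]
    exact e.apply_symm_apply _
  have hV : ∀ k, ContDiffOn ℝ ∞ (uncurry fun t x => (C.bilin (Ω t) k x).inverse (-β k t x))
      (Icc 0 1 ×ˢ C.ball k) := fun k =>
    contDiffOn_inverse_apply (contDiffOn_bilin hΩ k) (hβs k).neg
      fun t ht x hx => isInvertible_bilin (hs t ht) hx
  refine ⟨fun k t x => (C.bilin (Ω t) k x).inverse (-β k t x), hV,
    fun i k W φ h t ht x hx => ?_, fun k t ht x hx u v => ?_⟩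
  · obtain ⟨e, he⟩ := isInvertible_bilin (hs t ht) (h.mapsTo hx)
    have hsurj : Surjective (fderiv ℝ φ x) := LinearMap.surjective_of_injective
      (f := (fderiv ℝ φ x).toLinearMap)
      (h.isSmoothLift.injective_fderiv_and_pullback h.isOpen h.subset_dom hx).1
    have hinj : Injective (C.bilin (Ω t) k (φ x)) := by rw [← he]; exact e.injective
    refine hinj ?_
    rw [hsolve k t ht _ (h.mapsTo hx)]
    ext v
    obtain ⟨w, rfl⟩ := hsurj v
    rw [h.bilin_apply hx, hsolve i t ht x (h.subset hx), hβm i k W φ h t ht x hx]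
    rfl
  · exact derivWithin_add_lieDerivative_eq_zero (C.isOpen_ball k) (contDiffOn_bilin hΩ k) (hη k)
      (hV k) (fun t _ x _ => bilin_swap (Ω t) k x) (fun t ht x hx => bilin_closed (hs t ht) hx)
      (hdη k) (hsolve k) ht hx u v

end BallCover

end MoserField

/-! ### Flows over short times -/

section ShortFlow

universe u

/-- Local uniqueness of solutions, towards the future only since the vector field is defined only
for times in `[0,1]`. -/
theorem exists_mem_Ioc_eq_of_ode {E : Type*} [NormedAddCommGroup E] [NormedSpace ℝ E]
    {G : ℝ → E → E} {B : Set E} (hB : IsOpen B) (hBc : Convex ℝ B)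
    (hG : ContDiffOn ℝ ∞ (uncurry G) (Icc 0 1 ×ˢ B)) {a b : ℝ} (ha : 0 ≤ a) (hab : a < b)
    (hb : b ≤ 1) {f g : ℝ → E} (hf : ∀ σ ∈ Icc a b, HasDerivWithinAt f (G σ (f σ)) (Icc a b) σ)
    (hg : ∀ σ ∈ Icc a b, HasDerivWithinAt g (G σ (g σ)) (Icc a b) σ) (hfg : f a = g a)
    (hfB : f a ∈ B) : ∃ c ∈ Ioc a b, f c = g c := by
  have haI : a ∈ Icc (0 : ℝ) 1 := ⟨ha, by linarith⟩
  have haab : a ∈ Icc a b := ⟨le_rfl, hab.le⟩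
  obtain ⟨K, T, hT, hK⟩ := ((hG (a, f a) ⟨haI, hfB⟩).of_le (m := 1) (by simp)).exists_lipschitzOnWith
    ((convex_Icc 0 1).prod hBc)
  rw [nhdsWithin_prod_eq, Filter.mem_prod_iff] at hT
  obtain ⟨T₁, hT₁, T₂, hT₂, hsub⟩ := hT
  rw [hB.nhdsWithin_eq hfB] at hT₂
  have hev : ∀ᶠ σ in 𝓝[Icc a b] a, σ ∈ T₁ ∧ f σ ∈ T₂ ∧ g σ ∈ T₂ := by
    refine Filter.Eventually.and ?_ (Filter.Eventually.and ?_ ?_)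
    · exact nhdsWithin_mono a (Icc_subset_Icc ha hb) hT₁
    · exact (hf a haab).continuousWithinAt.eventually hT₂
    · exact (hg a haab).continuousWithinAt.eventually (by rw [← hfg]; exact hT₂)
  obtain ⟨ε, hε, hεs⟩ := Metric.mem_nhdsWithin_iff.1 hev
  set c := min b (a + ε / 2) with hc
  have hac : a < c := lt_min hab (by linarith)
  have hcb : c ≤ b := min_le_left _ _
  have hmem : ∀ σ ∈ Icc a c, σ ∈ T₁ ∧ f σ ∈ T₂ ∧ g σ ∈ T₂ := by
    intro σ hσ
    refine hεs ⟨?_, hσ.1, hσ.2.trans hcb⟩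
    have := hσ.2.trans (min_le_right b (a + ε / 2))
    rw [Metric.mem_ball, Real.dist_eq, abs_of_nonneg (by linarith [hσ.1])]
    linarith
  have hsubI : Icc a c ⊆ Icc a b := Icc_subset_Icc_right hcb
  refine ⟨c, ⟨hac, hcb⟩, ODE_solution_unique_of_mem_Icc_right (v := G) (s := fun _ => T₂) (K := K)
    (fun σ hσ => ?_) (fun σ hσ => ((hf σ (hsubI hσ)).mono hsubI).continuousWithinAt)
    (fun σ hσ => (hf σ (hsubI (Ico_subset_Icc_self hσ))).ici_of_Icc ⟨hσ.1, hσ.2.trans_le hcb⟩)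
    (fun σ hσ => (hmem σ (Ico_subset_Icc_self hσ)).2.1)
    (fun σ hσ => ((hg σ (hsubI hσ)).mono hsubI).continuousWithinAt)
    (fun σ hσ => (hg σ (hsubI (Ico_subset_Icc_self hσ))).ici_of_Icc ⟨hσ.1, hσ.2.trans_le hcb⟩)
    (fun σ hσ => (hmem σ (Ico_subset_Icc_self hσ)).2.2) hfg ⟨hac.le, le_rfl⟩⟩
  refine LipschitzOnWith.of_dist_le_mul fun y hy z hz => ?_
  have h1 := (hmem σ (Ico_subset_Icc_self hσ)).1
  have := hK.dist_le_mul (σ, y) (hsub ⟨h1, hy⟩) (σ, z) (hsub ⟨h1, hz⟩)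
  rwa [dist_prod_same_left] at this

variable {n : ℕ} {N : Type u} [TopologicalSpace N] {X : OrbifoldStructure n N}

namespace BallCover

/-- `y` is an integral curve of the time-dependent vector field `V k` in the ball with index `k`,
from time `s` to time `t`, with the time rescaled to `[0,1]`. -/
def IsCurve (C : BallCover X) (V : C.K → ℝ → OrbModel n → OrbModel n) (k : C.K) (s t : ℝ)
    (y : ℝ → OrbModel n) : Prop :=
  ∀ σ ∈ Icc (0 : ℝ) 1, y σ ∈ C.ball k ∧
    HasDerivWithinAt y ((t - s) • V k (s + σ * (t - s)) (y σ)) (Icc 0 1) σ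

variable {C : BallCover X} {V : C.K → ℝ → OrbModel n → OrbModel n} {Ω : ℝ → OrbifoldForm X 2}

theorem IsCurve.reverse {k : C.K} {s t : ℝ} {y : ℝ → OrbModel n} (h : C.IsCurve V k s t y) :
    C.IsCurve V k t s fun σ => y (1 - σ) := by
  intro σ hσ
  have hσ' : 1 - σ ∈ Icc (0 : ℝ) 1 := ⟨by linarith [hσ.2], by linarith [hσ.1]⟩
  refine ⟨(h _ hσ').1, ?_⟩
  have h1 : HasDerivWithinAt (fun σ : ℝ => 1 - σ) (-1) (Icc 0 1) σ :=
    ((hasDerivAt_id σ).const_sub 1).hasDerivWithinAt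
  refine ((h _ hσ').2.scomp σ h1 fun z hz => ⟨by linarith [hz.2], by linarith [hz.1]⟩).congr_deriv ?_
  rw [show s + (1 - σ) * (t - s) = t + σ * (s - t) by ring, smul_smul]
  congr 1
  ring

/-- Integral curves in two charts that start at the same point of the orbifold agree as curves in
the orbifold. -/
theorem IsCurve.proj_eq [T2Space N] (hV : C.IsMoserField Ω V) {i k : C.K} {s t : ℝ}
    (hs : s ∈ Icc (0 : ℝ) 1) (ht : t ∈ Icc (0 : ℝ) 1) {y y' : ℝ → OrbModel n}
    (h : C.IsCurve V i s t y) (h' : C.IsCurve V k s t y') (h0 : C.proj i (y 0) = C.proj k (y' 0)) :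
    ∀ σ ∈ Icc (0 : ℝ) 1, C.proj i (y σ) = C.proj k (y' σ) := by
  have hcont : ∀ {k y}, C.IsCurve V k s t y → ContinuousOn (fun σ => C.proj k (y σ)) (Icc 0 1) :=
    fun {k y} h => (C.chart k).1.continuousOn_proj.comp
      (fun σ hσ => (h σ hσ).2.continuousWithinAt) fun σ hσ => C.ball_subset k (h σ hσ).1
  refine IsClosed.Icc_subset_of_forall_exists_gt (s := {σ | C.proj i (y σ) = C.proj k (y' σ)})
    ?_ h0 ?_
  · have := ((hcont h).prodMk (hcont h')).preimage_isClosed_of_isClosed isClosed_Icc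
      isClosed_diagonal
    rwa [inter_comm] at this
  · rintro a ⟨ha, ha'⟩ c hc
    obtain ⟨ε, hε, φ, hφ, hφy⟩ := exists_isTransition (h a (Ico_subset_Icc_self ha')).1
      (h' a (Ico_subset_Icc_self ha')).1 ha
    have hev : ∀ᶠ σ in 𝓝[Icc 0 1] a, y σ ∈ Metric.ball (y a) ε :=
      (h a (Ico_subset_Icc_self ha')).2.continuousWithinAt.eventually (Metric.ball_mem_nhds _ hε)
    obtain ⟨ρ, hρ, hρs⟩ := Metric.mem_nhdsWithin_iff.1 hev
    set b := min (min c 1) (a + ρ / 2) with hb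
    have hab : a < b := lt_min (lt_min hc ha'.2) (by linarith)
    have hb1 : b ≤ 1 := (min_le_left _ _).trans (min_le_right _ _)
    have hbc : b ≤ c := (min_le_left _ _).trans (min_le_left _ _)
    have hsub : Icc a b ⊆ Icc 0 1 := Icc_subset_Icc ha'.1 hb1
    have hball : ∀ σ ∈ Icc a b, y σ ∈ Metric.ball (y a) ε := by
      intro σ hσ
      refine hρs ⟨?_, hsub hσ⟩
      have := hσ.2.trans (min_le_right (min c 1) (a + ρ / 2))
      rw [Metric.mem_ball, Real.dist_eq, abs_of_nonneg (by linarith [hσ.1])]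
      linarith
    have hG : ContDiffOn ℝ ∞ (uncurry fun σ x => (t - s) • V k (s + σ * (t - s)) x)
        (Icc 0 1 ×ˢ C.ball k) := by
      refine ContDiffOn.const_smul _ ((hV.contDiffOn k).comp
        (f := fun p : ℝ × OrbModel n => (s + p.1 * (t - s), p.2)) (by fun_prop) ?_)
      exact fun p hp => ⟨add_mul_sub_mem_Icc hs ht hp.1, hp.2⟩
    have hφy' : ∀ σ ∈ Icc a b, HasDerivWithinAt (φ ∘ y)
        ((t - s) • V k (s + σ * (t - s)) ((φ ∘ y) σ)) (Icc a b) σ := by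
      intro σ hσ
      have h1 := (hφ.differentiableAt (hball σ hσ)).hasFDerivAt.comp_hasDerivWithinAt σ
        ((h σ (hsub hσ)).2.mono hsub)
      refine h1.congr_deriv ?_
      rw [comp_apply, hV.map i k _ φ hφ _ (add_mul_sub_mem_Icc hs ht (hsub hσ)) _ (hball σ hσ),
        map_smul]
    obtain ⟨d, hd, hdeq⟩ := exists_mem_Ioc_eq_of_ode (C.isOpen_ball k) (convex_ball _ _) hG ha'.1
      hab hb1 hφy' (fun σ hσ => (h' σ (hsub hσ)).2.mono hsub) hφy
      (by rw [comp_apply, hφy]; exact (h' a (Ico_subset_Icc_self ha')).1)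
    refine ⟨d, ?_, hd.1, hd.2.trans hbc⟩
    show C.proj i (y d) = C.proj k (y' d)
    rw [← hdeq]
    exact (hφ.proj_eq (hball d ⟨hd.1.le, hd.2⟩)).symm

/-- Flow boxes with a common time span for all balls of a cover: `σ ↦ e k σ (s, t, x)` is the integral
curve of `V k` starting at `x`, from time `s` to time `t`, with the time rescaled to `[0,1]`. The
flow boxes are defined on the balls of a quarter of the radius, and `variation` says that their
derivatives in `x` solve the first variation equation. -/
structure IsFlowBox (C : BallCover X) (V : C.K → ℝ → OrbModel n → OrbModel n) (δ : ℝ)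
    (e : C.K → ℝ → ℝ × ℝ × OrbModel n → OrbModel n) : Prop where
  contDiffOn : ∀ k, ContDiffOn ℝ ∞ (e k 1)
    (shortTimes δ (Metric.ball (C.center k) (C.radius k / 4)))
  zero : ∀ k, ∀ p ∈ shortTimes δ (Metric.ball (C.center k) (C.radius k / 4)), e k 0 p = p.2.2
  isCurve : ∀ k, ∀ p ∈ shortTimes δ (Metric.ball (C.center k) (C.radius k / 4)),
    C.IsCurve V k p.1 p.2.1 (e k · p)
  variation : ∀ k, ∀ p ∈ shortTimes δ (Metric.ball (C.center k) (C.radius k / 4)),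
    ∃ w : ℝ → OrbModel n →L[ℝ] OrbModel n, w 0 = ContinuousLinearMap.id ℝ (OrbModel n) ∧
      (∀ σ ∈ Icc (0 : ℝ) 1, HasFDerivAt (fun x => e k σ (p.1, p.2.1, x)) (w σ) p.2.2) ∧
      ∀ σ ∈ Icc (0 : ℝ) 1, HasDerivWithinAt w ((p.2.1 - p.1) •
        (fderiv ℝ (V k (p.1 + σ * (p.2.1 - p.1))) (e k σ p)).comp (w σ)) (Icc 0 1) σ

theorem exists_isFlowBox (hV : C.IsMoserField Ω V) : ∃ δ > 0, ∃ e, C.IsFlowBox V δ e := by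
  choose δ hδ e he1 he2 using fun k =>
    exists_smooth_local_flow (C.radius_pos k) (hV.contDiffOn k)
  obtain ⟨δ', hδ', hle⟩ : ∃ δ' > 0, ∀ k, δ' ≤ δ k := by
    rcases isEmpty_or_nonempty C.K with h | h
    · exact ⟨1, one_pos, fun k => h.elim k⟩
    · obtain ⟨k, hk⟩ := Finite.exists_min δ
      exact ⟨δ k, hδ k, hk⟩
  have hsub : ∀ k, shortTimes δ' (Metric.ball (C.center k) (C.radius k / 4)) ⊆
      shortTimes (δ k) (Metric.ball (C.center k) (C.radius k / 4)) := fun k p hp =>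
    ⟨hp.1, hp.2.1, hp.2.2.1.trans (hle k), hp.2.2.2⟩
  refine ⟨δ', hδ', e, fun k => (he1 k 1 (by simp)).mono (hsub k),
    fun k p hp => (he2 k p (hsub k hp)).1, fun k p hp σ hσ => ?_,
    fun k p hp => (he2 k p (hsub k hp)).2.2.2⟩
  exact ⟨(he2 k p (hsub k hp)).2.1 σ hσ, (he2 k p (hsub k hp)).2.2.1 σ hσ⟩

/-- The flow over a short time preserves the family of forms. -/
theorem IsFlowBox.bilin_apply (hΩ : OrbifoldForm.IsSmoothFamily Ω) (hV : C.IsMoserField Ω V)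
    {δ : ℝ} {e : C.K → ℝ → ℝ × ℝ × OrbModel n → OrbModel n} (he : C.IsFlowBox V δ e) {k : C.K}
    {s t : ℝ} {x : OrbModel n}
    (hp : (s, t, x) ∈ shortTimes δ (Metric.ball (C.center k) (C.radius k / 4)))
    (u v : OrbModel n) :
    C.bilin (Ω t) k (e k 1 (s, t, x)) (fderiv ℝ (fun x => e k 1 (s, t, x)) x u)
      (fderiv ℝ (fun x => e k 1 (s, t, x)) x v) = C.bilin (Ω s) k x u v := by
  obtain ⟨w, hw0, hwd, hw⟩ := he.variation k _ hp
  have hcurve := he.isCurve k _ hp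
  have hz := he.zero k _ hp
  simp only at hwd hw hcurve hz
  rw [(hwd 1 (by simp)).fderiv]
  have h := apply_eq_of_lieDerivative (C.isOpen_ball k) (contDiffOn_bilin hΩ k) (hV.lie k) hp.1 hp.2.1
    hcurve hw0 hw u v
  rwa [hz] at h

end BallCover

end ShortFlow

/-! ### Families of maps with symplectic local lifts -/

section SymplecticLifts

universe u

variable {n : ℕ} {N : Type u} [TopologicalSpace N] {X : OrbifoldStructure n N}

theorem bilinearOfAlternating_compContinuousLinearMap {E : Type} [NormedAddCommGroup E]
    [NormedSpace ℝ E] (ζ : E [⋀^Fin 2]→L[ℝ] ℝ) (L : E →L[ℝ] E) (u v : E) :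
    bilinearOfAlternating (ζ.compContinuousLinearMap L) u v
      = bilinearOfAlternating ζ (L u) (L v) := by
  rw [bilinearOfAlternating_apply, bilinearOfAlternating_apply,
    ContinuousAlternatingMap.compContinuousLinearMap_apply]
  congr 1
  funext j
  fin_cases j <;> rfl

theorem exists_isOpen_prod_subset {E : Type*} [TopologicalSpace E] {J I : Set ℝ} {W : Set E}
    {T : Set (ℝ × E)} {t : ℝ} {x : E} (hJ : IsOpen J) (hW : IsOpen W) (ht : t ∈ J) (hx : x ∈ W)
    (hT : T ∈ 𝓝[(J ∩ I) ×ˢ W] (t, x)) :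
    ∃ J' W', IsOpen J' ∧ IsOpen W' ∧ t ∈ J' ∧ x ∈ W' ∧ J' ⊆ J ∧ W' ⊆ W ∧
      (J' ∩ I) ×ˢ W' ⊆ T := by
  rw [nhdsWithin_prod_eq, Filter.mem_prod_iff] at hT
  obtain ⟨T₁, hT₁, T₂, hT₂, hsub⟩ := hT
  obtain ⟨J', hJ', htJ', hJs⟩ := mem_nhdsWithin.1 hT₁
  obtain ⟨W', hW', hxW', hWs⟩ := mem_nhdsWithin.1 hT₂
  refine ⟨J' ∩ J, W' ∩ W, hJ'.inter hJ, hW'.inter hW, ⟨htJ', ht⟩, ⟨hxW', hx⟩, inter_subset_right,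
    inter_subset_right, fun p hp => hsub ⟨hJs ?_, hWs hp.2⟩⟩
  exact ⟨hp.1.1.1, hp.1.1.2, hp.1.2⟩

/-- Near the time `t` and the point `x` of the chart `α`, the maps `f s` have lifts with values in
the chart `β`, depending smoothly on `(s, x)` and sending `(t, x)` to `y`, which are immersions and
pull back `Ω (c' s)` to `Ω (c s)`. -/
def HasSymplecticLift (Ω : ℝ → OrbifoldForm X 2) (c c' : ℝ → ℝ) (f : ℝ → N → N) (t : ℝ)
    (α β : X.charts) (x y : OrbModel n) : Prop :=
  ∃ (J : Set ℝ) (W : Set (OrbModel n)) (F : ℝ → OrbModel n → OrbModel n),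
    IsOpen J ∧ t ∈ J ∧ IsOpen W ∧ x ∈ W ∧ W ⊆ α.1.dom ∧ F t x = y ∧
    ContDiffOn ℝ ∞ (uncurry F) ((J ∩ Icc 0 1) ×ˢ W) ∧
    ∀ s ∈ J ∩ Icc 0 1, IsSmoothLift (f s) α.1 β.1 W (F s) ∧ ∀ z ∈ W, Injective (fderiv ℝ (F s) z) ∧
      ((Ω (c' s)).form β (F s z)).compContinuousLinearMap (fderiv ℝ (F s) z) = (Ω (c s)).form α z

variable {Ω : ℝ → OrbifoldForm X 2} {c c' c'' : ℝ → ℝ} {f g : ℝ → N → N} {t : ℝ} {α β γ : X.charts}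
  {x y z : OrbModel n}

theorem HasTransition.hasSymplecticLift (h : HasTransition X α β x y) :
    HasSymplecticLift Ω c c (fun _ => id) t α β x y := by
  obtain ⟨W, τ, hWo, hxW, hWd, hτ, hτx, hinj, hform⟩ := h
  exact ⟨univ, W, fun _ => τ, isOpen_univ, mem_univ _, hWo, hxW, hWd, hτx,
    hτ.contDiffOn.comp contDiffOn_snd fun p hp => hp.2, fun s _ =>
    ⟨hτ, fun z hz => ⟨hinj z hz, hform 2 (Ω (c s)) z hz⟩⟩⟩

theorem HasSymplecticLift.comp (ht : t ∈ Icc (0 : ℝ) 1)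
    (h₁ : HasSymplecticLift Ω c c' f t α β x y) (h₂ : HasSymplecticLift Ω c' c'' g t β γ y z) :
    HasSymplecticLift Ω c c'' (fun s => g s ∘ f s) t α γ x z := by
  obtain ⟨J₁, W₁, F₁, hJ₁, htJ₁, hW₁, hxW₁, hWd₁, hFx₁, hF₁, hl₁⟩ := h₁
  obtain ⟨J₂, W₂, F₂, hJ₂, htJ₂, hW₂, hxW₂, hWd₂, hFx₂, hF₂, hl₂⟩ := h₂
  have hT : uncurry F₁ ⁻¹' W₂ ∈ 𝓝[(J₁ ∩ Icc 0 1) ×ˢ W₁] (t, x) := by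
    refine (hF₁.continuousOn (t, x) ⟨⟨htJ₁, ht⟩, hxW₁⟩) (hW₂.mem_nhds ?_)
    rw [uncurry_apply_pair, hFx₁]
    exact hxW₂
  obtain ⟨J, W, hJ, hW, htJ, hxW, hJs, hWs, hsub⟩ :=
    exists_isOpen_prod_subset hJ₁ hW₁ htJ₁ hxW₁ hT
  have hmaps : ∀ s ∈ J ∩ Icc (0 : ℝ) 1, MapsTo (F₁ s) W W₂ := fun s hs w hw =>
    hsub (show (s, w) ∈ (J ∩ Icc 0 1) ×ˢ W from ⟨hs, hw⟩)
  refine ⟨J ∩ J₂, W, fun s => F₂ s ∘ F₁ s, hJ.inter hJ₂, ⟨htJ, htJ₂⟩, hW, hxW, hWs.trans hWd₁,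
    by show F₂ t (F₁ t x) = z; rw [hFx₁, hFx₂], ?_, ?_⟩
  · refine hF₂.comp (f := fun p : ℝ × OrbModel n => (p.1, F₁ p.1 p.2))
      (contDiffOn_fst.prodMk (hF₁.mono ?_)) ?_
    · exact fun p hp => ⟨⟨hJs hp.1.1.1, hp.1.2⟩, hWs hp.2⟩
    · exact fun p hp => ⟨⟨hp.1.1.2, hp.1.2⟩, hmaps p.1 ⟨hp.1.1.1, hp.1.2⟩ hp.2⟩
  · rintro s ⟨⟨hsJ, hsJ₂⟩, hs⟩
    obtain ⟨hL₁, hl₁⟩ := hl₁ s ⟨hJs hsJ, hs⟩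
    obtain ⟨hL₂, hl₂⟩ := hl₂ s ⟨hsJ₂, hs⟩
    refine ⟨IsSmoothLift.comp hL₂ (hL₁.mono hWs) (hmaps s ⟨hsJ, hs⟩), fun w hw => ?_⟩
    have hw₂ := hmaps s ⟨hsJ, hs⟩ hw
    obtain ⟨hi₁, hp₁⟩ := hl₁ w (hWs hw)
    obtain ⟨hi₂, hp₂⟩ := hl₂ _ hw₂
    rw [fderiv_comp w (hL₂.differentiableAt hW₂ hw₂) (hL₁.differentiableAt hW₁ (hWs hw))]
    refine ⟨hi₂.comp hi₁, ?_⟩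
    rw [← hp₁, ← hp₂]
    rfl

/-- A family of maps of the orbifold, with parameter in `[0,1]`, that has symplectic lifts near
all points and in all charts. -/
def IsSymplecticFamily (Ω : ℝ → OrbifoldForm X 2) (c c' : ℝ → ℝ) (f : ℝ → N → N) : Prop :=
  ∀ t ∈ Icc (0 : ℝ) 1, ∀ (α β : X.charts), ∀ x ∈ α.1.dom, ∀ y ∈ β.1.dom,
    f t (α.1.proj x) = β.1.proj y → HasSymplecticLift Ω c c' f t α β x y

theorem isSymplecticFamily_id : IsSymplecticFamily Ω c c fun _ => id :=
  fun _ _ _ _ _ hx _ hy h => (hasTransition X _ _ hx hy h).hasSymplecticLift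

theorem IsSymplecticFamily.comp (hg : IsSymplecticFamily Ω c' c'' g)
    (hf : IsSymplecticFamily Ω c c' f) : IsSymplecticFamily Ω c c'' fun s => g s ∘ f s := by
  intro t ht α γ x hx z hz h
  obtain ⟨β, hβ, y, hy, hyf⟩ := X.isAtlas.cover (f t (α.1.proj x))
  refine (hf t ht α ⟨β, hβ⟩ x hx y hy hyf.symm).comp ht (hg t ht ⟨β, hβ⟩ γ y hy z hz ?_)
  rw [← h]
  exact congrArg (g t) hyf

/-- The symplectic lift can be chosen equivariant: shrink the neighbourhood to a convex one that is
invariant under the stabilizer; then the composite of the lift with an element of the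
stabilizer is a second lift, which differs from the first one by a constant element of the
group of the target chart. -/
theorem HasSymplecticLift.exists_equivariant (ht : t ∈ Icc (0 : ℝ) 1)
    (h : HasSymplecticLift Ω c c' f t α β x y) :
    ∃ (J : Set ℝ) (W : Set (OrbModel n)) (F : ℝ → OrbModel n → OrbModel n)
      (θ : α.1.stab x →* β.1.Γ),
      IsOpen J ∧ t ∈ J ∧ IsOpen W ∧ x ∈ W ∧ W ⊆ α.1.dom ∧
      ContDiffOn ℝ ∞ (uncurry F) ((J ∩ Icc 0 1) ×ˢ W) ∧
      ∀ s ∈ J ∩ Icc 0 1, IsSmoothLift (f s) α.1 β.1 W (F s) ∧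
        ∀ γ : α.1.stab x, ∀ y ∈ W, γ.1.1 y ∈ W ∧ F s (γ.1.1 y) = (θ γ).1 (F s y) := by
  obtain ⟨J, W, F, hJ, htJ, hW, hxW, hWd, -, hF, hl⟩ := h
  obtain ⟨ρ, hρ, hρs⟩ := Metric.isOpen_iff.1 hJ t htJ
  obtain ⟨ε, hε, hεs⟩ := Metric.isOpen_iff.1 hW x hxW
  let W' : Set (OrbModel n) := ⋂ γ : α.1.stab x, γ.1.1 ⁻¹' Metric.ball x ε
  have hW'o : IsOpen W' := isOpen_iInter_of_finite fun γ =>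
    Metric.isOpen_ball.preimage γ.1.1.continuous
  have hW'c : Convex ℝ W' := convex_iInter fun γ =>
    (convex_ball x ε).linear_preimage (γ.1.1 : OrbModel n →L[ℝ] OrbModel n).toLinearMap
  have hxW' : x ∈ W' := mem_iInter.2 fun γ => by
    have h1 : γ.1.1 x = x := γ.2
    rw [mem_preimage, h1]
    exact Metric.mem_ball_self hε
  have hW's : W' ⊆ W := fun y hy => hεs (mem_iInter.1 hy 1)
  have hinv : ∀ γ : α.1.stab x, ∀ y ∈ W', γ.1.1 y ∈ W' := fun γ y hy =>
    mem_iInter.2 fun γ' => mem_iInter.1 hy (γ' * γ)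
  have hJs : ∀ s ∈ Metric.ball t ρ ∩ Icc 0 1, s ∈ J ∩ Icc 0 1 := fun s hs => ⟨hρs hs.1, hs.2⟩
  have hF' : ContDiffOn ℝ ∞ (uncurry F) ((Metric.ball t ρ ∩ Icc 0 1) ×ˢ W') :=
    hF.mono fun p hp => ⟨hJs _ hp.1, hW's hp.2⟩
  have hlift : ∀ s ∈ Metric.ball t ρ ∩ Icc 0 1, IsSmoothLift (f s) α.1 β.1 W' (F s) :=
    fun s hs => (hl s (hJs s hs)).1.mono hW's
  have hex : ∀ γ : α.1.stab x, ∃ g : β.1.Γ, ∀ s ∈ Metric.ball t ρ ∩ Icc 0 1, ∀ y ∈ W',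
      F s (γ.1.1 y) = g.1 (F s y) := by
    intro γ
    have h1 : ContDiffOn ℝ ∞ (uncurry fun s y => F s (γ.1.1 y))
        ((Metric.ball t ρ ∩ Icc 0 1) ×ˢ W') :=
      hF'.comp (f := fun p : ℝ × OrbModel n => (p.1, γ.1.1 p.2))
        (contDiffOn_fst.prodMk (γ.1.1.contDiff.comp_contDiffOn contDiffOn_snd))
        fun p hp => ⟨hp.1, hinv γ _ hp.2⟩
    have h2 : ∀ s ∈ Metric.ball t ρ ∩ Icc 0 1,
        IsSmoothLift (f s) α.1 β.1 W' fun y => F s (γ.1.1 y) := by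
      refine fun s hs => ⟨fun y hy => (hlift s hs).mapsTo (hinv γ y hy),
        (hlift s hs).contDiffOn.comp γ.1.1.contDiff.contDiffOn (hinv γ), fun y hy => ?_⟩
      rw [(hlift s hs).covers _ (hinv γ y hy)]
      have hyd := hWd (hW's hy)
      exact congrArg (f s) ((α.1.proj_eq_iff _ hyd _ (α.1.smul_mem_dom _ γ.1.2 _ hyd)).2
        ⟨γ.1.1, γ.1.2, rfl⟩).symm
    obtain ⟨g, hg, hgF⟩ := exists_eq_group_action_of_isPreconnected hW'o
      ((convex_ball t ρ).inter (convex_Icc 0 1)).isPreconnected hW'c.isPreconnected h1 hF' h2 hlift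
      fun s hs y hy => ((hl s (hJs s hs)).2 y (hW's hy)).1
    exact ⟨⟨g, hg⟩, hgF⟩
  choose θ hθ using hex
  have htm : t ∈ Metric.ball t ρ ∩ Icc 0 1 := ⟨Metric.mem_ball_self hρ, ht⟩
  -- an element of the group is determined by its composite with the local diffeomorphism `F t`
  have huniq : ∀ g g' : β.1.Γ, (∀ y ∈ W', g.1 (F t y) = g'.1 (F t y)) → g = g' := by
    intro g g' hgg
    have hd := ((hlift t htm).differentiableAt hW'o hxW').hasFDerivAt
    have h1 := (g.1 : OrbModel n →L[ℝ] OrbModel n).hasFDerivAt.comp x hd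
    have h2 := (g'.1 : OrbModel n →L[ℝ] OrbModel n).hasFDerivAt.comp x hd
    have h3 := h1.unique (h2.congr_of_eventuallyEq (by
      filter_upwards [hW'o.mem_nhds hxW'] with y hy using hgg y hy))
    have hsurj : Surjective (fderiv ℝ (F t) x) := LinearMap.surjective_of_injective
      (f := (fderiv ℝ (F t) x).toLinearMap) ((hl t (hJs t htm)).2 x hxW).1
    refine Subtype.ext (ContinuousLinearEquiv.ext (funext fun v => ?_))
    obtain ⟨u, rfl⟩ := hsurj v
    exact congrArg (fun L : OrbModel n →L[ℝ] OrbModel n => L u) h3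
  refine ⟨Metric.ball t ρ, W', F, MonoidHom.mk' θ fun a b => huniq _ _ fun y hy => ?_,
    Metric.isOpen_ball, Metric.mem_ball_self hρ, hW'o, hxW', hW's.trans hWd, hF', fun s hs =>
    ⟨hlift s hs, fun γ y hy => ⟨hinv γ y hy, hθ γ s hs y hy⟩⟩⟩
  rw [← hθ (a * b) t htm y hy]
  show F t (a.1.1 (b.1.1 y)) = (θ a).1 ((θ b).1 (F t y))
  rw [hθ a t htm _ (hinv b y hy), hθ b t htm y hy]

theorem IsSymplecticFamily.isOrbifoldSmooth (h : IsSymplecticFamily Ω c c' f)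
    (ht : t ∈ Icc (0 : ℝ) 1) : IsOrbifoldSmooth X X (f t) := by
  rintro α β x hx ⟨y, hy, hyf⟩
  obtain ⟨J, W, F, θ, -, htJ, hW, hxW, hWd, -, hl⟩ :=
    (h t ht α β x hx y hy hyf.symm).exists_equivariant ht
  exact ⟨W, F t, θ, hW, hxW, hWd, hl t ⟨htJ, ht⟩⟩

theorem IsSymplecticFamily.pullbackEq (h : IsSymplecticFamily Ω c c' f)
    (ht : t ∈ Icc (0 : ℝ) 1) : PullbackEq (f t) (Ω (c' t)) (Ω (c t)) := by
  intro α β W G hW hWd hG x hx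
  obtain ⟨J, W', F, -, htJ, hW', hxW', -, -, -, hl⟩ :=
    h t ht α β x (hWd hx) (G x) (hG.mapsTo hx) (hG.covers x hx).symm
  obtain ⟨hF, hl⟩ := hl t ⟨htJ, ht⟩
  obtain ⟨g, hg, h1, h2⟩ := IsSmoothLift.exists_eq_group_action (hW.inter hW')
    (hG.mono inter_subset_left) (hF.mono inter_subset_right) ⟨hx, hxW'⟩
  rw [h1, h2, ← (hl x hxW').2, ← (Ω (c' t)).invariant β g hg _ (hF.mapsTo hxW')]
  rfl

end SymplecticLifts

/-! ### The flow of the Moser vector field -/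

section MoserFlow

universe u

variable {n : ℕ} {N : Type u} [TopologicalSpace N] {X : OrbifoldStructure n N}

namespace BallCover

variable {C : BallCover X} {V : C.K → ℝ → OrbModel n → OrbModel n} {Ω : ℝ → OrbifoldForm X 2}
  {δ : ℝ} {e : C.K → ℝ → ℝ × ℝ × OrbModel n → OrbModel n}

/-- The integral curves from time `s` to time `t` define a bijection of the orbifold; its inverse is
given by the reversed curves. -/
theorem IsFlowBox.exists_equiv [T2Space N] (hV : C.IsMoserField Ω V) (he : C.IsFlowBox V δ e)
    {s t : ℝ} (hs : s ∈ Icc (0 : ℝ) 1) (ht : t ∈ Icc (0 : ℝ) 1) (hst : |t - s| ≤ δ) :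
    ∃ f : N ≃ N, ∀ k y, C.IsCurve V k s t y → f (C.proj k (y 0)) = C.proj k (y 1) := by
  choose k x hx hxp using C.cover
  have hshort : ∀ {s t : ℝ}, s ∈ Icc (0 : ℝ) 1 → t ∈ Icc (0 : ℝ) 1 → |t - s| ≤ δ → ∀ p,
      (s, t, x p) ∈ shortTimes δ (Metric.ball (C.center (k p)) (C.radius (k p) / 4)) :=
    fun hs ht h p => ⟨hs, ht, h, hx p⟩
  let d : ℝ → ℝ → N → N := fun s t p => C.proj (k p) (e (k p) 1 (s, t, x p))
  have hd : ∀ {s t : ℝ}, s ∈ Icc (0 : ℝ) 1 → t ∈ Icc (0 : ℝ) 1 → |t - s| ≤ δ → ∀ i y,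
      C.IsCurve V i s t y → d s t (C.proj i (y 0)) = C.proj i (y 1) := by
    intro s t hs ht h i y hy
    have hp := hshort hs ht h (C.proj i (y 0))
    refine IsCurve.proj_eq hV hs ht (he.isCurve _ _ hp) hy ?_ 1 (by simp)
    rw [he.zero _ _ hp]
    exact hxp _
  have hinv : ∀ {s t : ℝ}, s ∈ Icc (0 : ℝ) 1 → t ∈ Icc (0 : ℝ) 1 → |t - s| ≤ δ → ∀ p,
      d t s (d s t p) = p := by
    intro s t hs ht h p
    have hp := hshort hs ht h p
    have h1 := hd ht hs (by rwa [abs_sub_comm]) _ _ (he.isCurve _ _ hp).reverse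
    simp only [sub_zero, sub_self, he.zero _ _ hp] at h1
    exact h1.trans (hxp p)
  exact ⟨⟨d s t, d t s, hinv hs ht hst, hinv ht hs (by rwa [abs_sub_comm])⟩, hd hs ht hst⟩

/-- Families of maps given by the flow over short times have symplectic lifts. -/
theorem IsFlowBox.isSymplecticFamily (hΩ : OrbifoldForm.IsSmoothFamily Ω)
    (hs : ∀ t ∈ Icc (0 : ℝ) 1, (Ω t).IsSymplectic) (hV : C.IsMoserField Ω V)
    (he : C.IsFlowBox V δ e) {c c' : ℝ → ℝ} (hc : ContDiff ℝ ∞ c) (hc' : ContDiff ℝ ∞ c')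
    (hcI : ∀ t ∈ Icc (0 : ℝ) 1, c t ∈ Icc (0 : ℝ) 1)
    (hcI' : ∀ t ∈ Icc (0 : ℝ) 1, c' t ∈ Icc (0 : ℝ) 1)
    (hcc : ∀ t ∈ Icc (0 : ℝ) 1, |c' t - c t| ≤ δ) {f : ℝ → N → N}
    (hf : ∀ t ∈ Icc (0 : ℝ) 1, ∀ k y, C.IsCurve V k (c t) (c' t) y →
      f t (C.proj k (y 0)) = C.proj k (y 1)) :
    IsSymplecticFamily Ω c c' f := by
  intro t ht α β x hx y hy hxy
  obtain ⟨k, a, ha, hap⟩ := C.cover (α.1.proj x)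
  have hshort : ∀ s ∈ Icc (0 : ℝ) 1, ∀ z ∈ Metric.ball (C.center k) (C.radius k / 4),
      (c s, c' s, z) ∈ shortTimes δ (Metric.ball (C.center k) (C.radius k / 4)) :=
    fun s hs z hz => ⟨hcI s hs, hcI' s hs, hcc s hs, hz⟩
  have hsub : Metric.ball (C.center k) (C.radius k / 4) ⊆ C.ball k :=
    Metric.ball_subset_ball (by linarith [C.radius_pos k])
  have hfe : ∀ s ∈ Icc (0 : ℝ) 1, ∀ z ∈ Metric.ball (C.center k) (C.radius k / 4),
      C.proj k (e k 1 (c s, c' s, z)) = f s (C.proj k z) := by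
    intro s hs z hz
    rw [← hf s hs k _ (he.isCurve k _ (hshort s hs z hz)), he.zero k _ (hshort s hs z hz)]
  have hmem : ∀ s ∈ Icc (0 : ℝ) 1, ∀ z ∈ Metric.ball (C.center k) (C.radius k / 4),
      e k 1 (c s, c' s, z) ∈ C.ball k := fun s hs z hz =>
    (he.isCurve k _ (hshort s hs z hz) 1 (by simp)).1
  have h1 : HasSymplecticLift Ω c c (fun _ => id) t α (C.chart k) x a :=
    (hasTransition X α (C.chart k) hx (C.ball_subset k (hsub ha)) hap.symm).hasSymplecticLift
  have h3 : HasSymplecticLift Ω c' c' (fun _ => id) t (C.chart k) β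
      (e k 1 (c t, c' t, a)) y := by
    refine (hasTransition X (C.chart k) β (C.ball_subset k (hmem t ht a ha)) hy
      ?_).hasSymplecticLift
    rw [← hxy, ← hap]
    exact hfe t ht a ha
  have h2 : HasSymplecticLift Ω c c' f t (C.chart k) (C.chart k) a (e k 1 (c t, c' t, a)) := by
    have hsm : ContDiffOn ℝ ∞ (uncurry fun s z => e k 1 (c s, c' s, z))
        (Icc 0 1 ×ˢ Metric.ball (C.center k) (C.radius k / 4)) :=
      (he.contDiffOn k).comp (f := fun p : ℝ × OrbModel n => (c p.1, c' p.1, p.2)) (by fun_prop)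
        fun p hp => hshort p.1 hp.1 p.2 hp.2
    refine ⟨univ, Metric.ball (C.center k) (C.radius k / 4), fun s z => e k 1 (c s, c' s, z),
      isOpen_univ, mem_univ _, Metric.isOpen_ball, ha, hsub.trans (C.ball_subset k), rfl,
      hsm.mono (prod_mono_left inter_subset_right), ?_⟩
    rintro s ⟨-, hsI⟩
    refine ⟨⟨fun z hz => C.ball_subset k (hmem s hsI z hz), hsm.uncurry_left hsI,
      fun z hz => hfe s hsI z hz⟩, fun z hz => ?_⟩
    have hb := he.bilin_apply hΩ hV (hshort s hsI z hz)
    constructor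
    · refine (injective_iff_map_eq_zero _).2 fun v hv => ?_
      obtain ⟨E, hE⟩ := isInvertible_bilin (C := C) (hs _ (hcI s hsI)) (hsub hz)
      refine E.injective (ContinuousLinearMap.ext fun w => ?_)
      have h4 := hb v w
      rw [hv, ← hE] at h4
      simpa using h4.symm
    · refine ext_of_bilinearOfAlternating fun u v => ?_
      rw [bilinearOfAlternating_compContinuousLinearMap]
      exact hb u v
  have h12 : HasSymplecticLift Ω c c' f t α (C.chart k) x (e k 1 (c t, c' t, a)) := h1.comp ht h2
  exact HasSymplecticLift.comp (g := fun _ => id) ht h12 h3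

/-- The flow over the times from `t` to `0` is composed from flows over short times. -/
theorem exists_isSymplecticFamily [T2Space N] (hΩ : OrbifoldForm.IsSmoothFamily Ω)
    (hs : ∀ t ∈ Icc (0 : ℝ) 1, (Ω t).IsSymplectic) (hV : C.IsMoserField Ω V) :
    ∃ Φ : ℝ → N ≃ N, IsSymplecticFamily Ω id (fun _ => 0) (fun t => Φ t) ∧
      IsSymplecticFamily Ω (fun _ => 0) id (fun t => (Φ t).symm) := by
  obtain ⟨δ, hδ, e, he⟩ := exists_isFlowBox hV
  obtain ⟨m, hm⟩ := exists_nat_one_div_lt hδ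
  have hm0 : (0 : ℝ) < m + 1 := by positivity
  have hcI : ∀ j : ℕ, j ≤ m + 1 → ∀ t ∈ Icc (0 : ℝ) 1, t * j / (m + 1) ∈ Icc (0 : ℝ) 1 := by
    intro j hj t ht
    have hj' : (j : ℝ) ≤ m + 1 := by exact_mod_cast hj
    refine ⟨div_nonneg (mul_nonneg ht.1 j.cast_nonneg) hm0.le, (div_le_one hm0).2 ?_⟩
    nlinarith [ht.1, ht.2, (Nat.cast_nonneg j : (0 : ℝ) ≤ j)]
  have hdiff : ∀ j : ℕ, ∀ t ∈ Icc (0 : ℝ) 1,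
      |t * (j + 1 : ℕ) / (m + 1) - t * j / (m + 1)| ≤ δ := by
    intro j t ht
    have h1 : t * (j + 1 : ℕ) / (m + 1) - t * j / (m + 1) = t * (1 / ((m : ℝ) + 1)) := by
      push_cast
      ring
    rw [h1, abs_of_nonneg (mul_nonneg ht.1 (by positivity))]
    exact (mul_le_of_le_one_left (by positivity) ht.2).trans hm.le
  have hcs : ∀ j : ℕ, ContDiff ℝ ∞ fun t : ℝ => t * j / (m + 1) := fun j => by fun_prop
  have key : ∀ j : ℕ, j ≤ m + 1 → ∃ Φ : ℝ → N ≃ N,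
      IsSymplecticFamily Ω (fun t => t * j / (m + 1)) (fun _ => 0) (fun t => Φ t) ∧
      IsSymplecticFamily Ω (fun _ => 0) (fun t => t * j / (m + 1)) (fun t => (Φ t).symm) := by
    intro j
    induction j with
    | zero =>
      intro _
      simp only [Nat.cast_zero, mul_zero, zero_div]
      exact ⟨fun _ => Equiv.refl N, isSymplecticFamily_id, isSymplecticFamily_id⟩
    | succ j ih =>
      intro hj
      obtain ⟨Φ, hΦ, hΦ'⟩ := ih (by omega)
      have hex : ∀ t : ℝ, ∃ f : N ≃ N, t ∈ Icc (0 : ℝ) 1 → ∀ k y,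
          C.IsCurve V k (t * (j + 1 : ℕ) / (m + 1)) (t * j / (m + 1)) y →
            f (C.proj k (y 0)) = C.proj k (y 1) := by
        intro t
        by_cases ht : t ∈ Icc (0 : ℝ) 1
        · obtain ⟨f, hf⟩ := he.exists_equiv hV (hcI (j + 1) hj t ht) (hcI j (by omega) t ht)
            (by rw [abs_sub_comm]; exact hdiff j t ht)
          exact ⟨f, fun _ => hf⟩
        · exact ⟨Equiv.refl N, fun h => absurd h ht⟩
      choose f hf using hex
      have hf' : ∀ t ∈ Icc (0 : ℝ) 1, ∀ k y,
          C.IsCurve V k (t * j / (m + 1)) (t * (j + 1 : ℕ) / (m + 1)) y →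
            (f t).symm (C.proj k (y 0)) = C.proj k (y 1) := by
        intro t ht k y hy
        have h1 := hf t ht k _ hy.reverse
        simp only [sub_zero, sub_self] at h1
        rw [← h1, Equiv.symm_apply_apply]
      have h1 := he.isSymplecticFamily hΩ hs hV (hcs (j + 1)) (hcs j) (hcI (j + 1) hj)
        (hcI j (by omega)) (fun t ht => by rw [abs_sub_comm]; exact hdiff j t ht)
        (f := fun t => f t) hf
      have h2 := he.isSymplecticFamily hΩ hs hV (hcs j) (hcs (j + 1)) (hcI j (by omega))
        (hcI (j + 1) hj) (hdiff j) (f := fun t => (f t).symm) hf'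
      exact ⟨fun t => (f t).trans (Φ t), hΦ.comp h1, h2.comp hΦ'⟩
  have h1 : (fun t : ℝ => t * (m + 1 : ℕ) / (m + 1)) = id := by
    funext t
    push_cast
    exact mul_div_cancel_right₀ t hm0.ne'
  have := key (m + 1) le_rfl
  rwa [h1] at this

end BallCover

end MoserFlow

theorem mainTheorem10 {n : ℕ} (hn : 2 ≤ n) {N : Type*} [TopologicalSpace N] [T2Space N]
    [CompactSpace N] (X : OrbifoldStructure n N) (Ω : ℝ → OrbifoldForm X 2)
    (hΩ_smooth : OrbifoldForm.IsSmoothFamily Ω)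
    (hΩ_symp : ∀ t ∈ Icc (0 : ℝ) 1, (Ω t).IsSymplectic)
    (hΩ_class : ∀ s ∈ Icc (0 : ℝ) 1, ∀ t ∈ Icc (0 : ℝ) 1, (Ω s).Cohomologous (Ω t)) :
    ∃ Ψ : ℝ → OrbifoldDiffeo X X,
      OrbifoldDiffeo.IsSmoothFamily Ψ ∧
      ∀ t ∈ Icc (0 : ℝ) 1, PullbackEq (Ψ t).toEquiv (Ω 0) (Ω t) := by
  obtain ⟨C⟩ := nonempty_ballCover X
  obtain ⟨V, hV⟩ := BallCover.exists_isMoserField C hΩ_smooth hΩ_symp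
    fun t ht => hΩ_class 0 (by simp) t ht
  obtain ⟨Φ, hΦ, hΦ'⟩ := BallCover.exists_isSymplecticFamily hΩ_smooth hΩ_symp hV
  -- outside of `[0,1]` the family is extended by constants
  let π : ℝ → ℝ := fun t => projIcc (0 : ℝ) 1 zero_le_one t
  have hπ : ∀ t, π t ∈ Icc (0 : ℝ) 1 := fun t => (projIcc (0 : ℝ) 1 zero_le_one t).2
  have hπ' : ∀ t ∈ Icc (0 : ℝ) 1, π t = t := fun t ht =>
    congrArg Subtype.val (projIcc_of_mem zero_le_one ht)
  refine ⟨fun t => ⟨Φ (π t), hΦ.isOrbifoldSmooth (hπ t), hΦ'.isOrbifoldSmooth (hπ t)⟩, ?_,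
    fun t ht => ?_⟩
  · rintro α β t ht x hx ⟨y, hy, hyf⟩
    simp only [hπ' t ht] at hyf
    obtain ⟨J, W, F, θ, hJ, htJ, hW, hxW, hWd, hF, hl⟩ :=
      (hΦ t ht α β x hx y hy hyf.symm).exists_equivariant ht
    refine ⟨J, W, F, θ, hJ, htJ, hW, hxW, hWd, hF, fun s hs => ?_⟩
    simp only [hπ' s hs.2]
    exact hl s hs
  · simp only [hπ' t ht]
    exact hΦ.pullbackEq ht
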